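/- Let $n\ge 0$ be an integer, $\tau$ a point of the upper half-plane, $\hbar,\kappa\in\mathbb C$ with $\hbar\neq0$, and let $\wp(z)$, $\sigma(z)$ be the Weierstrass functions with periods $1,\tau$. Let $V=\mathbb C^n$ with coordinates $x_1,\dots,x_n$, let $\mathbb C(V)$ be the field of meromorphic functions on $V$ and $\mathcal D(V)$ the algebra of differential operators on $V$ with meromorphic coefficients. The symmetric group $S_n$ acts on these by permuting coordinates; let $\mathcal D(V)*S_n$ be the crossed product. It also acts diagonally on $\mathcal D(V)\otimes\mathbb CS_n$, by $a\otimes\hat u\mapsto w.a\otimes\widehat{wuw^{-1}}$, where $\hat w$ denotes $w\in S_n$ as an element of the second tensor factor. Put $$\widehat{\mathrm{Res}}:\ \mathcal D(V)*S_n\to\mathcal D(V)\otimes\mathbb CS_n,\qquad \sum_w a_w w\mapsto\sum_w a_w\otimes\widehat{w^{-1}}.$$ Let $A_0=\mathbb C(V)[p_1,\dots,p_n]$, with $S_n$ permuting the $x_i$ and the $p_i$ simultaneously. For a symmetric polynomial $q\in\mathbb C[e_1,\dots,e_n]^{S_n}$ let $L^{\rm rat}_{q,c}=\mathrm{Res}\,q(y^{\rm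 rat}_{1,c},\dots,y^{\rm rat}_{n,c})\in A_0$, where $$y^{\rm rat}_{i,c}=p_i-\kappa\sum_{j\ne i}\frac1{x_i-x_j}s_{ij}\in A_0*S_n$$ are the (pairwise commuting) classical rational Dunkl operators and $\mathrm{Res}\bigl(\sum_w a_ww\bigr)=\sum_w a_w$. For $\lambda=(\lambda_1,\dots,\lambda_n)\in\mathbb C^n$ with $\lambda_i-\lambda_j\notin\mathbb Z+\mathbb Z\tau$ for all $i\ne j$, let $$y_i(\lambda)=\hbar\frac{\partial}{\partial x_i}-\kappa\sum_{j\neq i}\phi(\lambda_i-\lambda_j,x_i-x_j)s_{ij}\in\mathcal D(V)*S_n,\qquad \phi(\mu,z)=\frac{\sigma(z-\mu)}{\sigma(z)\sigma(-\mu)},$$ be the (pairwise commuting) elliptic Dunkl operators, and let $L^{\rm rat}_{q,c}(\lambda,y)\in\mathcal D(V)*S_n$ be obtained from $L^{\rm rat}_{q,c}$ by replacing $x_i$ with $\lambda_i$ in the coefficients and $p_i$ with $y_i(\lambda)$. Then for every symmetric $q$ the element $L^{\rm rat}_{q,c}(\lambda,y)$ is regular in $\lambda$ near $\lambda=0$,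 so that it has a well-defined limit at $\lambda=0$. Put $\widehat L_q=\widehat{\mathrm{Res}}\lim_{\lambda\to0}L^{\rm rat}_{q,c}(\lambda,y)$. The set $\{\widehat L_q : q\in\mathbb C[e_1,\dots,e_n]^{S_n}\}$ is a commutative subalgebra of $(\mathcal D(V)\otimes\mathbb C S_n)^{S_n}$. It contains the total momentum and the spin elliptic Calogero–Moser Hamiltonian; precisely, with $\partial_i=\partial/\partial x_i$, $$\widehat L_q=\sum_{i=1}^n\hbar\partial_i\ \text{ for } q=\sum_i e_i,\qquad \widehat L_q=\sum_{i=1}^n\hbar^2\partial_i^2-2\sum_{i<j}\wp(x_i-x_j)\,\kappa(\kappa-\hbar\hat s_{ij})\ \text{ for } q=\sum_i e_i^2 .$$ -/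

import Mathlib

open scoped TensorProduct

noncomputable section

namespace SpinCM

/-! ### Entire and meromorphic functions on `V = ℂⁿ` -/

/-- The ring `𝒪(V)` of entire functions on `V = ℂⁿ`. -/
def entireSubalgebra (n : ℕ) : Subalgebra ℂ ((Fin n → ℂ) → ℂ) where
  carrier := {f | ∀ x, AnalyticAt ℂ f x}
  mul_mem' hf hg x := (hf x).mul (hg x)
  add_mem' hf hg x := (hf x).add (hg x)
  algebraMap_mem' c _ := analyticAt_const (v := c)

def Entire (n : ℕ) : Type := entireSubalgebra n

instance (n : ℕ) : CommRing (Entire n) := inferInstanceAs (CommRing (entireSubalgebra n))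
instance (n : ℕ) : Algebra ℂ (Entire n) := inferInstanceAs (Algebra ℂ (entireSubalgebra n))

/-- By the identity theorem, `𝒪(V)` is an integral domain. -/
instance (n : ℕ) : IsDomain (Entire n) := by
  have : NoZeroDivisors (Entire n) := by
    refine ⟨fun {a b} hab => ?_⟩
    by_contra! h
    obtain ⟨ha, hb⟩ := h
    obtain ⟨x, hx⟩ : ∃ x, a.1 x ≠ 0 := by
      by_contra! h0
      exact ha (Subtype.ext (funext h0))
    apply hb
    have hab' : ∀ y, a.1 y * b.1 y = 0 := fun y => congrFun (congrArg Subtype.val hab) y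
    have hev : b.1 =ᶠ[nhds x] fun _ => 0 := by
      filter_upwards [(a.2 x).continuousAt.eventually_ne hx] with y hy
      exact (mul_eq_zero.mp (hab' y)).resolve_left hy
    exact Subtype.ext (AnalyticOnNhd.eq_of_eventuallyEq (𝕜 := ℂ) (z₀ := x)
      (fun y _ => b.2 y) (fun y _ => analyticAt_const) hev)
  have : Nontrivial (Entire n) :=
    ⟨⟨0, 1, fun h => zero_ne_one (congrFun (congrArg Subtype.val h) 0)⟩⟩
  exact NoZeroDivisors.to_isDomain _

/-- The field `ℂ(V)` of meromorphic functions on `V = ℂⁿ`, as the field of fractions of the ring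
of entire functions (every meromorphic function on `ℂⁿ` is a quotient of two entire functions). -/
def Mer (n : ℕ) : Type := FractionRing (Entire n)

instance (n : ℕ) : Field (Mer n) := inferInstanceAs (Field (FractionRing (Entire n)))
instance (n : ℕ) : Algebra ℂ (Mer n) := inferInstanceAs (Algebra ℂ (FractionRing (Entire n)))
instance (n : ℕ) : Algebra (Entire n) (Mer n) :=
  inferInstanceAs (Algebra (Entire n) (FractionRing (Entire n)))
instance (n : ℕ) : IsScalarTower ℂ (Entire n) (Mer n) :=
  inferInstanceAs (IsScalarTower ℂ (Entire n) (FractionRing (Entire n)))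
instance (n : ℕ) : IsFractionRing (Entire n) (Mer n) :=
  inferInstanceAs (IsFractionRing (Entire n) (FractionRing (Entire n)))

/-- `F : V → ℂ` gives the values of the meromorphic function `f`: for some presentation `f = a / b`
with `a`, `b` entire, `b ≠ 0`, one has `F x = a x / b x` wherever `b x ≠ 0`. The values of `F` on
the zero set of `b` do not matter. -/
def Represents {n : ℕ} (f : Mer n) (F : (Fin n → ℂ) → ℂ) : Prop :=
  ∃ a b : Entire n, b ≠ 0 ∧ f = algebraMap (Entire n) (Mer n) a / algebraMap (Entire n) (Mer n) b ∧
    ∀ x, b.1 x ≠ 0 → F x = a.1 x / b.1 x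

/-- A function on `V` represents at most one meromorphic function. -/
theorem Represents.unique {n : ℕ} {f g : Mer n} {F : (Fin n → ℂ) → ℂ}
    (hf : Represents f F) (hg : Represents g F) : f = g := by
  obtain ⟨a, b, hb, rfl, h⟩ := hf
  obtain ⟨a', b', hb', rfl, h'⟩ := hg
  have key : (a * b' - a' * b) * (b * b') = 0 := by
    apply Subtype.ext
    funext x
    change (a.1 x * b'.1 x - a'.1 x * b.1 x) * (b.1 x * b'.1 x) = 0
    by_cases h1 : b.1 x = 0
    · simp [h1]
    by_cases h2 : b'.1 x = 0
    · simp [h2]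
    have e := (h x h1).symm.trans (h' x h2)
    rw [div_eq_div_iff h1 h2] at e
    rw [e, sub_self, zero_mul]
  have h0 : a * b' = a' * b := by
    rcases mul_eq_zero.mp key with h | h
    · exact sub_eq_zero.mp h
    · exact absurd h (mul_ne_zero hb hb')
  have inj := IsFractionRing.injective (Entire n) (Mer n)
  have i1 : algebraMap (Entire n) (Mer n) b ≠ 0 := (map_ne_zero_iff _ inj).mpr hb
  have i2 : algebraMap (Entire n) (Mer n) b' ≠ 0 := (map_ne_zero_iff _ inj).mpr hb'
  rw [div_eq_div_iff i1 i2, ← map_mul, ← map_mul, h0]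

open Classical in
/-- The meromorphic function on `V` whose values are given by `F`. -/
def ofFun {n : ℕ} (F : (Fin n → ℂ) → ℂ) : Mer n :=
  if h : ∃ f : Mer n, Represents f F then h.choose else 0

theorem ofFun_eq {n : ℕ} {f : Mer n} {F : (Fin n → ℂ) → ℂ} (h : Represents f F) : ofFun F = f := by
  have hex : ∃ f : Mer n, Represents f F := ⟨f, h⟩
  rw [ofFun, dif_pos hex]
  exact hex.choose_spec.unique h

open Classical in
/-- The value of a meromorphic function `f` at a point `v` where it is regular: `a v / b v` for any
presentation `f = a / b` with `b v ≠ 0`. -/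
def valueAt {n : ℕ} (v : Fin n → ℂ) (f : Mer n) : ℂ :=
  if h : ∃ p : Entire n × Entire n, p.2.1 v ≠ 0 ∧
      f = algebraMap (Entire n) (Mer n) p.1 / algebraMap (Entire n) (Mer n) p.2
  then h.choose.1.1 v / h.choose.2.1 v else 0

theorem valueAt_div {n : ℕ} (v : Fin n → ℂ) (a b : Entire n) (hb : b.1 v ≠ 0) :
    valueAt v (algebraMap (Entire n) (Mer n) a / algebraMap (Entire n) (Mer n) b)
      = a.1 v / b.1 v := by
  have hex : ∃ p : Entire n × Entire n, p.2.1 v ≠ 0 ∧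
      algebraMap (Entire n) (Mer n) a / algebraMap (Entire n) (Mer n) b
        = algebraMap (Entire n) (Mer n) p.1 / algebraMap (Entire n) (Mer n) p.2 := ⟨(a, b), hb, rfl⟩
  rw [valueAt, dif_pos hex]
  obtain ⟨h1, h2⟩ := hex.choose_spec
  set p := hex.choose
  have inj := IsFractionRing.injective (Entire n) (Mer n)
  have nz : ∀ c : Entire n, c.1 v ≠ 0 → algebraMap (Entire n) (Mer n) c ≠ 0 := fun c hc =>
    (map_ne_zero_iff _ inj).mpr fun h => hc (by rw [h]; rfl)
  rw [div_eq_div_iff (nz b hb) (nz _ h1), ← map_mul, ← map_mul] at h2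
  have h3 : a.1 v * p.2.1 v = p.1.1 v * b.1 v := congrFun (congrArg Subtype.val (inj h2)) v
  rw [div_eq_div_iff h1 hb, h3]

/-! ### Partial derivatives and the action of `S_n` on `ℂ(V)` -/

section Extend

variable {R A K : Type} [CommRing R] [CommRing A] [IsDomain A] [Field K] [Algebra R A] [Algebra R K]
  [Algebra A K] [IsScalarTower R A K] [IsFractionRing A K]

/-- `f ↦ f + ε d f`, with values in the dual numbers over the field of fractions. -/
def dualOfDerivation (d : Derivation R A A) : K →ₐ[R] TrivSqZeroExt K K :=
  IsLocalization.liftAlgHom (M := nonZeroDivisors A) (A := R)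
    (f :=
      { toFun := fun f =>
          TrivSqZeroExt.inl (algebraMap A K f) + TrivSqZeroExt.inr (algebraMap A K (d f))
        map_one' := by apply TrivSqZeroExt.ext <;> simp
        map_mul' := fun x y => by
          apply TrivSqZeroExt.ext
          · simp
          · simp only [Derivation.leibniz, smul_eq_mul, map_add, map_mul, TrivSqZeroExt.snd_add,
              TrivSqZeroExt.snd_mul, TrivSqZeroExt.snd_inl, TrivSqZeroExt.snd_inr,
              TrivSqZeroExt.fst_add, TrivSqZeroExt.fst_inl, TrivSqZeroExt.fst_inr,
              MulOpposite.smul_eq_mul_unop, MulOpposite.unop_op]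
            ring
        map_zero' := by apply TrivSqZeroExt.ext <;> simp
        map_add' := fun x y => by
          rw [map_add, map_add, map_add, TrivSqZeroExt.inl_add, TrivSqZeroExt.inr_add]
          abel
        commutes' := fun r => by
          apply TrivSqZeroExt.ext
          · simp [TrivSqZeroExt.algebraMap_eq_inl', ← IsScalarTower.algebraMap_apply]
          · simp [TrivSqZeroExt.algebraMap_eq_inl'] })
    (fun y => by
      rw [TrivSqZeroExt.isUnit_iff_isUnit_fst]
      simp)

theorem dualOfDerivation_algebraMap (d : Derivation R A A) (f : A) :
    dualOfDerivation d (algebraMap A K f) =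
      TrivSqZeroExt.inl (algebraMap A K f) + TrivSqZeroExt.inr (algebraMap A K (d f)) := by
  rw [dualOfDerivation, IsLocalization.liftAlgHom_apply, IsLocalization.lift_eq]
  rfl

theorem fst_dualOfDerivation (d : Derivation R A A) (f : K) :
    (dualOfDerivation d f).fst = f := by
  have : (TrivSqZeroExt.fstHom R K K).comp (dualOfDerivation d) = AlgHom.id R K := by
    refine IsLocalization.algHom_ext (nonZeroDivisors A) ?_
    ext x
    change (dualOfDerivation d (algebraMap A K x)).fst = algebraMap A K x
    simp [dualOfDerivation_algebraMap]
  exact congrArg (fun φ : K →ₐ[R] K => φ f) this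

/-- The extension of a derivation of an integral domain to its field of fractions. -/
def extendDerivation (d : Derivation R A A) : Derivation R K K :=
  Derivation.mk'
    { toFun := fun f => (dualOfDerivation d f).snd
      map_add' := fun f g => by simp
      map_smul' := fun c f => by simp }
    (fun f g => by simp [fst_dualOfDerivation, mul_comm])

theorem extendDerivation_algebraMap (d : Derivation R A A) (f : A) :
    extendDerivation d (algebraMap A K f) = algebraMap A K (d f) := by
  change (dualOfDerivation d (algebraMap A K f)).snd = _
  rw [dualOfDerivation_algebraMap, TrivSqZeroExt.snd_add, TrivSqZeroExt.snd_inl,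
    TrivSqZeroExt.snd_inr, zero_add]

end Extend

/-- `∂_i` on entire functions. -/
def pdEntire {n : ℕ} (i : Fin n) : Derivation ℂ (Entire n) (Entire n) :=
  Derivation.mk'
    { toFun := fun f => ⟨fun x => fderiv ℂ f.1 x (Pi.single i 1), fun x =>
        ((ContinuousLinearMap.apply ℂ ℂ (Pi.single i 1 : Fin n → ℂ)).analyticAt _).comp
          (AnalyticAt.fderiv (f.2 x))⟩
      map_add' := fun f g => Subtype.ext <| funext fun x => by
        have := fderiv_add (f.2 x).differentiableAt (g.2 x).differentiableAt
        exact congrArg (fun L => L (Pi.single i 1)) this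
      map_smul' := fun c f => Subtype.ext <| funext fun x => by
        have := fderiv_const_smul (f.2 x).differentiableAt c
        exact congrArg (fun L => L (Pi.single i 1)) this }
    (fun f g => Subtype.ext <| funext fun x => by
      have := fderiv_mul (f.2 x).differentiableAt (g.2 x).differentiableAt
      exact congrArg (fun L => L (Pi.single i 1)) this)

/-- The partial derivative `∂_i = ∂/∂x_i` on `ℂ(V)`, extended from entire functions by the
quotient rule. -/
def pd {n : ℕ} (i : Fin n) : Derivation ℂ (Mer n) (Mer n) := extendDerivation (pdEntire i)

theorem pd_algebraMap {n : ℕ} (i : Fin n) (f : Entire n) :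
    pd i (algebraMap (Entire n) (Mer n) f) = algebraMap (Entire n) (Mer n) (pdEntire i f) :=
  extendDerivation_algebraMap _ _

/-- The action of `w ∈ S_n` on entire functions: `(w.f)(x) = f(w⁻¹.x)`, where `S_n` permutes the
standard basis of `V`, that is, `(w⁻¹.x)_i = x_{w i}`. -/
def permEntire {n : ℕ} (w : Equiv.Perm (Fin n)) : Entire n →ₐ[ℂ] Entire n where
  toFun f := ⟨fun x => f.1 (fun i => x (w i)), fun x =>
    (f.2 _).comp (f := fun x : Fin n → ℂ => fun i => x (w i))
      ((LinearMap.toContinuousLinearMap (LinearMap.funLeft ℂ ℂ w)).analyticAt x)⟩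
  map_one' := rfl
  map_mul' _ _ := rfl
  map_zero' := rfl
  map_add' _ _ := rfl
  commutes' _ := rfl

theorem permEntire_injective {n : ℕ} (w : Equiv.Perm (Fin n)) :
    Function.Injective (permEntire w) := by
  intro f g h
  apply Subtype.ext
  funext x
  have h' : f.1 (fun i => x (w⁻¹ (w i))) = g.1 (fun i => x (w⁻¹ (w i))) :=
    congrFun (congrArg Subtype.val h) (fun i => x (w⁻¹ i))
  simpa using h'

theorem pdEntire_permEntire {n : ℕ} (w : Equiv.Perm (Fin n)) (i : Fin n) (f : Entire n) :
    pdEntire (w i) (permEntire w f) = permEntire w (pdEntire i f) := by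
  apply Subtype.ext
  funext x
  change fderiv ℂ (fun x : Fin n → ℂ => f.1 (fun j => x (w j))) x (Pi.single (w i) 1) =
    fderiv ℂ f.1 (fun j => x (w j)) (Pi.single i 1)
  set L : (Fin n → ℂ) →L[ℂ] (Fin n → ℂ) := LinearMap.toContinuousLinearMap (LinearMap.funLeft ℂ ℂ w)
  have hL : ∀ y, L y = fun j => y (w j) := fun y => rfl
  have h := fderiv_comp x (g := f.1) (f := L) (f.2 (L x)).differentiableAt L.differentiableAt
  have h2 : fderiv ℂ (fun x : Fin n → ℂ => f.1 (fun j => x (w j))) x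
      = (fderiv ℂ f.1 (L x)).comp L := by
    rw [L.fderiv] at h
    exact h
  rw [h2, ContinuousLinearMap.comp_apply]
  have h3 : L (Pi.single (w i) 1) = Pi.single i 1 := by
    rw [hL]
    funext j
    simp [Pi.single_apply]
  rw [h3, hL]

theorem Mer.algHom_ext {n : ℕ} {φ ψ : Mer n →ₐ[ℂ] Mer n}
    (h : ∀ f : Entire n, φ (algebraMap _ _ f) = ψ (algebraMap _ _ f)) : φ = ψ :=
  IsLocalization.algHom_ext (nonZeroDivisors (Entire n)) (AlgHom.ext h)

/-- The extension of `permEntire w` to meromorphic functions. -/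
def permMerHom {n : ℕ} (w : Equiv.Perm (Fin n)) : Mer n →ₐ[ℂ] Mer n :=
  IsLocalization.liftAlgHom (M := nonZeroDivisors (Entire n))
    (f := (IsScalarTower.toAlgHom ℂ (Entire n) (Mer n)).comp (permEntire w)) fun y => by
      have hy : permEntire w y ≠ 0 :=
        (map_ne_zero_iff _ (permEntire_injective w)).mpr (nonZeroDivisors.ne_zero y.2)
      exact isUnit_iff_ne_zero.mpr
        ((map_ne_zero_iff _ (IsFractionRing.injective (Entire n) (Mer n))).mpr hy)

theorem permMerHom_algebraMap {n : ℕ} (w : Equiv.Perm (Fin n)) (f : Entire n) :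
    permMerHom w (algebraMap _ (Mer n) f) = algebraMap _ (Mer n) (permEntire w f) := by
  rw [permMerHom, IsLocalization.liftAlgHom_apply, IsLocalization.lift_eq]
  rfl

/-- The action of `S_n` on meromorphic functions. -/
def permMer {n : ℕ} : Equiv.Perm (Fin n) →* (Mer n →ₐ[ℂ] Mer n) where
  toFun := permMerHom
  map_one' := Mer.algHom_ext fun f => permMerHom_algebraMap 1 f
  map_mul' w w' := Mer.algHom_ext fun f => by
    rw [AlgHom.mul_apply, permMerHom_algebraMap, permMerHom_algebraMap, permMerHom_algebraMap]
    rfl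

theorem permMer_algebraMap {n : ℕ} (w : Equiv.Perm (Fin n)) (f : Entire n) :
    permMer w (algebraMap _ (Mer n) f) = algebraMap _ (Mer n) (permEntire w f) :=
  permMerHom_algebraMap w f

theorem pd_permMer {n : ℕ} (w : Equiv.Perm (Fin n)) (i : Fin n) (f : Mer n) :
    pd (w i) (permMer w f) = permMer w (pd i f) := by
  obtain ⟨a, b, hb, rfl⟩ := IsFractionRing.div_surjective (A := Entire n) f
  simp only [map_div₀, Derivation.leibniz_div, permMer_algebraMap, pd_algebraMap, map_mul,
    map_sub, map_pow, map_inv₀, smul_eq_mul, pdEntire_permEntire]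

/-! ### Differential operators, crossed products -/

/-- The algebra `𝒟(V)` of differential operators with meromorphic coefficients, generated inside
`End_ℂ ℂ(V)` by the multiplications by meromorphic functions and the `∂_i`. -/
def diffOpSubalgebra (n : ℕ) : Subalgebra ℂ (Module.End ℂ (Mer n)) :=
  Algebra.adjoin ℂ
    (Set.range (LinearMap.mulLeft ℂ : Mer n → Module.End ℂ (Mer n)) ∪
      Set.range fun i : Fin n => (pd i).toLinearMap)

/-- `𝒟(V)` as a type. -/
def DiffOp (n : ℕ) : Type := diffOpSubalgebra n

instance (n : ℕ) : Ring (DiffOp n) := inferInstanceAs (Ring (diffOpSubalgebra n))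
instance (n : ℕ) : Algebra ℂ (DiffOp n) := inferInstanceAs (Algebra ℂ (diffOpSubalgebra n))

/-- Multiplication by a meromorphic function, as a differential operator. -/
def mulOp {n : ℕ} (g : Mer n) : DiffOp n :=
  ⟨LinearMap.mulLeft ℂ g, Algebra.subset_adjoin (Or.inl ⟨g, rfl⟩)⟩

/-- `∂_i` as a differential operator. -/
def dOp {n : ℕ} (i : Fin n) : DiffOp n :=
  ⟨(pd i).toLinearMap, Algebra.subset_adjoin (Or.inr ⟨i, rfl⟩)⟩

/-- The conjugation `a ↦ w a w⁻¹` on `End_ℂ ℂ(V)`. -/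
def conjEnd {n : ℕ} (w : Equiv.Perm (Fin n)) (a : Module.End ℂ (Mer n)) : Module.End ℂ (Mer n) :=
  (permMer w).toLinearMap ∘ₗ a ∘ₗ (permMer w⁻¹).toLinearMap

theorem permMer_inv_apply {n : ℕ} (w : Equiv.Perm (Fin n)) (f : Mer n) :
    permMer w⁻¹ (permMer w f) = f := by
  rw [← AlgHom.mul_apply, ← map_mul, inv_mul_cancel, map_one, AlgHom.one_apply]

theorem permMer_apply_inv {n : ℕ} (w : Equiv.Perm (Fin n)) (f : Mer n) :
    permMer w (permMer w⁻¹ f) = f := by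
  rw [← AlgHom.mul_apply, ← map_mul, mul_inv_cancel, map_one, AlgHom.one_apply]

theorem conjEnd_mem {n : ℕ} (w : Equiv.Perm (Fin n)) {a : Module.End ℂ (Mer n)}
    (ha : a ∈ diffOpSubalgebra n) : conjEnd w a ∈ diffOpSubalgebra n := by
  induction ha using Algebra.adjoin_induction with
  | mem x hx =>
    rcases hx with ⟨g, rfl⟩ | ⟨i, rfl⟩
    · have : conjEnd w (LinearMap.mulLeft ℂ g) = LinearMap.mulLeft ℂ (permMer w g) := by
        ext f
        simp [conjEnd, permMer_apply_inv]
      rw [this]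
      exact Algebra.subset_adjoin (Or.inl ⟨_, rfl⟩)
    · have : conjEnd w (pd i).toLinearMap = (pd (w i)).toLinearMap := by
        ext f
        change permMer w (pd i (permMer w⁻¹ f)) = pd (w i) f
        rw [← pd_permMer, permMer_apply_inv]
      rw [this]
      exact Algebra.subset_adjoin (Or.inr ⟨_, rfl⟩)
  | algebraMap r =>
    have : conjEnd w (algebraMap ℂ _ r) = algebraMap ℂ _ r := by
      ext f
      simp [conjEnd, permMer_apply_inv, Module.algebraMap_end_apply]
    rw [this]
    exact Subalgebra.algebraMap_mem _ r
  | add x y _ _ hx hy =>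
    have : conjEnd w (x + y) = conjEnd w x + conjEnd w y := by
      ext f
      simp [conjEnd]
    rw [this]
    exact add_mem hx hy
  | mul x y _ _ hx hy =>
    have : conjEnd w (x * y) = conjEnd w x * conjEnd w y := by
      ext f
      simp [conjEnd, permMer_inv_apply]
    rw [this]
    exact mul_mem hx hy

/-- The action of `S_n` on `𝒟(V)` by automorphisms, `w.a = w a w⁻¹`; so `w.∂_i = ∂_{w i}`, and
`w.g` is as above for `g ∈ ℂ(V)`. -/
instance (n : ℕ) : MulSemiringAction (Equiv.Perm (Fin n)) (DiffOp n) where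
  smul w a := ⟨conjEnd w a.1, conjEnd_mem w a.2⟩
  one_smul a := Subtype.ext <| LinearMap.ext fun f => by
    change permMer 1 (a.1 (permMer 1⁻¹ f)) = a.1 f
    simp
  mul_smul w w' a := Subtype.ext <| LinearMap.ext fun f => by
    change permMer (w * w') (a.1 (permMer (w * w')⁻¹ f)) =
      permMer w (permMer w' (a.1 (permMer w'⁻¹ (permMer w⁻¹ f))))
    simp
  smul_zero w := Subtype.ext <| LinearMap.ext fun f => by
    change permMer w 0 = 0
    simp
  smul_add w a b := Subtype.ext <| LinearMap.ext fun f => by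
    change permMer w (a.1 (permMer w⁻¹ f) + b.1 (permMer w⁻¹ f)) = _
    rw [map_add]
    rfl
  smul_one w := Subtype.ext <| LinearMap.ext fun f => permMer_apply_inv w f
  smul_mul w a b := Subtype.ext <| LinearMap.ext fun f => by
    change permMer w (a.1 (b.1 (permMer w⁻¹ f))) =
      permMer w (a.1 (permMer w⁻¹ (permMer w (b.1 (permMer w⁻¹ f)))))
    rw [permMer_inv_apply]

instance (n : ℕ) : SMulCommClass (Equiv.Perm (Fin n)) ℂ (DiffOp n) where
  smul_comm w c a := Subtype.ext <| LinearMap.ext fun f => by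
    change permMer w (c • a.1 (permMer w⁻¹ f)) = c • permMer w (a.1 (permMer w⁻¹ f))
    rw [map_smul]

/-- The crossed product `𝒟(V) * S_n`. -/
abbrev Crossed (n : ℕ) : Type := SkewMonoidAlgebra (DiffOp n) (Equiv.Perm (Fin n))

/-- The algebra `A_0 = ℂ(V)[p_1, …, p_n]` of classical observables. -/
def ClassObs (n : ℕ) : Type := MvPolynomial (Fin n) (Mer n)

instance (n : ℕ) : CommRing (ClassObs n) := inferInstanceAs (CommRing (MvPolynomial (Fin n) (Mer n)))
instance (n : ℕ) : Algebra ℂ (ClassObs n) :=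
  inferInstanceAs (Algebra ℂ (MvPolynomial (Fin n) (Mer n)))

/-- Elements of `A_0` as polynomials in the momenta. -/
def ClassObs.toPoly {n : ℕ} (f : ClassObs n) : MvPolynomial (Fin n) (Mer n) := f

/-- The momentum `p_i ∈ A_0`. -/
def mom {n : ℕ} (i : Fin n) : ClassObs n := (MvPolynomial.X i : MvPolynomial (Fin n) (Mer n))

/-- The inclusion `ℂ(V) → A_0`. -/
def cl {n : ℕ} : Mer n →+* ClassObs n := (MvPolynomial.C : Mer n →+* MvPolynomial (Fin n) (Mer n))

/-- The action of `w ∈ S_n` on `A_0`: on `ℂ(V)` as above, and `w.p_i = p_{w i}`. -/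
def permClassical {n : ℕ} (w : Equiv.Perm (Fin n)) : ClassObs n →+* ClassObs n :=
  MvPolynomial.eval₂Hom (cl.comp (permMer w : Mer n →+* Mer n)) fun i => mom (w i)

theorem permClassical_cl {n : ℕ} (w : Equiv.Perm (Fin n)) (g : Mer n) :
    permClassical w (cl g) = cl (permMer w g) :=
  MvPolynomial.eval₂_C _ _ _

theorem permClassical_mom {n : ℕ} (w : Equiv.Perm (Fin n)) (i : Fin n) :
    permClassical w (mom i) = mom (w i) :=
  MvPolynomial.eval₂_X _ _ _

theorem ClassObs.hom_ext {n : ℕ} {φ ψ : ClassObs n →+* ClassObs n}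
    (hC : ∀ g : Mer n, φ (cl g) = ψ (cl g)) (hX : ∀ i, φ (mom i) = ψ (mom i)) : φ = ψ :=
  MvPolynomial.ringHom_ext hC hX

instance (n : ℕ) : MulSemiringAction (Equiv.Perm (Fin n)) (ClassObs n) where
  smul w a := permClassical w a
  one_smul a := by
    have : permClassical (1 : Equiv.Perm (Fin n)) = RingHom.id _ := by
      refine ClassObs.hom_ext (fun g => ?_) (fun i => ?_)
      · rw [permClassical_cl, map_one]
        rfl
      · exact permClassical_mom 1 i
    exact congrArg (fun φ : ClassObs n →+* ClassObs n => φ a) this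
  mul_smul w w' a := by
    have : permClassical (w * w') = (permClassical w).comp (permClassical w') := by
      refine ClassObs.hom_ext (fun g => ?_) (fun i => ?_)
      · rw [RingHom.comp_apply, permClassical_cl, permClassical_cl, permClassical_cl, map_mul]
        rfl
      · rw [RingHom.comp_apply, permClassical_mom, permClassical_mom, permClassical_mom]
        rfl
    exact congrArg (fun φ : ClassObs n →+* ClassObs n => φ a) this
  smul_zero w := map_zero (permClassical w)
  smul_add w := map_add (permClassical w)
  smul_one w := map_one (permClassical w)
  smul_mul w := map_mul (permClassical w)

instance (n : ℕ) : SMulCommClass (Equiv.Perm (Fin n)) ℂ (ClassObs n) where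
  smul_comm w c a := by
    have hc : ∀ b : ClassObs n, c • b = cl (algebraMap ℂ (Mer n) c) * b := fun b =>
      Algebra.smul_def (A := MvPolynomial (Fin n) (Mer n)) c b
    change permClassical w (c • a) = c • permClassical w a
    rw [hc, hc, map_mul, permClassical_cl, AlgHom.commutes]

/-- The crossed product `A_0 * S_n`. -/
abbrev ClassicalCrossed (n : ℕ) : Type := SkewMonoidAlgebra (ClassObs n) (Equiv.Perm (Fin n))

/-- The monomial `Y_1^{α_1} ⋯ Y_n^{α_n}`. It is used for families `Y` of pairwise commuting
elements (Dunkl operators), where the order of the factors does not matter. -/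
def monomialAt {n : ℕ} {B : Type} [Ring B] (Y : Fin n → B) (α : Fin n →₀ ℕ) : B :=
  (List.ofFn fun i => Y i ^ α i).prod

/-! ### Rational classical Calogero–Moser Hamiltonians -/

/-- The classical rational Dunkl operator `p_i - κ Σ_{j ≠ i} (x_i - x_j)⁻¹ s_{ij} ∈ A_0 * S_n`. -/
def ratDunkl {n : ℕ} (κ : ℂ) (i : Fin n) : ClassicalCrossed n :=
  SkewMonoidAlgebra.single 1 (mom i) -
    κ • ∑ j ∈ Finset.univ.erase i,
      SkewMonoidAlgebra.single (Equiv.swap i j) (cl (ofFun fun x => 1 / (x i - x j)))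

/-- `Res : A_0 * S_n → A_0`, `Σ_w a_w w ↦ Σ_w a_w`. -/
def resClassical {n : ℕ} (a : ClassicalCrossed n) : ClassObs n := a.sum fun _ c => c

/-- The rational classical Calogero–Moser Hamiltonian `L^{rat}_{q,c} = Res q(y^{rat}_c) ∈ A_0`. -/
def ratHam {n : ℕ} (κ : ℂ) (q : MvPolynomial (Fin n) ℂ) : ClassObs n :=
  resClassical (∑ α ∈ q.support, q.coeff α • monomialAt (ratDunkl κ) α)

/-! ### Elliptic functions and elliptic Dunkl operators -/

/-- The periods `1, τ`. -/
def periods (τ : UpperHalfPlane) : PeriodPair where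
  ω₁ := 1
  ω₂ := τ
  indep := by
    rw [LinearIndependent.pair_iff]
    intro s t h
    have him := congrArg Complex.im h
    have hre := congrArg Complex.re h
    have ht : t = 0 := by
      simpa [τ.im_ne_zero] using him
    subst ht
    simpa using hre

/-- The Weierstrass `σ`-function `σ(z) = z ∏_{l ≠ 0} (1 - z / l) exp (z / l + z² / (2 l²))`. -/
def weierstrassSigma (L : PeriodPair) (z : ℂ) : ℂ :=
  z * ∏' l : {l : L.lattice // l ≠ 0},
    ((1 - z / (l.1 : ℂ)) * Complex.exp (z / (l.1 : ℂ) + z ^ 2 / (2 * (l.1 : ℂ) ^ 2)))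

/-- `φ(μ, z) = σ(z - μ) / (σ(z) σ(-μ))`. -/
def phi (L : PeriodPair) (μ z : ℂ) : ℂ :=
  weierstrassSigma L (z - μ) / (weierstrassSigma L z * weierstrassSigma L (-μ))

/-- The elliptic Dunkl operator
`y_i(λ) = ħ ∂_i - κ Σ_{j ≠ i} φ(λ_i - λ_j, x_i - x_j) s_{ij} ∈ 𝒟(V) * S_n`
at a point `v = (λ_1, …, λ_n)` with `λ_i - λ_j` outside the period lattice for `i ≠ j`. -/
def ellDunkl {n : ℕ} (L : PeriodPair) (ħ κ : ℂ) (v : Fin n → ℂ) (i : Fin n) : Crossed n :=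
  SkewMonoidAlgebra.single 1 (ħ • dOp i) -
    κ • ∑ j ∈ Finset.univ.erase i,
      SkewMonoidAlgebra.single (Equiv.swap i j)
        (mulOp (ofFun fun x => phi L (v i - v j) (x i - x j)))

/-- `f(λ, y) ∈ 𝒟(V) * S_n` for `f ∈ A_0 = ℂ(V)[p_1, …, p_n]`, at the point `v = λ`: in the
coefficients of `f` the variables `x_i` are replaced with `λ_i`, and the momenta `p_i` are replaced
with the elliptic Dunkl operators `y_i(λ)`. -/
def substDunkl {n : ℕ} (L : PeriodPair) (ħ κ : ℂ) (f : ClassObs n) (v : Fin n → ℂ) : Crossed n :=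
  ∑ α ∈ f.toPoly.support, valueAt v (f.toPoly.coeff α) • monomialAt (ellDunkl L ħ κ v) α

/-! ### The limit `λ → 0` -/

/-- The spectral parameters `λ` for which the elliptic Dunkl operators are defined. -/
def generic (n : ℕ) (L : PeriodPair) : Set (Fin n → ℂ) :=
  {v | ∀ i j, i ≠ j → v i - v j ∉ L.lattice}

/-- `F`, a function of generic `λ` with values in `𝒟(V) * S_n`, is regular near `λ = 0` and its
limit at `λ = 0` is `G`: for generic `λ` near `0`, `F(λ) = Σ_k c_k(λ, x) P_k`, where the `P_k` do
not depend on `λ` and the `c_k(λ, x)` are holomorphic in `λ` near `0` and `x ∈ V`, and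
`G = Σ_k c_k(0, x) P_k`. (Poles in `x` are allowed, in the `P_k`.) -/
def HasRegularLimit {n : ℕ} (L : PeriodPair) (F : (Fin n → ℂ) → Crossed n) (G : Crossed n) : Prop :=
  ∃ (U : Set (Fin n → ℂ)) (m : ℕ) (c : Fin m → (Fin n → ℂ) → Entire n) (P : Fin m → Crossed n),
    IsOpen U ∧ 0 ∈ U ∧
    (∀ k, ∀ v ∈ U, ∀ x : Fin n → ℂ,
      AnalyticAt ℂ (fun p : (Fin n → ℂ) × (Fin n → ℂ) => (c k p.1).1 p.2) (v, x)) ∧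
    (∀ v ∈ U, v ∈ generic n L →
      F v = ∑ k, SkewMonoidAlgebra.single 1 (mulOp (algebraMap _ (Mer n) (c k v))) * P k) ∧
    G = ∑ k, SkewMonoidAlgebra.single 1 (mulOp (algebraMap _ (Mer n) (c k 0))) * P k

open Classical in
/-- `lim_{λ → 0} F(λ)`, for `F` regular near `λ = 0`. -/
def limZero {n : ℕ} (L : PeriodPair) (F : (Fin n → ℂ) → Crossed n) : Crossed n :=
  if h : ∃ G, HasRegularLimit L F G then h.choose else 0

/-! ### Spin Hamiltonians -/

/-- The algebra `𝒟(V) ⊗ ℂ S_n`. -/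
abbrev SpinAlg (n : ℕ) : Type := DiffOp n ⊗[ℂ] MonoidAlgebra ℂ (Equiv.Perm (Fin n))

/-- The element `ŵ` of the second tensor factor `ℂ S_n`. -/
def hat {n : ℕ} (w : Equiv.Perm (Fin n)) : MonoidAlgebra ℂ (Equiv.Perm (Fin n)) :=
  MonoidAlgebra.of ℂ (Equiv.Perm (Fin n)) w

/-- The action of `w ∈ S_n` on `𝒟(V) ⊗ ℂ S_n`, `a ⊗ û ↦ w.a ⊗ (w u w⁻¹)^`; it is the conjugation by
`w ⊗ ŵ` in `(𝒟(V) * S_n) ⊗ ℂ S_n`. -/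
def spinAct {n : ℕ} (w : Equiv.Perm (Fin n)) : SpinAlg n →ₐ[ℂ] SpinAlg n :=
  Algebra.TensorProduct.map (MulSemiringAction.toAlgHom ℂ (DiffOp n) w)
    (MonoidAlgebra.mapDomainAlgHom ℂ ℂ (MulAut.conj w).toMonoidHom)

/-- The subalgebra of invariants `(𝒟(V) ⊗ ℂ S_n)^{S_n}`. -/
def spinInvariants (n : ℕ) : Subalgebra ℂ (SpinAlg n) :=
  ⨅ w : Equiv.Perm (Fin n), AlgHom.equalizer (spinAct w) (AlgHom.id ℂ (SpinAlg n))

/-- The map `Res^ : 𝒟(V) * S_n → 𝒟(V) ⊗ ℂ S_n`, `Σ_w a_w w ↦ Σ_w a_w ⊗ (w⁻¹)^`. -/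
def resHat {n : ℕ} (a : Crossed n) : SpinAlg n := a.sum fun w c => c ⊗ₜ[ℂ] hat w⁻¹

/-- `L^_q = Res^ lim_{λ → 0} L^{rat}_{q,c}(λ, y)`. -/
def spinHam {n : ℕ} (L : PeriodPair) (ħ κ : ℂ) (q : MvPolynomial (Fin n) ℂ) : SpinAlg n :=
  resHat (limZero L (substDunkl L ħ κ (ratHam κ q)))

/-- The total momentum `Σ_i ħ ∂_i`. -/
def totalMomentum (n : ℕ) (ħ : ℂ) : SpinAlg n := ∑ i : Fin n, (ħ • dOp i) ⊗ₜ[ℂ] 1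

/-- The spin elliptic Calogero–Moser Hamiltonian
`Σ_i ħ² ∂_i² - 2 Σ_{i < j} ℘(x_i - x_j) κ (κ - ħ ŝ_{ij})`. -/
def spinCMHam (n : ℕ) (L : PeriodPair) (ħ κ : ℂ) : SpinAlg n :=
  ∑ i : Fin n, (ħ ^ 2 • dOp i ^ 2) ⊗ₜ[ℂ] 1 -
    (2 : ℂ) • ∑ i : Fin n, ∑ j ∈ Finset.univ.filter (fun j => i < j),
      mulOp (ofFun fun x => L.weierstrassP (x i - x j)) ⊗ₜ[ℂ]
        (κ • (κ • 1 - ħ • hat (Equiv.swap i j)))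

end SpinCM

end

/-!
The proof has four parts.

*Commutativity.* The function `φ` satisfies the Fay-type addition theorem `phi_three_term`, which
comes from the three-term identity of `σ`, which in turn comes from
`σ(a + b) σ(a - b) = -σ(a)² σ(b)² (℘(a) - ℘(b))`. The addition theorem is the classical Yang–Baxter
relation for the terms `φ(λ_i - λ_j, x_i - x_j) s_{ij}`, so that the elliptic Dunkl operators
commute, just as the rational ones do (`commute_of_yangBaxter`, `commute_dunklOp`). Hence, for fixed
generic `λ`, the substitution `f ↦ f(λ, y)` is an algebra homomorphism (`exists_substHom`). For
rational Dunkl operators, `Res` is multiplicative on elements with invariant residue, so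
`q ↦ L^{rat}_{q,c}` is a homomorphism with values in the `S_n`-invariants.

*Regularity.* By the Hartogs principle it is enough to exclude poles along a single hyperplane
`λ_i = λ_j`, away from the others. There the rational Hamiltonians lie in the algebra
`pairAlg κ i j`, generated by elements without pole, by `(x_i - x_j)(p_i - p_j)` and by the rank one
Hamiltonian `(p_i - p_j)² - 4 κ² / (x_i - x_j)²` (`ratHam_mem_pairAlg`). The latter substitutes to
`(y_i - y_j)² - 4 κ² / (λ_i - λ_j)²`. Write `y_i - y_j = T - 2 κ φ s_{ij}` with `T` regular. The
double pole of `4 κ² (φ s_{ij})² = 4 κ² (℘(λ_i - λ_j) - ℘(x_i - x_j))` cancels, and so does the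
simple pole of `T φ s_{ij} + φ s_{ij} T`, since on the hyperplane the residue of `φ s_{ij}` is
`-s_{ij}`, which anticommutes with `T` (`extends_quad`). The Hartogs principle is proved by hand
(`extends_of_extends_pairSet`): all poles are cleared by some product of the `λ_a - λ_b`, and the
factors are divided out again one at a time. Analytic families of operators form an algebra (`fam`).
Such a family vanishing on `λ_i = λ_j` is divisible by `λ_i - λ_j` (`exists_fam_eq_smul`), and it is
determined by its values at generic points (`fam_eq_zero_of_frequently`); this also makes limits
unique.

*The algebra of limits.* By uniqueness, limits are compatible with sums and products. Since `S_n`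
permutes the Dunkl operators `y_i(λ)` and the `λ_i` simultaneously, the limit at the fixed point
`λ = 0` commutes with `S_n`. On such elements `Res^` is multiplicative and has invariant values
(`resHatLin_mul`, `resHatLin_mem_spinInvariants`). So `q ↦ L^_q` is a homomorphism from a
commutative algebra.

*The explicit Hamiltonians.* In `∑ y_i²` the products of two different reflection terms cancel by
the three-term relation (`sum_sq_of_threeTerm`). The squares give
`κ² (℘(λ_i - λ_j) - ℘(x_i - x_j))`, whose pole is the one subtracted in
`L^{rat}_{q,c} = ∑ p_i² - κ² ∑ 1 / (x_i - x_j)²`, and the terms linear in `κ` give `∂_z φ(μ, z)`,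
which tends to `-℘(z)` as `μ → 0`.
-/

open scoped TensorProduct

noncomputable section

namespace SpinCM

/-! ### The Weierstrass `σ`-function -/

section Sigma

variable (L : PeriodPair)

/-- The canonical factor `E₂(u) = (1 - u) exp (u + u² / 2)` differs from `1` by `O(u³)`. -/
theorem norm_canonicalFactor_sub_one_le (u : ℂ) (hu : ‖u‖ ≤ 1) :
    ‖(1 - u) * Complex.exp (u + u ^ 2 / 2) - 1‖ ≤ Real.exp 2 * ‖u‖ ^ 3 := by
  have hd : ∀ w : ℂ, HasDerivAt (fun w : ℂ => (1 - w) * Complex.exp (w + w ^ 2 / 2))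
      (-w ^ 2 * Complex.exp (w + w ^ 2 / 2)) w := by
    intro w
    have h1 : HasDerivAt (fun w : ℂ => w + w ^ 2 / 2) (1 + w) w := by
      have := (hasDerivAt_id w).add (((hasDerivAt_id w).pow 2).div_const 2)
      convert! this using 1
      simp
    have := ((hasDerivAt_id w).const_sub 1).mul h1.cexp
    convert! this using 1
    simp
    ring
  have hb : ∀ w ∈ Metric.closedBall (0 : ℂ) ‖u‖,
      ‖-w ^ 2 * Complex.exp (w + w ^ 2 / 2)‖ ≤ Real.exp 2 * ‖u‖ ^ 2 := by
    intro w hw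
    have hw' : ‖w‖ ≤ ‖u‖ := by simpa using hw
    have hw1 : ‖w‖ ≤ 1 := hw'.trans hu
    have : ‖w + w ^ 2 / 2‖ ≤ 2 := by
      refine (norm_add_le _ _).trans ?_
      rw [norm_div, norm_pow]
      have : ‖w‖ ^ 2 ≤ 1 := pow_le_one₀ (norm_nonneg _) hw1
      norm_num
      linarith
    rw [norm_mul, norm_neg, norm_pow, mul_comm]
    gcongr
    exact (Complex.norm_exp_le_exp_norm _).trans (Real.exp_le_exp.mpr this)
  have := (convex_closedBall (0 : ℂ) ‖u‖).norm_image_sub_le_of_norm_hasDerivWithin_le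
    (fun w _ => (hd w).hasDerivWithinAt) hb (x := 0) (y := u) (by simp) (by simp)
  simpa [pow_succ, mul_assoc] using this

theorem summable_norm_lattice : Summable fun l : {l : L.lattice // l ≠ 0} =>
    ‖(l.1 : ℂ)‖ ^ (-3 : ℝ) :=
  (ZLattice.summable_norm_rpow L.lattice (-3) (by simp; norm_num)).subtype _

theorem eventually_le_norm_lattice (R : ℝ) :
    ∀ᶠ l : {l : L.lattice // l ≠ 0} in Filter.cofinite, R ≤ ‖(l.1 : ℂ)‖ := by
  have h : ∀ᶠ l : L.lattice in Filter.cofinite, R ≤ ‖(l : ℂ)‖ := by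
    refine ((isCompact_iff_finite.mp (isCompact_closedBall (0 : L.lattice) R)).subset ?_)
    intro l hl
    have : ‖(l : ℂ)‖ < R := by simpa using hl
    simpa using this.le
  exact (Subtype.val_injective.tendsto_cofinite).eventually h

/-- `∏_{l ≠ 0} (1 - z / l) exp (z / l + z² / (2 l²))`, so that `σ(z) = z · sigmaProd z`. -/
def sigmaProd (z : ℂ) : ℂ :=
  ∏' l : {l : L.lattice // l ≠ 0},
    ((1 - z / (l.1 : ℂ)) * Complex.exp (z / (l.1 : ℂ) + z ^ 2 / (2 * (l.1 : ℂ) ^ 2)))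

theorem weierstrassSigma_eq (z : ℂ) : weierstrassSigma L z = z * sigmaProd L z := rfl

theorem coe_lattice_ne_zero (l : {l : L.lattice // l ≠ 0}) : (l.1 : ℂ) ≠ 0 := by
  simpa using l.2

/-- Almost all factors of the product for `σ` are `1 + O(|l|⁻³)`, uniformly on a disc. -/
theorem sigmaFactor_bound (r : ℝ) :
    ∀ᶠ l : {l : L.lattice // l ≠ 0} in Filter.cofinite, ∀ z ∈ Metric.ball (0 : ℂ) r,
      ‖(1 - z / (l.1 : ℂ)) * Complex.exp (z / (l.1 : ℂ) + z ^ 2 / (2 * (l.1 : ℂ) ^ 2)) - 1‖ ≤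
        Real.exp 2 * r ^ 3 * ‖(l.1 : ℂ)‖ ^ (-3 : ℝ) := by
  filter_upwards [eventually_le_norm_lattice L r] with l hl z hz
  have hz' : ‖z‖ < r := by simpa using hz
  have hl0 : 0 < ‖(l.1 : ℂ)‖ := norm_pos_iff.mpr (coe_lattice_ne_zero L l)
  have h1 : ‖z / (l.1 : ℂ)‖ ≤ 1 := by
    rw [norm_div]
    exact div_le_one_of_le₀ (by linarith) hl0.le
  have h2 := norm_canonicalFactor_sub_one_le (z / (l.1 : ℂ)) h1
  have h3 : z / (l.1 : ℂ) + z ^ 2 / (2 * (l.1 : ℂ) ^ 2) =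
      z / (l.1 : ℂ) + (z / (l.1 : ℂ)) ^ 2 / 2 := by
    have := coe_lattice_ne_zero L l
    field_simp
  rw [h3]
  refine h2.trans ?_
  rw [norm_div, div_pow, mul_assoc, show (-3 : ℝ) = -((3 : ℕ) : ℝ) by norm_num,
    Real.rpow_neg hl0.le,
    Real.rpow_natCast, ← div_eq_mul_inv]
  gcongr

theorem hasProdLocallyUniformlyOn_sigmaProd (r : ℝ) :
    HasProdLocallyUniformlyOn (fun (l : {l : L.lattice // l ≠ 0}) (z : ℂ) =>
      ((1 - z / (l.1 : ℂ)) * Complex.exp (z / (l.1 : ℂ) + z ^ 2 / (2 * (l.1 : ℂ) ^ 2))))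
      (sigmaProd L) (Metric.ball 0 r) := by
  have := Summable.hasProdLocallyUniformlyOn_one_add (K := Metric.ball (0 : ℂ) r)
    (f := fun (l : {l : L.lattice // l ≠ 0}) (z : ℂ) =>
      ((1 - z / (l.1 : ℂ)) * Complex.exp (z / (l.1 : ℂ) + z ^ 2 / (2 * (l.1 : ℂ) ^ 2))) - 1)
    Metric.isOpen_ball ((summable_norm_lattice L).mul_left _) (sigmaFactor_bound L _)
    (fun l => by fun_prop)
  simp only [add_sub_cancel] at this
  exact this

theorem differentiable_sigmaFactor (l : {l : L.lattice // l ≠ 0}) : Differentiable ℂ (fun z : ℂ =>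
      ((1 - z / (l.1 : ℂ)) * Complex.exp (z / (l.1 : ℂ) + z ^ 2 / (2 * (l.1 : ℂ) ^ 2)))) := by
  fun_prop

theorem differentiable_sigmaProd : Differentiable ℂ (sigmaProd L) := by
  intro z
  have := (hasProdLocallyUniformlyOn_sigmaProd L (‖z‖ + 1)).differentiableOn
    (.of_forall fun _ => by
      simpa [Finset.prod_fn] using DifferentiableOn.finsetProd (fun l _ =>
        (differentiable_sigmaFactor L l).differentiableOn)) Metric.isOpen_ball
  exact this.differentiableAt (Metric.isOpen_ball.mem_nhds (by simp))

theorem sigmaProd_ne_zero {z : ℂ} (hz : z ∉ L.lattice ∨ z = 0) : sigmaProd L z ≠ 0 := by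
  have := tprod_one_add_ne_zero_of_summable
    (f := fun (l : {l : L.lattice // l ≠ 0}) =>
      ((1 - z / (l.1 : ℂ)) * Complex.exp (z / (l.1 : ℂ) + z ^ 2 / (2 * (l.1 : ℂ) ^ 2))) - 1) ?_ ?_
  · simpa [sigmaProd] using this
  · intro l
    simp only [add_sub_cancel, mul_ne_zero_iff, Complex.exp_ne_zero, ne_eq, not_false_eq_true,
      and_true, sub_eq_zero]
    intro h
    rw [eq_div_iff (coe_lattice_ne_zero L l), one_mul] at h
    rcases hz with hz | rfl
    · exact hz (h ▸ l.1.2)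
    · exact coe_lattice_ne_zero L l h
  · refine ((summable_norm_lattice L).mul_left 
      (Real.exp 2 * (‖z‖ + 1) ^ 3)).of_norm_bounded_eventually ?_
    filter_upwards [sigmaFactor_bound L (‖z‖ + 1)] with l hl
    simpa using hl z (by simp)

theorem sigmaProd_zero : sigmaProd L 0 = 1 := by
  simp [sigmaProd]

theorem sigmaProd_neg (z : ℂ) : sigmaProd L (-z) = sigmaProd L z := by
  let e : {l : L.lattice // l ≠ 0} ≃ {l : L.lattice // l ≠ 0} :=
    (Equiv.neg L.lattice).subtypeEquiv (fun l => by simp)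
  rw [sigmaProd, ← e.tprod_eq]
  refine tprod_congr fun l => ?_
  have : ((e l).1 : ℂ) = -(l.1 : ℂ) := rfl
  rw [this]
  simp

theorem sigmaProd_coe (l : {l : L.lattice // l ≠ 0}) : sigmaProd L (l.1 : ℂ) = 0 := by
  have h := (hasProdLocallyUniformlyOn_sigmaProd L (‖(l.1 : ℂ)‖ + 1)).hasProd
    (x := (l.1 : ℂ)) (by simp)
  refine h.unique (hasProd_zero_of_exists_eq_zero ⟨l, ?_⟩)
  simp [div_self (coe_lattice_ne_zero L l)]

theorem differentiable_weierstrassSigma : Differentiable ℂ (weierstrassSigma L) :=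
  differentiable_id.mul (differentiable_sigmaProd L)

theorem weierstrassSigma_neg (z : ℂ) : weierstrassSigma L (-z) = -weierstrassSigma L z := by
  rw [weierstrassSigma_eq, weierstrassSigma_eq, sigmaProd_neg, neg_mul]

theorem weierstrassSigma_eq_zero_iff (z : ℂ) : weierstrassSigma L z = 0 ↔ z ∈ L.lattice := by
  rw [weierstrassSigma_eq, mul_eq_zero]
  constructor
  · rintro (rfl | h)
    · exact zero_mem _
    · by_contra hz
      exact sigmaProd_ne_zero L (Or.inl hz) h
  · intro hz
    by_cases h0 : z = 0
    · exact Or.inl h0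
    · exact Or.inr (sigmaProd_coe L ⟨⟨z, hz⟩, by simpa [Subtype.ext_iff] using h0⟩)

theorem weierstrassSigma_zero : weierstrassSigma L 0 = 0 := by simp [weierstrassSigma_eq]

theorem logDeriv_sigmaFactor (l : {l : L.lattice // l ≠ 0}) {z : ℂ} (hz : z ≠ l.1) :
    logDeriv (fun z : ℂ =>
      ((1 - z / (l.1 : ℂ)) * Complex.exp (z / (l.1 : ℂ) + z ^ 2 / (2 * (l.1 : ℂ) ^ 2)))) z =
    1 / (z - l.1) + 1 / (l.1 : ℂ) + z / (l.1 : ℂ) ^ 2 := by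
  have hl := coe_lattice_ne_zero L l
  have hz' := sub_ne_zero.mpr hz
  have hz'' : (l.1 : ℂ) - z ≠ 0 := sub_ne_zero.mpr hz.symm
  have h1 : HasDerivAt (fun z : ℂ => 1 - z / (l.1 : ℂ)) (-(1 / (l.1 : ℂ))) z :=
    ((hasDerivAt_id z).div_const _).const_sub 1
  have h2 : HasDerivAt (fun z : ℂ => z / (l.1 : ℂ) + z ^ 2 / (2 * (l.1 : ℂ) ^ 2))
      (1 / (l.1 : ℂ) + (2 * z) / (2 * (l.1 : ℂ) ^ 2)) z := by
    have := ((hasDerivAt_id z).div_const (l.1 : ℂ)).add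
      (((hasDerivAt_id z).pow 2).div_const (2 * (l.1 : ℂ) ^ 2))
    convert! this using 1
    simp
  rw [logDeriv_apply, (h1.fun_mul h2.cexp).deriv]
  have := Complex.exp_ne_zero (z / (l.1 : ℂ) + z ^ 2 / (2 * (l.1 : ℂ) ^ 2))
  have h3 : 1 - z / (l.1 : ℂ) ≠ 0 := by
    rw [one_sub_div hl]
    exact div_ne_zero hz'' hl
  rw [one_sub_div hl] at h3 ⊢
  field_simp
  ring

theorem logDeriv_sigmaFactor_bound {r : ℝ} (hr : 0 < r) :
    ∀ᶠ l : {l : L.lattice // l ≠ 0} in Filter.cofinite, ∀ z ∈ Metric.ball (0 : ℂ) r,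
      ‖1 / (z - l.1) + 1 / (l.1 : ℂ) + z / (l.1 : ℂ) ^ 2‖ ≤ 2 * r ^ 2 * ‖(l.1 : ℂ)‖ ^ (-3 : ℝ) := by
  filter_upwards [eventually_le_norm_lattice L (2 * r)] with l hl z hz
  have hz' : ‖z‖ < r := by simpa using hz
  have hl0 : 0 < ‖(l.1 : ℂ)‖ := norm_pos_iff.mpr (coe_lattice_ne_zero L l)
  have hl1 := coe_lattice_ne_zero L l
  have h1 : ‖(l.1 : ℂ)‖ / 2 ≤ ‖z - l.1‖ := by
    rw [norm_sub_rev]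
    exact .trans (by linarith) (norm_sub_norm_le _ _)
  have h2 : z - l.1 ≠ 0 := by
    rw [← norm_pos_iff]
    linarith
  have h3 : 1 / (z - l.1) + 1 / (l.1 : ℂ) + z / (l.1 : ℂ) ^ 2 =
      z ^ 2 / ((l.1 : ℂ) ^ 2 * (z - l.1)) := by
    field_simp
    ring
  rw [h3, show (-3 : ℝ) = -((3 : ℕ) : ℝ) by norm_num, Real.rpow_neg hl0.le, Real.rpow_natCast,
    norm_div, norm_mul, norm_pow, norm_pow]
  calc ‖z‖ ^ 2 / (‖(l.1 : ℂ)‖ ^ 2 * ‖z - l.1‖) ≤ r ^ 2 / (‖(l.1 : ℂ)‖ ^ 2 * (‖(l.1 : ℂ)‖ / 2)) := by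
        gcongr
    _ = _ := by field_simp

theorem isOpen_compl_nonzero_lattice : IsOpen ((L.lattice \ {0} : Set ℂ)ᶜ) :=
  L.isOpen_compl_lattice_sdiff

/-- `(log (σ(z) / z))'' = -(℘(z) - 1 / z²)`, by differentiating the product twice, locally
uniformly. -/
theorem hasDerivAt_logDeriv_sigmaProd {z : ℂ} (hz : z ∈ ((L.lattice \ {0} : Set ℂ)ᶜ)) :
    HasDerivAt (logDeriv (sigmaProd L)) (-L.weierstrassPExcept 0 z) z := by
  set r : ℝ := ‖z‖ + 1
  have hr : 0 < r := by positivity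
  set s : Set ℂ := Metric.ball 0 r ∩ (L.lattice \ {0} : Set ℂ)ᶜ
  have hs : IsOpen s := Metric.isOpen_ball.inter (isOpen_compl_nonzero_lattice L)
  have hzs : z ∈ s := ⟨by simp [r], hz⟩
  have hne : ∀ w ∈ s, ∀ l : {l : L.lattice // l ≠ 0}, w ≠ l.1 := by
    rintro w hw l rfl
    exact hw.2 ⟨l.1.2, coe_lattice_ne_zero L l⟩
  set T : {l : L.lattice // l ≠ 0} → ℂ → ℂ := fun l w =>
    1 / (w - l.1) + 1 / (l.1 : ℂ) + w / (l.1 : ℂ) ^ 2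
  have hT : ∀ l, ∀ w ∈ s, HasDerivAt (T l) (-(1 / (w - l.1) ^ 2 - 1 / (l.1 : ℂ) ^ 2)) w := by
    intro l w hw
    have hwl : w - l.1 ≠ 0 := sub_ne_zero.mpr (hne w hw l)
    have h1 := ((hasDerivAt_id w).sub_const (l.1 : ℂ)).inv hwl
    have h2 := ((h1.add_const (1 / (l.1 : ℂ))).add ((hasDerivAt_id w).div_const ((l.1 : ℂ) ^ 2)))
    convert! h2 using 1
    · ext w
      simp [T]
    · simp
      ring
  have hu := tendstoUniformlyOn_tsum_of_cofinite_eventually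
    ((summable_norm_lattice L).mul_left (2 * r ^ 2)) (logDeriv_sigmaFactor_bound L hr)
  have hloc : TendstoLocallyUniformlyOn (fun (t : Finset {l : L.lattice // l ≠ 0}) w =>
      ∑ l ∈ t, T l w) (fun w => ∑' l, T l w) Filter.atTop s :=
    (hu.mono Set.inter_subset_left).tendstoLocallyUniformlyOn
  have hdiff : ∀ᶠ t : Finset {l : L.lattice // l ≠ 0} in Filter.atTop,
      DifferentiableOn ℂ (fun w => ∑ l ∈ t, T l w) s :=
    .of_forall fun t => DifferentiableOn.fun_sum fun l _ w hw =>
      (hT l w hw).differentiableAt.differentiableWithinAt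
  -- off the lattice the logarithmic derivative is the sum of those of the factors
  have heq : ∀ w ∈ s, logDeriv (sigmaProd L) w = ∑' l, T l w := by
    intro w hw
    have hTl : ∀ l : {l : L.lattice // l ≠ 0}, logDeriv (fun z : ℂ =>
      ((1 - z / (l.1 : ℂ)) * Complex.exp (z / (l.1 : ℂ) + z ^ 2 / (2 * (l.1 : ℂ) ^ 2)))) w =
        T l w :=
      fun l => logDeriv_sigmaFactor L l (hne w hw l)
    have hsum : Summable fun l => T l w :=
      ((summable_norm_lattice L).mul_left (2 * r ^ 2)).of_norm_bounded_eventually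
        ((logDeriv_sigmaFactor_bound L hr).mono fun l hl => hl w hw.1)
    have hnz : sigmaProd L w ≠ 0 := by
      refine sigmaProd_ne_zero L ?_
      by_contra! h
      exact hw.2 ⟨h.1, h.2⟩
    have := logDeriv_tprod_eq_tsum Metric.isOpen_ball (x := w) hw.1
      (f := fun (l : {l : L.lattice // l ≠ 0}) (z : ℂ) =>
      ((1 - z / (l.1 : ℂ)) * Complex.exp (z / (l.1 : ℂ) + z ^ 2 / (2 * (l.1 : ℂ) ^ 2))))
      (fun l => by
        simp only [mul_ne_zero_iff, Complex.exp_ne_zero, ne_eq, not_false_eq_true,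
          and_true, sub_eq_zero]
        intro h
        rw [eq_div_iff (coe_lattice_ne_zero L l), one_mul] at h
        exact hne w hw l h.symm)
      (fun l => (differentiable_sigmaFactor L l).differentiableOn)
      (by simpa only [hTl] using hsum)
      (hasProdLocallyUniformlyOn_sigmaProd L r).multipliableLocallyUniformlyOn hnz
    simp only [hTl] at this
    exact this
  have hd : DifferentiableAt ℂ (fun w => ∑' l, T l w) z :=
    (hloc.differentiableOn hdiff hs).differentiableAt (hs.mem_nhds hzs)
  have hlim := (hloc.deriv hdiff hs).tendsto_at hzs
  have hPsum : HasSum (fun l : {l : L.lattice // l ≠ 0} =>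
      -(1 / (z - l.1) ^ 2 - 1 / (l.1 : ℂ) ^ 2)) (-L.weierstrassPExcept 0 z) := by
    have h := L.hasSum_weierstrassPExcept 0 z
    have h2 := (hasSum_subtype_iff_of_support_subset (s := {l : L.lattice | l ≠ 0})
      (fun l hl => by
        intro h0
        apply hl
        simp [h0])).mpr h
    refine (h2.congr_fun ?_).neg
    intro l
    have hl0 : l.1 ≠ 0 := l.2
    simp [hl0]
  have hval : deriv (fun w => ∑' l, T l w) z = -L.weierstrassPExcept 0 z := by
    refine tendsto_nhds_unique hlim ?_
    refine Filter.Tendsto.congr (fun t => ?_) hPsum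
    exact (HasDerivAt.fun_sum fun l _ => hT l z hzs).deriv.symm
  have := hd.hasDerivAt
  rw [hval] at this
  refine this.congr_of_eventuallyEq ?_
  filter_upwards [hs.mem_nhds hzs] with w hw using heq w hw

/-- `(log σ)'' = -℘`, written without denominators. -/
theorem deriv_weierstrassSigma_sq_sub {z : ℂ} (hz : z ∉ L.lattice) :
    deriv (weierstrassSigma L) z ^ 2 - weierstrassSigma L z * deriv (deriv (weierstrassSigma L)) z =
      weierstrassSigma L z ^ 2 * L.weierstrassP z := by
  have hz0 : z ≠ 0 := fun h => hz (h ▸ zero_mem _)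
  have hσ := fun w => (differentiable_weierstrassSigma L w).hasDerivAt
  have hσ' : HasDerivAt (deriv (weierstrassSigma L)) (deriv (deriv (weierstrassSigma L)) z) z :=
    ((differentiable_weierstrassSigma L).contDiff (n := 2)).differentiable_deriv_two z |>.hasDerivAt
  have hne : weierstrassSigma L z ≠ 0 := fun h => hz ((weierstrassSigma_eq_zero_iff L z).mp h)
  have h1 := hσ'.div (hσ z) hne
  have h2 : HasDerivAt (fun w => 1 / w + logDeriv (sigmaProd L) w)
      (-(z ^ 2)⁻¹ + -L.weierstrassPExcept 0 z) z := by
    simpa [one_div] using (hasDerivAt_inv hz0).fun_add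
      (hasDerivAt_logDeriv_sigmaProd L (z := z) fun h => hz h.1)
  have h3 : (fun w => 1 / w + logDeriv (sigmaProd L) w) =ᶠ[nhds z]
      fun w => deriv (weierstrassSigma L) w / weierstrassSigma L w := by
    filter_upwards [L.isClosed_lattice.isOpen_compl.mem_nhds hz] with w hw
    have hw0 : w ≠ 0 := fun h => hw (h ▸ zero_mem L.lattice)
    have hP := sigmaProd_ne_zero L (Or.inl hw)
    have hd : deriv (weierstrassSigma L) w = 1 * sigmaProd L w + w * deriv (sigmaProd L) w :=
      ((hasDerivAt_id w).mul ((differentiable_sigmaProd L) w).hasDerivAt).deriv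
    rw [hd, weierstrassSigma_eq, logDeriv_apply]
    field_simp
  have h4 := h1.unique (h2.congr_of_eventuallyEq h3.symm)
  have h5 := L.weierstrassPExcept_def ⟨0, zero_mem _⟩ z
  simp only [ne_eq, OfNat.ofNat_ne_zero, not_false_eq_true, zero_pow, div_zero, sub_zero,
    zero_sub] at h5
  rw [h5, div_eq_iff (pow_ne_zero 2 hne)] at h4
  have h6 : (-(z ^ 2)⁻¹ + -(L.weierstrassP z + -(1 / z ^ 2))) = -L.weierstrassP z := by
    rw [one_div]
    ring
  rw [h6] at h4
  linear_combination -h4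

theorem weierstrassSigma_ne_zero {z : ℂ} (hz : z ∉ L.lattice) : weierstrassSigma L z ≠ 0 :=
  fun h => hz ((weierstrassSigma_eq_zero_iff L z).mp h)

theorem isPreconnected_compl_lattice : IsPreconnected ((L.lattice : Set ℂ)ᶜ) := by
  have hc : (L.lattice : Set ℂ).Countable := by
    have : Countable L.lattice := L.latticeEquivProd.toEquiv.countable_iff.mpr inferInstance
    exact Set.to_countable _
  refine (hc.isConnected_compl_of_one_lt_rank ?_).isPreconnected
  rw [Complex.rank_real_complex]
  norm_num

/-- The Weierstrass `ζ`-function `σ'/σ` is a primitive of `-℘`. -/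
theorem hasDerivAt_logDeriv_weierstrassSigma {z : ℂ} (hz : z ∉ L.lattice) :
    HasDerivAt (fun z => deriv (weierstrassSigma L) z / weierstrassSigma L z)
      (-L.weierstrassP z) z := by
  have hσ' : HasDerivAt (deriv (weierstrassSigma L)) (deriv (deriv (weierstrassSigma L)) z) z :=
    ((differentiable_weierstrassSigma L).contDiff (n := 2)).differentiable_deriv_two z |>.hasDerivAt
  have hne := weierstrassSigma_ne_zero L hz
  have h1 := hσ'.fun_div (differentiable_weierstrassSigma L z).hasDerivAt hne
  convert! h1 using 1
  rw [eq_div_iff (pow_ne_zero 2 hne)]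
  linear_combination deriv_weierstrassSigma_sq_sub L hz

/-- Quasi-periodicity of `σ`. The constants are not needed explicitly. -/
theorem exists_weierstrassSigma_add (l : L.lattice) :
    ∃ C η : ℂ, C ≠ 0 ∧ ∀ z, weierstrassSigma L (z + l) =
      C * Complex.exp (η * z) * weierstrassSigma L z := by
  have hopen : IsOpen ((L.lattice : Set ℂ)ᶜ) := L.isClosed_lattice.isOpen_compl
  have hconn := isPreconnected_compl_lattice L
  have hadd : ∀ {z : ℂ}, z ∉ L.lattice → z + l ∉ L.lattice := fun {z} hz h => hz <| by
    simpa using sub_mem h l.2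
  set Z : ℂ → ℂ := fun z => deriv (weierstrassSigma L) z / weierstrassSigma L z with hZ
  set w : ℂ := L.ω₁ / 2
  have hw : w ∉ L.lattice := L.ω₁_div_two_notMem_lattice
  have hσ := fun z => (differentiable_weierstrassSigma L z).hasDerivAt
  have h1 : ∀ z ∈ ((L.lattice : Set ℂ)ᶜ), HasDerivAt (fun z => Z (z + l) - Z z) 0 z := by
    intro z hz
    have := ((hasDerivAt_logDeriv_weierstrassSigma L (hadd hz)).comp_add_const z (l : ℂ)).fun_sub
      (hasDerivAt_logDeriv_weierstrassSigma L hz)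
    rw [L.weierstrassP_add_coe, sub_self] at this
    exact this
  set η := Z (w + l) - Z w
  have hη : ∀ z ∉ L.lattice, Z (z + l) - Z z = η := fun z hz =>
    hopen.is_const_of_deriv_eq_zero hconn
      (fun z hz => (h1 z hz).differentiableAt.differentiableWithinAt)
      (fun z hz => (h1 z hz).deriv) hz hw
  have h2 : ∀ z ∈ ((L.lattice : Set ℂ)ᶜ), HasDerivAt
      (fun z => weierstrassSigma L (z + l) * Complex.exp (-(η * z)) / weierstrassSigma L z) 0
      z := by
    intro z hz
    have hne := weierstrassSigma_ne_zero L hz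
    have hne' := weierstrassSigma_ne_zero L (hadd hz)
    have h3 := (((hσ (z + l)).comp_add_const z (l : ℂ)).fun_mul
      ((hasDerivAt_id z).const_mul η).neg.cexp).fun_div (hσ z) hne
    convert! h3 using 1
    have h4 := hη z hz
    simp only [hZ] at h4
    rw [div_sub_div _ _ hne' hne, div_eq_iff (mul_ne_zero hne' hne)] at h4
    rw [eq_div_iff (pow_ne_zero 2 hne)]
    simp only [id, zero_mul, mul_one]
    linear_combination (-Complex.exp (-(η * z))) * h4
  set C := weierstrassSigma L (w + l) * Complex.exp (-(η * w)) / weierstrassSigma L w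
  refine ⟨C, η, div_ne_zero (mul_ne_zero (weierstrassSigma_ne_zero L (hadd hw))
    (Complex.exp_ne_zero _)) (weierstrassSigma_ne_zero L hw), fun z => ?_⟩
  by_cases hz : z ∈ L.lattice
  · rw [(weierstrassSigma_eq_zero_iff L z).mpr hz,
      (weierstrassSigma_eq_zero_iff L _).mpr (add_mem hz l.2), mul_zero]
  · have h5 := hopen.is_const_of_deriv_eq_zero hconn
      (fun z hz => (h2 z hz).differentiableAt.differentiableWithinAt)
      (fun z hz => (h2 z hz).deriv) hz hw
    change _ = C at h5
    rw [← h5, Complex.exp_neg]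
    have hne := weierstrassSigma_ne_zero L hz
    have := Complex.exp_ne_zero (η * z)
    field_simp

/-- The addition theorem for `℘` in terms of `σ`. For `b ∉ Λ` the function
`σ(a + b) σ(a - b) / (σ(a)² σ(b)²) + ℘(a) - ℘(b)` of `a` is elliptic and has no poles, and it
vanishes at `a = b`. -/
theorem weierstrassSigma_add_mul_sub {a b : ℂ} (ha : a ∉ L.lattice) (hb : b ∉ L.lattice) :
    weierstrassSigma L (a + b) * weierstrassSigma L (a - b) =
      -(weierstrassSigma L a ^ 2 * weierstrassSigma L b ^ 2 *
        (L.weierstrassP a - L.weierstrassP b)) := by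
  have hσ := differentiable_weierstrassSigma L
  have hσb := weierstrassSigma_ne_zero L hb
  set N : ℂ → ℂ := fun a => weierstrassSigma L (a + b) * weierstrassSigma L (a - b) with hN
  -- `M(a) / a² = N(a) / (σ(a)² σ(b)²) + 1 / a²`, and this is holomorphic at `0`, since `M` is even
  -- and vanishes there
  set M : ℂ → ℂ := fun a => N a / (sigmaProd L a ^ 2 * weierstrassSigma L b ^ 2) + 1 with hM
  have hNeven : ∀ a, N (-a) = N a := by
    intro a
    simp only [hN]
    rw [show -a + b = -(a - b) by ring, show -a - b = -(a + b) by ring, weierstrassSigma_neg,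
      weierstrassSigma_neg]
    ring
  have hMeven : ∀ a, M (-a) = M a := fun a => by simp only [hM, hNeven, sigmaProd_neg]
  have hM0 : M 0 = 0 := by
    simp only [hM, hN, zero_add, zero_sub, weierstrassSigma_neg, sigmaProd_zero]
    field_simp
    ring
  have hMa : AnalyticAt ℂ M 0 := by
    have h1 : AnalyticAt ℂ N 0 :=
      (((hσ.comp (differentiable_id.add_const b)).mul
        (hσ.comp (differentiable_id.sub_const b))).analyticAt 0)
    have h2 : AnalyticAt ℂ (fun a => sigmaProd L a ^ 2 * weierstrassSigma L b ^ 2) 0 :=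
      (((differentiable_sigmaProd L).pow 2).mul_const _).analyticAt 0
    exact (h1.div h2 (by simp [sigmaProd_zero, hσb])).add analyticAt_const
  have hM1 : deriv M 0 = 0 := by
    have h1 := hMa.differentiableAt.hasDerivAt
    have h2 : HasDerivAt (fun a => M (-a)) (-deriv M 0) 0 := by
      have h3 : HasDerivAt M (deriv M 0) (-0) := by simpa using h1
      simpa [Function.comp_def] using h3.scomp (0 : ℂ) (hasDerivAt_neg (0 : ℂ))
    simp only [hMeven] at h2
    have := h1.unique h2
    linear_combination this / 2
  set M2 : ℂ → ℂ := dslope (dslope M 0) 0 with hM2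
  have hM2a : AnalyticAt ℂ M2 0 := by
    obtain ⟨p, hp⟩ := hMa
    exact ⟨_, hp.has_fpower_series_dslope_fslope.has_fpower_series_dslope_fslope⟩
  have hM2v : ∀ a, a ≠ 0 → M2 a = M a / a ^ 2 := by
    intro a ha
    rw [hM2, dslope_of_ne _ ha, slope_def_field, dslope_same, hM1, dslope_of_ne _ ha,
      slope_def_field, hM0]
    field_simp
    ring
  set c := M2 0 + L.weierstrassPExcept 0 0 - L.weierstrassP b
  classical
  -- the function of the docstring, with the removable singularities at the periods filled in
  set k : ℂ → ℂ := fun a => if a ∈ L.lattice then c else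
    N a / (weierstrassSigma L a ^ 2 * weierstrassSigma L b ^ 2) + L.weierstrassP a -
      L.weierstrassP b with hk
  have hper : ∀ (l : L.lattice) a, k (a + l) = k a := by
    intro l a
    have hmem : a + l ∈ L.lattice ↔ a ∈ L.lattice :=
      L.lattice.toAddSubgroup.add_mem_cancel_right (y := a) l.2
    simp only [hk, hmem]
    split_ifs with h
    · rfl
    obtain ⟨C, η, hC, h1⟩ := exists_weierstrassSigma_add L l
    have hne := weierstrassSigma_ne_zero L h
    simp only [hN]
    rw [show a + l + b = a + b + l by ring, show a + l - b = a - b + l by ring, h1, h1, h1,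
      L.weierstrassP_add_coe]
    have h2 : Complex.exp (η * (a + b)) * Complex.exp (η * (a - b)) = Complex.exp (η * a) ^ 2 := by
      rw [← Complex.exp_add, ← Complex.exp_nat_mul]
      congr 1
      push_cast
      ring
    have h3 := Complex.exp_ne_zero (η * a)
    congr 2
    rw [div_eq_div_iff (by positivity) (by positivity)]
    linear_combination (C ^ 2 * weierstrassSigma L (a + b) * weierstrassSigma L (a - b) *
      weierstrassSigma L a ^ 2 * weierstrassSigma L b ^ 2) * h2
  have hk0 : AnalyticAt ℂ k 0 := by
    have h1 : AnalyticAt ℂ (fun a => M2 a + L.weierstrassPExcept 0 a - L.weierstrassP b) 0 :=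
      (hM2a.add (L.analyticAt_weierstrassPExcept 0)).sub analyticAt_const
    refine h1.congr ?_
    filter_upwards [(isOpen_compl_nonzero_lattice L).mem_nhds (x := 0) (by simp)] with a ha
    by_cases h0 : a = 0
    · subst h0
      simp [hk, c]
    have hal : a ∉ L.lattice := fun h => ha ⟨h, h0⟩
    have hne := weierstrassSigma_ne_zero L hal
    have hP := sigmaProd_ne_zero L (Or.inl hal)
    have h5 := L.weierstrassPExcept_def ⟨0, zero_mem _⟩ a
    simp only [ne_eq, OfNat.ofNat_ne_zero, not_false_eq_true, zero_pow, div_zero, sub_zero,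
      zero_sub] at h5
    simp only [hk, if_neg hal]
    rw [hM2v a h0, h5, weierstrassSigma_eq L a]
    simp only [hM]
    field_simp
    ring
  have hka : ∀ a, AnalyticAt ℂ k a := by
    intro a
    by_cases ha : a ∈ L.lattice
    · have h1 : AnalyticAt ℂ k (a - a) := by rwa [sub_self]
      have h2 : AnalyticAt ℂ (fun z => k (z - a)) a :=
        h1.comp (f := fun z => z - a) (analyticAt_id.sub analyticAt_const)
      refine h2.congr (.of_forall fun z => ?_)
      have := hper ⟨a, ha⟩ (z - a)
      simp only [sub_add_cancel] at this
      exact this.symm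
    · have h1 : AnalyticAt ℂ (fun a => N a / (weierstrassSigma L a ^ 2 * weierstrassSigma L b ^ 2) +
          L.weierstrassP a - L.weierstrassP b) a := by
        refine ((AnalyticAt.div ?_ ?_ ?_).add (L.analyticOnNhd_weierstrassP a ha)).sub
          analyticAt_const
        · exact (((hσ.comp (differentiable_id.add_const b)).mul
            (hσ.comp (differentiable_id.sub_const b))).analyticAt a)
        · exact ((hσ.pow 2).mul_const _).analyticAt a
        · have hne := weierstrassSigma_ne_zero L ha
          positivity
      refine h1.congr ?_
      filter_upwards [L.isClosed_lattice.isOpen_compl.mem_nhds ha] with z hz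
      exact (if_neg hz).symm
  have hkd : Differentiable ℂ k := fun a => (hka a).differentiableAt
  have hconst := hkd.apply_eq_apply_of_bounded (IsZLattice.isCompact_range_of_periodic L.lattice k
    hkd.continuous fun z w hw => hper ⟨w, hw⟩ z).isBounded a b
  have hkb : k b = 0 := by
    simp [hk, hb, hN, weierstrassSigma_zero]
  rw [hkb] at hconst
  simp only [hk, if_neg ha] at hconst
  have hne := weierstrassSigma_ne_zero L ha
  have h6 : N a / (weierstrassSigma L a ^ 2 * weierstrassSigma L b ^ 2) =
      -(L.weierstrassP a - L.weierstrassP b) := by linear_combination hconst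
  rw [div_eq_iff (by positivity)] at h6
  change N a = _
  rw [h6]
  ring

/-- The entire function `σ² ℘ = σ'² - σ σ''`. -/
def sigmaSqP (z : ℂ) : ℂ :=
  deriv (weierstrassSigma L) z ^ 2 - weierstrassSigma L z * deriv (deriv (weierstrassSigma L)) z

theorem differentiable_deriv_weierstrassSigma : Differentiable ℂ (deriv (weierstrassSigma L)) :=
  ((differentiable_weierstrassSigma L).contDiff (n := 2)).differentiable_deriv_two

theorem differentiable_sigmaSqP : Differentiable ℂ (sigmaSqP L) :=
  ((differentiable_deriv_weierstrassSigma L).pow 2).sub ((differentiable_weierstrassSigma L).mul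
    ((differentiable_deriv_weierstrassSigma L).contDiff (n := 2)).differentiable_deriv_two)

theorem dense_compl_lattice : Dense ((L.lattice : Set ℂ)ᶜ) := by
  have : Countable L.lattice := L.latticeEquivProd.toEquiv.countable_iff.mpr inferInstance
  exact (Set.to_countable (L.lattice : Set ℂ)).dense_compl ℝ

/-- `σ(a + b) σ(a - b) = σ(a)² σ(b)² (℘(b) - ℘(a))` in terms of entire functions. -/
theorem weierstrassSigma_add_mul_sub' (a b : ℂ) :
    weierstrassSigma L (a + b) * weierstrassSigma L (a - b) =
      weierstrassSigma L a ^ 2 * sigmaSqP L b - sigmaSqP L a * weierstrassSigma L b ^ 2 := by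
  have hσ := (differentiable_weierstrassSigma L).continuous
  have hK := (differentiable_sigmaSqP L).continuous
  have h1 : ∀ a ∉ L.lattice, ∀ b ∉ L.lattice,
      weierstrassSigma L (a + b) * weierstrassSigma L (a - b) =
      weierstrassSigma L a ^ 2 * sigmaSqP L b - sigmaSqP L a * weierstrassSigma L b ^ 2 := by
    intro a ha b hb
    rw [weierstrassSigma_add_mul_sub L ha hb, sigmaSqP, sigmaSqP,
      deriv_weierstrassSigma_sq_sub L ha, deriv_weierstrassSigma_sq_sub L hb]
    ring
  have h2 : ∀ a ∉ L.lattice, ∀ b,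
      weierstrassSigma L (a + b) * weierstrassSigma L (a - b) =
      weierstrassSigma L a ^ 2 * sigmaSqP L b - sigmaSqP L a * weierstrassSigma L b ^ 2 :=
    fun a ha => congrFun <| Continuous.ext_on (dense_compl_lattice L) (by fun_prop) (by fun_prop)
      (fun b hb => h1 a ha b hb)
  exact congrFun (f := fun a => weierstrassSigma L (a + b) * weierstrassSigma L (a - b))
    (Continuous.ext_on (dense_compl_lattice L) (by fun_prop) (by fun_prop)
      (fun a ha => h2 a ha b)) a

/-- The three-term identity for `σ`. Each product `σ(a + b) σ(a - b)` is the minor of the vectors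
`(σ², σ² ℘)(a)` and `(σ², σ² ℘)(b)`, so this is the Plücker relation for four vectors in a plane. -/
theorem weierstrassSigma_three_term (a b c d : ℂ) :
    weierstrassSigma L (a + b) * weierstrassSigma L (a - b) *
        (weierstrassSigma L (c + d) * weierstrassSigma L (c - d)) +
      weierstrassSigma L (b + c) * weierstrassSigma L (b - c) *
        (weierstrassSigma L (a + d) * weierstrassSigma L (a - d)) +
      weierstrassSigma L (c + a) * weierstrassSigma L (c - a) *
        (weierstrassSigma L (b + d) * weierstrassSigma L (b - d)) = 0 := by
  simp only [weierstrassSigma_add_mul_sub']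
  ring

theorem phi_neg_neg (μ z : ℂ) : phi L (-μ) (-z) = -phi L μ z := by
  rw [phi, phi, show -z - -μ = -(z - μ) by ring, weierstrassSigma_neg, weierstrassSigma_neg,
    weierstrassSigma_neg L (-μ), neg_mul_neg, neg_div]

theorem phi_mul_phi_neg {μ z : ℂ} (hμ : μ ∉ L.lattice) (hz : z ∉ L.lattice) :
    phi L μ z * phi L μ (-z) = L.weierstrassP μ - L.weierstrassP z := by
  have h1 := weierstrassSigma_ne_zero L hμ
  have h2 := weierstrassSigma_ne_zero L hz
  have h3 := weierstrassSigma_add_mul_sub L hz hμ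
  rw [phi, phi, show -z - μ = -(z + μ) by ring, weierstrassSigma_neg, weierstrassSigma_neg,
    weierstrassSigma_neg]
  rw [div_mul_div_comm, div_eq_iff (by simp [h1, h2])]
  linear_combination -h3

/-- The addition theorem for `φ`, which is responsible for the commutativity of the Dunkl
operators. -/
theorem phi_three_term {a b c α β γ : ℂ} (habc : a + b + c = 0) (hαβγ : α + β + γ = 0)
    (ha : a ∉ L.lattice) (hb : b ∉ L.lattice) (hc : c ∉ L.lattice)
    (hα : α ∉ L.lattice) (hβ : β ∉ L.lattice) (hγ : γ ∉ L.lattice) :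
    phi L α a * phi L (-γ) b + phi L β b * phi L (-α) c + phi L γ c * phi L (-β) a = 0 := by
  -- the arguments are chosen so that their sums and differences are, up to sign, the arguments of
  -- `σ` in the numerators and denominators of the six values of `φ`
  have h := weierstrassSigma_three_term L ((a - b + β) / 2) ((γ - α - c) / 2) ((c - β) / 2)
    ((c + β) / 2)
  obtain rfl : c = -a - b := by linear_combination habc
  obtain rfl : γ = -α - β := by linear_combination hαβγ
  have e1 : (a - b + β) / 2 + (-α - β - α - (-a - b)) / 2 = a - α := by ring
  have e2 : (a - b + β) / 2 - (-α - β - α - (-a - b)) / 2 = -(b + (-α - β)) := by ring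
  have e3 : (-a - b - β) / 2 + (-a - b + β) / 2 = -a - b := by ring
  have e4 : (-a - b - β) / 2 - (-a - b + β) / 2 = -β := by ring
  have e5 : (-α - β - α - (-a - b)) / 2 + (-a - b - β) / 2 = -α - β := by ring
  have e6 : (-α - β - α - (-a - b)) / 2 - (-a - b - β) / 2 = -(-a - b + α) := by ring
  have e7 : (a - b + β) / 2 + (-a - b + β) / 2 = -(b - β) := by ring
  have e8 : (a - b + β) / 2 - (-a - b + β) / 2 = a := by ring
  have e9 : (-a - b - β) / 2 + (a - b + β) / 2 = -b := by ring
  have e10 : (-a - b - β) / 2 - (a - b + β) / 2 = -(a + β) := by ring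
  have e11 : (-α - β - α - (-a - b)) / 2 + (-a - b + β) / 2 = -α := by ring
  have e12 : (-α - β - α - (-a - b)) / 2 - (-a - b + β) / 2 = -(-a - b - (-α - β)) := by ring
  rw [e1, e2, e3, e4, e5, e6, e7, e8, e9, e10, e11, e12] at h
  simp only [weierstrassSigma_neg] at h
  have na := weierstrassSigma_ne_zero L ha
  have nb := weierstrassSigma_ne_zero L hb
  have nc := weierstrassSigma_ne_zero L hc
  have nα := weierstrassSigma_ne_zero L hα
  have nβ := weierstrassSigma_ne_zero L hβ
  have nγ := weierstrassSigma_ne_zero L hγ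
  simp only [phi, sub_neg_eq_add, neg_neg, weierstrassSigma_neg]
  generalize weierstrassSigma L (-a - b) = sc at *
  generalize weierstrassSigma L (-α - β) = sγ at *
  generalize weierstrassSigma L (a - α) = s1 at *
  generalize weierstrassSigma L (b + (-α - β)) = s2 at *
  generalize weierstrassSigma L (-a - b + α) = s3 at *
  generalize weierstrassSigma L (b - β) = s4 at *
  generalize weierstrassSigma L (a + β) = s5 at *
  generalize weierstrassSigma L (-a - b - (-α - β)) = s6 at *
  field_simp
  linear_combination -h

end Sigma

/-! ### Division of analytic functions by a linear form -/

section Division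

variable {E : Type*} [NormedAddCommGroup E] [NormedSpace ℂ E]

/-- The projection onto the kernel of `ℓ` along `e`. -/
def kerProj (ℓ : E →L[ℂ] ℂ) (e : E) : E →L[ℂ] E := ContinuousLinearMap.id ℂ E - ℓ.smulRight e

theorem kerProj_apply (ℓ : E →L[ℂ] ℂ) (e y : E) : kerProj ℓ e y = y - ℓ y • e := by
  simp [kerProj]

/-- The power series of `(f(y) - f(π y)) / ℓ(y)`, where `π` is the projection onto the kernel of `ℓ`
along `e`: the term of degree `m` is the telescoping sum over `k` of `p_{m + 1}` with `k` arguments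
`y`, one argument `e`, and `m - k` arguments `π y`. -/
def quotientSeries (p : FormalMultilinearSeries ℂ E ℂ) (ℓ : E →L[ℂ] ℂ) (e : E) :
    FormalMultilinearSeries ℂ E ℂ := fun m =>
  ∑ k : Fin (m + 1), ((p (m + 1)).curryMid k e).compContinuousLinearMap
    (fun i => if k.succAbove i < k then ContinuousLinearMap.id ℂ E else kerProj ℓ e)

/-- The homogeneous terms of `quotientSeries` multiplied by `ℓ` telescope. In `w k` the first `k`
arguments are `y` and the others `π y`. -/
theorem mul_quotientSeries (p : FormalMultilinearSeries ℂ E ℂ) (ℓ : E →L[ℂ] ℂ) (e : E) (m : ℕ)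
    (y : E) :
    ℓ y * quotientSeries p ℓ e m (fun _ => y) =
      p (m + 1) (fun _ => y) - p (m + 1) (fun _ => kerProj ℓ e y) := by
  set w : ℕ → Fin (m + 1) → E := fun k i => if (i : ℕ) < k then y else kerProj ℓ e y with hw
  have h1 : ∀ k : Fin (m + 1), p (m + 1) (w (k + 1)) - p (m + 1) (w k) =
      ℓ y * ((p (m + 1)).curryMid k e).compContinuousLinearMap
        (fun i => if k.succAbove i < k then ContinuousLinearMap.id ℂ E else kerProj ℓ e)
        (fun _ => y) := by
    intro k
    have e1 : w (k + 1) = Function.update (w k) k y := by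
      ext i
      by_cases hik : i = k
      · subst hik
        simp [hw]
      · have : (i : ℕ) ≠ k := fun h => hik (Fin.ext h)
        simp only [hw, Function.update_of_ne hik]
        congr 1
        simp only [eq_iff_iff]
        omega
    have e2 : w k = Function.update (w k) k (kerProj ℓ e y) := by
      ext i
      by_cases hik : i = k
      · subst hik
        simp [hw]
      · rw [Function.update_of_ne hik]
    have e3 : Function.update (w k) k e = k.insertNth e (fun i =>
        (if k.succAbove i < k then ContinuousLinearMap.id ℂ E else kerProj ℓ e) y) := by
      rw [Fin.eq_insertNth_iff]
      refine ⟨by simp, ?_⟩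
      ext i
      simp only [Fin.removeNth_apply, Function.update_of_ne (Fin.succAbove_ne k i), hw,
        ← Fin.lt_def]
      split_ifs <;> rfl
    rw [ContinuousMultilinearMap.compContinuousLinearMap_apply,
      ContinuousMultilinearMap.curryMid_apply, ← e3, e1]
    nth_rewrite 2 [e2]
    rw [← ContinuousMultilinearMap.map_update_sub, kerProj_apply, sub_sub_cancel,
      ContinuousMultilinearMap.map_update_smul, smul_eq_mul]
  have h2 : quotientSeries p ℓ e m (fun _ => y) = ∑ k : Fin (m + 1),
      ((p (m + 1)).curryMid k e).compContinuousLinearMap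
        (fun i => if k.succAbove i < k then ContinuousLinearMap.id ℂ E else kerProj ℓ e)
        (fun _ => y) := by
    simp [quotientSeries]
  rw [h2, Finset.mul_sum, ← Finset.sum_congr rfl fun k _ => h1 k,
    Fin.sum_univ_eq_sum_range (fun k => p (m + 1) (w (k + 1)) - p (m + 1) (w k)),
    Finset.sum_range_sub (fun k => p (m + 1) (w k))]
  congr 2
  · ext i
    exact if_pos i.2

theorem norm_quotientSeries_le (p : FormalMultilinearSeries ℂ E ℂ) (ℓ : E →L[ℂ] ℂ) (e : E) (m : ℕ) :
    ‖quotientSeries p ℓ e m‖ ≤ (m + 1) * (‖p (m + 1)‖ * ‖e‖ * (1 + ‖kerProj ℓ e‖) ^ m) := by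
  refine (norm_sum_le _ _).trans ?_
  have : ∀ k ∈ (Finset.univ : Finset (Fin (m + 1))),
      ‖((p (m + 1)).curryMid k e).compContinuousLinearMap
        (fun i => if k.succAbove i < k then ContinuousLinearMap.id ℂ E else kerProj ℓ e)‖ ≤
      ‖p (m + 1)‖ * ‖e‖ * (1 + ‖kerProj ℓ e‖) ^ m := by
    intro k _
    refine (ContinuousMultilinearMap.norm_compContinuousLinearMap_le _ _).trans ?_
    gcongr
    · exact (ContinuousLinearMap.le_opNorm _ _).trans_eq
        (by rw [ContinuousMultilinearMap.norm_curryMid])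
    · refine (Finset.prod_le_prod (fun _ _ => norm_nonneg _) (fun i _ => ?_)).trans_eq
        (by rw [Finset.prod_const, Finset.card_univ, Fintype.card_fin])
      split_ifs
      · exact ContinuousLinearMap.norm_id_le.trans (by simp)
      · linarith
  refine (Finset.sum_le_card_nsmul _ _ _ this).trans_eq ?_
  simp

theorem quotientSeries_radius_pos (p : FormalMultilinearSeries ℂ E ℂ) (hp : 0 < p.radius)
    (ℓ : E →L[ℂ] ℂ) (e : E) : 0 < (quotientSeries p ℓ e).radius := by
  obtain ⟨r, hr0, hr⟩ := ENNReal.lt_iff_exists_nnreal_btwn.mp hp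
  have hr0' : 0 < r := by simpa using hr0
  obtain ⟨C, hC, hpC⟩ := p.norm_mul_pow_le_of_lt_radius hr
  set K : NNReal := 2 * (1 + ‖kerProj ℓ e‖₊) with hK
  have hKpos : 0 < K := by positivity
  refine lt_of_lt_of_le (b := ((r / K : NNReal) : ENNReal)) (by exact_mod_cast div_pos hr0' hKpos)
    (FormalMultilinearSeries.le_radius_of_bound _ (C * ‖e‖ / r) fun m => ?_)
  have hrr : (0 : ℝ) < r := hr0'
  have hKr : (K : ℝ) = 2 * (1 + ‖kerProj ℓ e‖) := by simp [hK]
  have hm : ((m : ℝ) + 1) ≤ 2 ^ m := by exact_mod_cast Nat.lt_two_pow_self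
  have hA : 0 < 1 + ‖kerProj ℓ e‖ := by positivity
  rw [NNReal.coe_div, hKr, div_pow, mul_pow]
  calc ‖quotientSeries p ℓ e m‖ * ((r : ℝ) ^ m / (2 ^ m * (1 + ‖kerProj ℓ e‖) ^ m))
      ≤ 2 ^ m * (‖p (m + 1)‖ * ‖e‖ * (1 + ‖kerProj ℓ e‖) ^ m) *
        ((r : ℝ) ^ m / (2 ^ m * (1 + ‖kerProj ℓ e‖) ^ m)) := by
        gcongr
        exact (norm_quotientSeries_le p ℓ e m).trans (by gcongr)
    _ = (‖p (m + 1)‖ * (r : ℝ) ^ (m + 1)) * ‖e‖ / r := by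
        field_simp
        ring
    _ ≤ C * ‖e‖ / r := by
        gcongr
        exact hpC (m + 1)

/-- An analytic function vanishing on the hyperplane `ℓ = 0` is divisible by `ℓ`, locally. -/
theorem exists_analyticAt_eq_mul {f : E → ℂ} {ℓ : E →L[ℂ] ℂ} {e x : E} (he : ℓ e = 1)
    (hx : ℓ x = 0) (hf : AnalyticAt ℂ f x) (h0 : ∀ᶠ y in nhds x, ℓ y = 0 → f y = 0) :
    ∃ g : E → ℂ, AnalyticAt ℂ g x ∧ ∀ᶠ y in nhds x, f y = ℓ y * g y := by
  obtain ⟨p, r, hp⟩ := hf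
  set q := quotientSeries p ℓ e with hq
  have hqr : 0 < q.radius := quotientSeries_radius_pos p (hp.r_pos.trans_le hp.r_le) ℓ e
  have hqs := q.hasFPowerSeriesOnBall hqr
  have hqa : AnalyticAt ℂ q.sum (x - x) := by
    rw [sub_self]
    exact hqs.analyticAt
  refine ⟨fun y => q.sum (y - x), hqa.comp (f := fun y => y - x)
    (analyticAt_id.sub analyticAt_const), ?_⟩
  have hsub : Filter.Tendsto (fun y => y - x) (nhds x) (nhds 0) := by
    have : Continuous fun y : E => y - x := by fun_prop
    simpa using this.tendsto x
  have hπ : Filter.Tendsto (fun y => kerProj ℓ e (y - x)) (nhds x) (nhds 0) := by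
    have h := ((kerProj ℓ e).continuous.tendsto 0).comp hsub
    rwa [map_zero] at h
  have hπx : Filter.Tendsto (fun y => x + kerProj ℓ e (y - x)) (nhds x) (nhds x) := by
    simpa using hπ.const_add x
  filter_upwards [hsub (Metric.eball_mem_nhds 0 hp.r_pos), hπ (Metric.eball_mem_nhds 0 hp.r_pos),
    hsub (Metric.eball_mem_nhds 0 hqr), hπx h0] with y h1 h2 h3 h4
  have s1 := hp.hasSum h1
  have s2 := hp.hasSum h2
  have s3 := (hqs.hasSum h3).mul_left (ℓ (y - x))
  have hker : ℓ (x + kerProj ℓ e (y - x)) = 0 := by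
    simp [kerProj_apply, hx, he]
  rw [h4 hker] at s2
  have s4 := s1.sub s2
  rw [← hasSum_nat_add_iff' 1] at s4
  simp only [hq, mul_quotientSeries] at s3
  have hy : ℓ (y - x) = ℓ y := by simp [hx]
  have := s4.unique s3
  have hc : p 0 (fun _ : Fin 0 => y - x) = p 0 (fun _ : Fin 0 => kerProj ℓ e (y - x)) :=
    congrArg _ (Subsingleton.elim _ _)
  simp only [add_sub_cancel, sub_zero, Finset.range_one, Finset.sum_singleton, zero_add, hc,
    sub_self, hy] at this
  exact this

open Classical in
/-- The quotient of `f` by the linear form `ℓ`, extended to the kernel of `ℓ` by the derivative of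
`f` in the direction of `e`. -/
def divLinear (f : E → ℂ) (ℓ : E →L[ℂ] ℂ) (e : E) (y : E) : ℂ :=
  if ℓ y = 0 then fderiv ℂ f y e else f y / ℓ y

theorem analyticAt_divLinear {f : E → ℂ} {ℓ : E →L[ℂ] ℂ} {e x : E} (he : ℓ e = 1)
    (hf : AnalyticAt ℂ f x) (h0 : ∀ᶠ y in nhds x, ℓ y = 0 → f y = 0) :
    AnalyticAt ℂ (divLinear f ℓ e) x := by
  by_cases hx : ℓ x = 0
  · obtain ⟨g, hg, hfg⟩ := exists_analyticAt_eq_mul he hx hf h0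
    refine hg.congr ?_
    filter_upwards [hg.eventually_analyticAt, hfg.eventually_nhds] with y hgy hy
    by_cases hly : ℓ y = 0
    · have h1 : f =ᶠ[nhds y] fun z => ℓ z * g z := hy
      rw [divLinear, if_pos hly, h1.fderiv_eq,
        fderiv_fun_mul ℓ.differentiableAt hgy.differentiableAt]
      simp [hly, he]
    · rw [divLinear, if_neg hly, hy.self_of_nhds]
      field_simp
  · have h1 : AnalyticAt ℂ (fun y => f y / ℓ y) x := hf.div (ℓ.analyticAt x) hx
    refine h1.congr ?_
    filter_upwards [ℓ.continuous.continuousAt.eventually_ne hx] with y hy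
    rw [divLinear, if_neg hy]

theorem mul_divLinear {f : E → ℂ} {ℓ : E →L[ℂ] ℂ} (e : E) {y : E} (h0 : ℓ y = 0 → f y = 0) :
    ℓ y * divLinear f ℓ e y = f y := by
  rw [divLinear]
  split_ifs with h
  · rw [h, zero_mul, h0 h]
  · field_simp

end Division

/-! ### Analytic families in the crossed product -/

section Families

variable {n : ℕ}

/-- Multiplication operators, as a ring homomorphism `ℂ(V) → 𝒟(V)`. -/
def mulOpHom : Mer n →+* DiffOp n where
  toFun := mulOp
  map_one' := Subtype.ext <| LinearMap.ext fun f => one_mul f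
  map_mul' a b := Subtype.ext <| LinearMap.ext fun f => mul_assoc a b f
  map_zero' := Subtype.ext <| LinearMap.ext fun f => zero_mul f
  map_add' a b := Subtype.ext <| LinearMap.ext fun f => add_mul a b f

theorem mulOpHom_apply (g : Mer n) : mulOpHom g = mulOp g := rfl

theorem dOp_mul_mulOp (i : Fin n) (g : Mer n) :
    dOp i * mulOp g = mulOp g * dOp i + mulOp (pd i g) :=
  Subtype.ext <| LinearMap.ext fun f => by
    change pd i (g * f) = g * pd i f + pd i g * f
    rw [Derivation.leibniz, smul_eq_mul, smul_eq_mul, mul_comm f]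

theorem smul_mulOp (w : Equiv.Perm (Fin n)) (g : Mer n) :
    w • mulOp g = mulOp (permMer w g) :=
  Subtype.ext <| LinearMap.ext fun f => by
    change permMer w (g * permMer w⁻¹ f) = permMer w g * f
    rw [map_mul, permMer_apply_inv]

theorem smul_dOp (w : Equiv.Perm (Fin n)) (i : Fin n) : w • dOp i = dOp (w i) :=
  Subtype.ext <| LinearMap.ext fun f => by
    change permMer w (pd i (permMer w⁻¹ f)) = pd (w i) f
    rw [← pd_permMer, permMer_apply_inv]

theorem mulOp_algebraMap (r : ℂ) : mulOp (algebraMap ℂ (Mer n) r) = algebraMap ℂ (DiffOp n) r :=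
  Subtype.ext <| LinearMap.ext fun f => (Algebra.smul_def r f).symm

@[elab_as_elim]
theorem DiffOp.induction {p : DiffOp n → Prop} (mulOp : ∀ g, p (mulOp g)) (dOp : ∀ i, p (dOp i))
    (add : ∀ a b, p a → p b → p (a + b)) (mul : ∀ a b, p a → p b → p (a * b)) (a : DiffOp n) :
    p a := by
  obtain ⟨a, ha⟩ := a
  induction ha using Algebra.adjoin_induction with
  | mem a h =>
    rcases h with ⟨g, rfl⟩ | ⟨i, rfl⟩
    · exact mulOp g
    · exact dOp i
  | algebraMap r =>
    have := mulOp (algebraMap ℂ (Mer n) r)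
    rw [mulOp_algebraMap] at this
    exact this
  | add a b ha hb h1 h2 => exact add ⟨a, ha⟩ ⟨b, hb⟩ h1 h2
  | mul a b ha hb h1 h2 => exact mul ⟨a, ha⟩ ⟨b, hb⟩ h1 h2

/-- The inclusion `ℂ(V) → 𝒟(V) * S_n`. -/
def merHom : Mer n →+* Crossed n :=
  (SkewMonoidAlgebra.singleOneRingHom (k := DiffOp n) (G := Equiv.Perm (Fin n))).comp mulOpHom

theorem merHom_apply (g : Mer n) : merHom g = SkewMonoidAlgebra.single 1 (mulOp g) := rfl

/-- `𝒟(V) * S_n` as a vector space over `ℂ(V)`, by multiplication from the left. -/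
instance : Module (Mer n) (Crossed n) := Module.compHom (Crossed n) merHom

theorem mer_smul_def (g : Mer n) (P : Crossed n) : g • P = merHom g * P := rfl

theorem mer_smul_mul (g : Mer n) (P Q : Crossed n) : g • P * Q = g • (P * Q) := mul_assoc _ _ _

theorem merHom_algebraMap (c : ℂ) : merHom (algebraMap ℂ (Mer n) c) =
    algebraMap ℂ (Crossed n) c := by
  rw [merHom_apply, SkewMonoidAlgebra.coe_algebraMap, Function.comp_apply]
  rw [mulOp_algebraMap]

theorem algebraMap_smul_crossed (c : ℂ) (P : Crossed n) : algebraMap ℂ (Mer n) c • P = c • P := by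
  rw [mer_smul_def, merHom_algebraMap, Algebra.smul_def]

/-- The family `c(v, x)` of entire functions of `x ∈ V` depends analytically on `v ∈ W`. -/
def IsAnalyticFamily (W : Set (Fin n → ℂ)) (c : (Fin n → ℂ) → Entire n) : Prop :=
  ∀ v ∈ W, ∀ x : Fin n → ℂ,
    AnalyticAt ℂ (fun p : (Fin n → ℂ) × (Fin n → ℂ) => (c p.1).1 p.2) (v, x)

variable {W : Set (Fin n → ℂ)}

theorem IsAnalyticFamily.mono {W' : Set (Fin n → ℂ)} {c : (Fin n → ℂ) → Entire n}
    (hc : IsAnalyticFamily W c) (h : W' ⊆ W) : IsAnalyticFamily W' c := fun v hv x => hc v (h hv) x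

theorem isAnalyticFamily_const (a : Entire n) : IsAnalyticFamily W fun _ => a := fun v _ x =>
  (a.2 x).comp (f := fun p : (Fin n → ℂ) × (Fin n → ℂ) => p.2) (x := (v, x)) analyticAt_snd

theorem isAnalyticFamily_scalar {f : (Fin n → ℂ) → ℂ} (hf : ∀ v ∈ W, AnalyticAt ℂ f v) :
    IsAnalyticFamily W fun v => algebraMap ℂ (Entire n) (f v) := fun v hv x =>
  (hf v hv).comp (f := fun p : (Fin n → ℂ) × (Fin n → ℂ) => p.1) (x := (v, x)) analyticAt_fst

theorem IsAnalyticFamily.add {c d : (Fin n → ℂ) → Entire n} (hc : IsAnalyticFamily W c)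
    (hd : IsAnalyticFamily W d) : IsAnalyticFamily W fun v => c v + d v := fun v hv x =>
  (hc v hv x).add (hd v hv x)

theorem IsAnalyticFamily.mul {c d : (Fin n → ℂ) → Entire n} (hc : IsAnalyticFamily W c)
    (hd : IsAnalyticFamily W d) : IsAnalyticFamily W fun v => c v * d v := fun v hv x =>
  (hc v hv x).mul (hd v hv x)

theorem IsAnalyticFamily.sum {ι : Type*} (s : Finset ι) {c : ι → (Fin n → ℂ) → Entire n}
    (hc : ∀ i ∈ s, IsAnalyticFamily W (c i)) : IsAnalyticFamily W fun v => ∑ i ∈ s, c i v := by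
  classical
  induction s using Finset.induction_on with
  | empty => simpa using isAnalyticFamily_const 0
  | insert a s ha ih =>
    simp only [Finset.sum_insert ha]
    exact (hc a (by simp)).add (ih fun i hi => hc i (by simp [hi]))

theorem IsAnalyticFamily.perm {c : (Fin n → ℂ) → Entire n} (hc : IsAnalyticFamily W c)
    (w : Equiv.Perm (Fin n)) : IsAnalyticFamily W fun v => permEntire w (c v) := fun v hv x => by
  let T : ((Fin n → ℂ) × (Fin n → ℂ)) →L[ℂ] ((Fin n → ℂ) × (Fin n → ℂ)) :=
    (ContinuousLinearMap.fst ℂ _ _).prod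
      ((LinearMap.toContinuousLinearMap (LinearMap.funLeft ℂ ℂ w)).comp
        (ContinuousLinearMap.snd ℂ _ _))
  exact (hc v hv (fun i => x (w i))).comp (f := T) (T.analyticAt (v, x))

theorem IsAnalyticFamily.pd {c : (Fin n → ℂ) → Entire n} (hc : IsAnalyticFamily W c)
    (i : Fin n) : IsAnalyticFamily W fun v => pdEntire i (c v) := fun v hv x => by
  have h1 := (hc v hv x).fderiv
  have h2 : AnalyticAt ℂ (fun p : (Fin n → ℂ) × (Fin n → ℂ) =>
      fderiv ℂ (fun p : (Fin n → ℂ) × (Fin n → ℂ) => (c p.1).1 p.2) p (0, Pi.single i 1)) (v, x) :=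
    ((ContinuousLinearMap.apply ℂ ℂ
      ((0, Pi.single i 1) : (Fin n → ℂ) × (Fin n → ℂ))).analyticAt _).comp h1
  refine h2.congr ?_
  filter_upwards [(hc v hv x).eventually_analyticAt] with p hp
  change _ = fderiv ℂ (c p.1).1 p.2 (Pi.single i 1)
  have h3 : HasFDerivAt (fun y : Fin n → ℂ => (p.1, y))
      (ContinuousLinearMap.inr ℂ (Fin n → ℂ) (Fin n → ℂ)) p.2 := hasFDerivAt_prodMk_right _ _
  have h4 := (hp.differentiableAt.hasFDerivAt (x := p)).comp (f := fun y : Fin n → ℂ => (p.1, y))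
    p.2 h3
  rw [show (c p.1).1 = (fun p : (Fin n → ℂ) × (Fin n → ℂ) => (c p.1).1 p.2) ∘
    (fun y : Fin n → ℂ => (p.1, y)) from rfl, h4.fderiv]
  rfl

/-- The additive monoid of the finite sums of families `c(v, x) P` on `W`, with `c` an analytic
family of entire functions and `P` a constant operator; `fam` is the same set as an algebra. -/
def famAdd (W : Set (Fin n → ℂ)) : AddSubmonoid ((Fin n → ℂ) → Crossed n) :=
  AddSubmonoid.closure {F | ∃ (c : (Fin n → ℂ) → Entire n) (P : Crossed n),
    IsAnalyticFamily W c ∧ ∀ v ∈ W, F v = algebraMap (Entire n) (Mer n) (c v) • P}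

theorem elem_mem_famAdd {c : (Fin n → ℂ) → Entire n} (hc : IsAnalyticFamily W c)
    (P : Crossed n) : (fun v => algebraMap (Entire n) (Mer n) (c v) • P) ∈ famAdd W :=
  AddSubmonoid.subset_closure ⟨c, P, hc, fun _ _ => rfl⟩

theorem famAdd_smul {c : (Fin n → ℂ) → Entire n} (hc : IsAnalyticFamily W c)
    {F : (Fin n → ℂ) → Crossed n} (hF : F ∈ famAdd W) :
    (fun v => algebraMap (Entire n) (Mer n) (c v) • F v) ∈ famAdd W := by
  induction hF using AddSubmonoid.closure_induction with
  | mem F hF =>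
    obtain ⟨d, P, hd, h⟩ := hF
    refine AddSubmonoid.subset_closure ⟨fun v => c v * d v, P, hc.mul hd, fun v hv => ?_⟩
    simp only [h v hv, map_mul, mul_smul]
  | zero =>
    convert! zero_mem (famAdd W) using 1
    ext1 v
    exact smul_zero _
  | add F G _ _ hF hG =>
    convert! add_mem hF hG using 1
    ext1 v
    exact smul_add _ _ _

theorem famAdd_mul_const {F : (Fin n → ℂ) → Crossed n} (hF : F ∈ famAdd W) (Q : Crossed n) :
    (fun v => F v * Q) ∈ famAdd W := by
  induction hF using AddSubmonoid.closure_induction with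
  | mem F hF =>
    obtain ⟨d, P, hd, h⟩ := hF
    exact AddSubmonoid.subset_closure ⟨d, P * Q, hd, fun v hv => by
      simp only [h v hv, mer_smul_mul]⟩
  | zero =>
    convert! zero_mem (famAdd W) using 1
  | add F G _ _ hF hG =>
    convert! add_mem hF hG using 1
    ext1 v
    exact add_mul _ _ _

/-- Coefficients can be moved to the left of a differential operator. -/
theorem diffOp_mul_coeff_mem (a : DiffOp n) : ∀ (d : (Fin n → ℂ) → Entire n),
    IsAnalyticFamily W d → (fun v => (SkewMonoidAlgebra.single 1 a : Crossed n) *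
      merHom (algebraMap (Entire n) (Mer n) (d v))) ∈ famAdd W := by
  induction a using DiffOp.induction with
  | mulOp g =>
    intro d hd
    convert! elem_mem_famAdd hd (merHom g) using 1
    ext1 v
    rw [mer_smul_def, ← map_mul, mul_comm, map_mul]
    rfl
  | dOp i =>
      intro d hd
      convert! add_mem (elem_mem_famAdd hd (SkewMonoidAlgebra.single 1 (dOp i)))
        (elem_mem_famAdd (hd.pd i) 1) using 1
      ext1 v
      rw [Pi.add_apply, mer_smul_def, mer_smul_def, merHom_apply, merHom_apply, mul_one,
        SkewMonoidAlgebra.single_mul_single, SkewMonoidAlgebra.single_mul_single, one_smul,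
        one_smul, one_mul, ← SkewMonoidAlgebra.single_add, dOp_mul_mulOp, pd_algebraMap]
  | add a b h1 h2 =>
    intro d hd
    convert! add_mem (h1 d hd) (h2 d hd) using 1
    ext1 v
    rw [Pi.add_apply, ← add_mul, ← SkewMonoidAlgebra.single_add]
  | mul a b h1 h2 =>
    intro d hd
    have h3 : ∀ F ∈ famAdd W, (fun v => (SkewMonoidAlgebra.single 1 a :
        Crossed n) * F v) ∈ famAdd W := by
      intro F hF
      induction hF using AddSubmonoid.closure_induction with
      | mem F hF =>
        obtain ⟨c, P, hc, h⟩ := hF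
        have h4 := famAdd_mul_const (h1 c hc) P
        have h5 : (fun v => (SkewMonoidAlgebra.single 1 a : Crossed n) * F v) -
            (fun v => (SkewMonoidAlgebra.single 1 a : Crossed n) *
              merHom (algebraMap (Entire n) (Mer n) (c v)) * P) ∈ famAdd W :=
          AddSubmonoid.subset_closure ⟨0, 0, isAnalyticFamily_const 0, fun v hv => by
            simp [h v hv, mer_smul_def, mul_assoc]⟩
        simpa using add_mem h5 h4
      | zero =>
        convert! zero_mem (famAdd W) using 1
        ext1 v
        exact mul_zero _
      | add F G _ _ hF hG =>
        convert! add_mem hF hG using 1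
        ext1 v
        exact mul_add _ _ _
    convert! h3 _ (h2 d hd) using 1
    ext1 v
    rw [← mul_assoc, SkewMonoidAlgebra.single_mul_single, one_smul, one_mul]

theorem const_mul_coeff_mem (P : Crossed n) {d : (Fin n → ℂ) → Entire n}
    (hd : IsAnalyticFamily W d) :
    (fun v => P * merHom (algebraMap (Entire n) (Mer n) (d v))) ∈ famAdd W := by
  induction P using SkewMonoidAlgebra.induction with
  | h0 =>
    convert! zero_mem (famAdd W) using 1
  | ha w a P _ _ hP =>
    convert! add_mem (famAdd_mul_const (diffOp_mul_coeff_mem a _ (hd.perm w))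
      (SkewMonoidAlgebra.single w 1)) hP using 1
    ext1 v
    rw [Pi.add_apply, add_mul]
    congr 1
    rw [merHom_apply, merHom_apply, SkewMonoidAlgebra.single_mul_single,
      SkewMonoidAlgebra.single_mul_single, SkewMonoidAlgebra.single_mul_single, one_smul, one_mul,
      one_mul, mul_one, smul_one, mul_one, smul_mulOp, permMer_algebraMap]

/-- The algebra of analytic families `F(v) = ∑_k c_k(v, x) P_k`, `v ∈ W`, in `𝒟(V) * S_n`, where
the `P_k` do not depend on `v`. The values of `F` outside `W` are arbitrary. -/
def fam (W : Set (Fin n → ℂ)) : Subalgebra ℂ ((Fin n → ℂ) → Crossed n) where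
  toAddSubmonoid := famAdd W
  mul_mem' {F G} hF hG := by
    change F ∈ famAdd W at hF
    change G ∈ famAdd W at hG
    change F * G ∈ famAdd W
    have h1 : ∀ P : Crossed n, (fun v => P * G v) ∈ famAdd W := by
      intro P
      induction hG using AddSubmonoid.closure_induction with
      | mem G hG =>
        obtain ⟨d, Q, hd, h⟩ := hG
        have h4 := famAdd_mul_const (const_mul_coeff_mem P hd) Q
        have h5 : (fun v => P * G v) - (fun v => P *
            merHom (algebraMap (Entire n) (Mer n) (d v)) * Q) ∈ famAdd W :=
          AddSubmonoid.subset_closure ⟨0, 0, isAnalyticFamily_const 0, fun v hv => by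
            simp [h v hv, mer_smul_def, mul_assoc]⟩
        simpa using add_mem h5 h4
      | zero =>
        convert! zero_mem (famAdd W) using 1
        ext1 v
        exact mul_zero _
      | add F G _ _ hF hG =>
        convert! add_mem hF hG using 1
        ext1 v
        exact mul_add _ _ _
    induction hF using AddSubmonoid.closure_induction with
    | mem F hF =>
      obtain ⟨c, P, hc, h⟩ := hF
      have h4 := famAdd_smul hc (h1 P)
      have h5 : F * G - (fun v => algebraMap (Entire n) (Mer n) (c v) • (P * G v)) ∈ famAdd W :=
        AddSubmonoid.subset_closure ⟨0, 0, isAnalyticFamily_const 0, fun v hv => by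
          simp [h v hv, mer_smul_mul]⟩
      simpa using add_mem h5 h4
    | zero => simp
    | add F F' _ _ hF hF' =>
      rw [add_mul]
      exact add_mem hF hF'
  algebraMap_mem' r := by
    change _ ∈ famAdd W
    convert! elem_mem_famAdd (isAnalyticFamily_const 1) (algebraMap ℂ (Crossed n) r) using 1
    ext1 v
    simp

theorem mem_fam_of_eqOn {F G : (Fin n → ℂ) → Crossed n} (hG : G ∈ fam W)
    (h : ∀ v ∈ W, F v = G v) : F ∈ fam W := by
  have h5 : F - G ∈ fam W := AddSubmonoid.subset_closure ⟨0, 0, isAnalyticFamily_const 0,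
    fun v hv => by simp [h v hv]⟩
  simpa using add_mem h5 hG

theorem coeff_smul_mem_fam {c : (Fin n → ℂ) → Entire n} (hc : IsAnalyticFamily W c)
    (P : Crossed n) : (fun v => algebraMap (Entire n) (Mer n) (c v) • P) ∈ fam W :=
  elem_mem_famAdd hc P

theorem const_mem_fam (P : Crossed n) : (fun _ => P) ∈ fam W := by
  simpa using coeff_smul_mem_fam (W := W) (isAnalyticFamily_const 1) P

theorem scalar_smul_mem_fam {f : (Fin n → ℂ) → ℂ} (hf : ∀ v ∈ W, AnalyticAt ℂ f v)
    {F : (Fin n → ℂ) → Crossed n} (hF : F ∈ fam W) : (fun v => f v • F v) ∈ fam W := by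
  have := famAdd_smul (isAnalyticFamily_scalar hf) hF
  simp only [← IsScalarTower.algebraMap_apply, algebraMap_smul_crossed] at this
  exact this

theorem fam_mono {W' : Set (Fin n → ℂ)} (h : W' ⊆ W) {F : (Fin n → ℂ) → Crossed n}
    (hF : F ∈ fam W) : F ∈ fam W' := by
  change F ∈ famAdd W at hF
  induction hF using AddSubmonoid.closure_induction with
  | mem F hF =>
    obtain ⟨c, P, hc, hF⟩ := hF
    exact AddSubmonoid.subset_closure ⟨c, P, hc.mono h, fun v hv => hF v (h hv)⟩
  | zero => exact zero_mem _
  | add F G _ _ hF hG => exact add_mem hF hG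

theorem exists_eq_sum_of_mem_fam {F : (Fin n → ℂ) → Crossed n} (hF : F ∈ fam W) :
    ∃ (m : ℕ) (c : Fin m → (Fin n → ℂ) → Entire n) (P : Fin m → Crossed n),
      (∀ k, IsAnalyticFamily W (c k)) ∧
      ∀ v ∈ W, F v = ∑ k, algebraMap (Entire n) (Mer n) (c k v) • P k := by
  change F ∈ famAdd W at hF
  induction hF using AddSubmonoid.closure_induction with
  | mem F hF =>
    obtain ⟨c, P, hc, h⟩ := hF
    exact ⟨1, fun _ => c, fun _ => P, fun _ => hc, fun v hv => by simpa using h v hv⟩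
  | zero => exact ⟨0, Fin.elim0, Fin.elim0, fun k => k.elim0, fun v _ => by simp⟩
  | add F G _ _ hF hG =>
    obtain ⟨m, c, P, hc, h⟩ := hF
    obtain ⟨m', c', P', hc', h'⟩ := hG
    refine ⟨m + m', Fin.append c c', Fin.append P P', fun k => ?_, fun v hv => ?_⟩
    · induction k using Fin.addCases with
      | left k => simpa using hc k
      | right k => simpa using hc' k
    · rw [Pi.add_apply, h v hv, h' v hv, Fin.sum_univ_add]
      simp

theorem mem_fam_of_eq_sum {ι : Type*} [Fintype ι] {F : (Fin n → ℂ) → Crossed n}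
    {c : ι → (Fin n → ℂ) → Entire n} {P : ι → Crossed n}
    (hc : ∀ k, IsAnalyticFamily W (c k))
    (h : ∀ v ∈ W, F v = ∑ k, algebraMap (Entire n) (Mer n) (c k v) • P k) : F ∈ fam W := by
  refine mem_fam_of_eqOn (sum_mem (t := Finset.univ) fun k _ => coeff_smul_mem_fam (hc k) (P k))
    fun v hv => ?_
  rw [h v hv, Finset.sum_apply]

/-- The constant operators in an analytic family can be chosen linearly independent over `ℂ(V)`. -/
theorem exists_eq_sum_linearIndependent {F : (Fin n → ℂ) → Crossed n} (hF : F ∈ fam W) :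
    ∃ (m : ℕ) (c : Fin m → (Fin n → ℂ) → Entire n) (P : Fin m → Crossed n),
      LinearIndependent (Mer n) P ∧ (∀ k, IsAnalyticFamily W (c k)) ∧
      ∀ v ∈ W, F v = ∑ k, algebraMap (Entire n) (Mer n) (c k v) • P k := by
  obtain ⟨m, c, P, hc, h⟩ := exists_eq_sum_of_mem_fam hF
  set S := Submodule.span (Mer n) (Set.range P) with hS
  have : Module.Finite (Mer n) S := Module.Finite.span_of_finite _ (Set.finite_range P)
  set Q := Module.finBasis (Mer n) S
  have hPS : ∀ k, P k ∈ S := fun k => Submodule.subset_span ⟨k, rfl⟩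
  have hrepr : ∀ k, P k = ∑ l, Q.repr ⟨P k, hPS k⟩ l • (Q l : Crossed n) := by
    intro k
    have := congrArg S.subtype (Q.sum_repr ⟨P k, hPS k⟩)
    rw [map_sum] at this
    simp only [map_smul] at this
    exact this.symm
  obtain ⟨b, hb⟩ := IsLocalization.exist_integer_multiples_of_finite (nonZeroDivisors (Entire n))
    (fun kl : Fin m × Fin (Module.finrank (Mer n) S) => Q.repr ⟨P kl.1, hPS kl.1⟩ kl.2)
  choose a ha using hb
  have hb0 : algebraMap (Entire n) (Mer n) b ≠ 0 :=
    (map_ne_zero_iff _ (IsFractionRing.injective (Entire n) (Mer n))).mpr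
      (nonZeroDivisors.ne_zero b.2)
  have ha' : ∀ k l, Q.repr ⟨P k, hPS k⟩ l =
      algebraMap (Entire n) (Mer n) (a (k, l)) * (algebraMap (Entire n) (Mer n) b)⁻¹ := by
    intro k l
    rw [ha (k, l), Algebra.smul_def, mul_comm (algebraMap _ _ _), mul_assoc, mul_inv_cancel₀ hb0,
      mul_one]
  have hQ : LinearIndependent (Mer n) (fun l => (Q l : Crossed n)) :=
    Q.linearIndependent.map' S.subtype (Submodule.ker_subtype S)
  refine ⟨_, fun l v => ∑ k, c k v * a (k, l),
    fun l => (algebraMap (Entire n) (Mer n) b)⁻¹ • (Q l : Crossed n), ?_, fun l => ?_, ?_⟩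
  · exact hQ.units_smul (fun _ => Units.mk0 _ (inv_ne_zero hb0))
  · exact IsAnalyticFamily.sum _ fun k _ => (hc k).mul (isAnalyticFamily_const _)
  · intro v hv
    rw [h v hv]
    simp only [map_sum, map_mul, Finset.sum_smul]
    rw [Finset.sum_comm]
    refine Finset.sum_congr rfl fun k _ => ?_
    conv_lhs => rw [hrepr k, Finset.smul_sum]
    refine Finset.sum_congr rfl fun l _ => ?_
    rw [ha', smul_smul, smul_smul, mul_assoc]

theorem algebraMap_entire_eq_zero {a : Entire n} :
    algebraMap (Entire n) (Mer n) a = 0 ↔ ∀ x, a.1 x = 0 := by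
  rw [map_eq_zero_iff _ (IsFractionRing.injective (Entire n) (Mer n))]
  exact ⟨fun h x => by rw [h]; rfl, fun h => Subtype.ext (funext h)⟩

/-- An analytic family that vanishes at points accumulating at `v` vanishes at `v`. -/
theorem fam_eq_zero_of_frequently {F : (Fin n → ℂ) → Crossed n} (hF : F ∈ fam W)
    {v : Fin n → ℂ} (hv : v ∈ W) (h : ∃ᶠ u in nhds v, u ∈ W ∧ F u = 0) : F v = 0 := by
  obtain ⟨m, c, P, hP, hc, hFc⟩ := exists_eq_sum_linearIndependent hF
  rw [hFc v hv]
  refine Finset.sum_eq_zero fun k _ => ?_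
  suffices algebraMap (Entire n) (Mer n) (c k v) = 0 by rw [this, zero_smul]
  rw [algebraMap_entire_eq_zero]
  intro x
  by_contra hx
  have h1 : ContinuousAt (fun u => (c k u).1 x) v :=
    (hc k v hv x).continuousAt.comp (f := fun u => (u, x))
      (continuousAt_id.prodMk continuousAt_const)
  refine h ?_
  filter_upwards [h1.eventually_ne hx] with u hu ⟨huW, h0⟩
  rw [hFc u huW] at h0
  exact hu (algebraMap_entire_eq_zero.mp (Fintype.linearIndependent_iff.mp hP _ h0 k) x)

/-- The linear form `(v, x) ↦ v_i - v_j`. -/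
def diffForm (i j : Fin n) : ((Fin n → ℂ) × (Fin n → ℂ)) →L[ℂ] ℂ :=
  (ContinuousLinearMap.proj (R := ℂ) (φ := fun _ : Fin n => ℂ) i -
    ContinuousLinearMap.proj (R := ℂ) (φ := fun _ : Fin n => ℂ) j).comp
    (ContinuousLinearMap.fst ℂ (Fin n → ℂ) (Fin n → ℂ))

theorem diffForm_apply (i j : Fin n) (p : (Fin n → ℂ) × (Fin n → ℂ)) :
    diffForm i j p = p.1 i - p.1 j := rfl

open Classical in
/-- The quotient of an analytic family of entire functions by `v_i - v_j`. -/
def divDiff (i j : Fin n) (c : (Fin n → ℂ) → Entire n) (v : Fin n → ℂ) :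
    Entire n :=
  if h : ∀ x, AnalyticAt ℂ (fun x => divLinear
    (fun p : (Fin n → ℂ) × (Fin n → ℂ) => (c p.1).1 p.2) (diffForm i j) (Pi.single i 1, 0) (v, x)) x
  then ⟨_, h⟩ else 0

theorem divDiff_spec (hW : IsOpen W) {i j : Fin n} (hij : i ≠ j) {c : (Fin n → ℂ) → Entire n}
    (hc : IsAnalyticFamily W c) (h0 : ∀ v ∈ W, v i = v j → c v = 0) :
    IsAnalyticFamily W (divDiff i j c) ∧
    (∀ v ∈ W, c v = algebraMap ℂ (Entire n) (v i - v j) * divDiff i j c v) ∧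
    ∀ v ∈ W, ∀ x, (divDiff i j c v).1 x = divLinear
    (fun p : (Fin n → ℂ) × (Fin n → ℂ) => (c p.1).1 p.2) (diffForm i j) (Pi.single i 1, 0)
      (v, x) := by
  have he : diffForm i j (Pi.single i 1, 0) = 1 := by
    simp [diffForm_apply, hij.symm]
  have hzero : ∀ v ∈ W, ∀ x, diffForm i j (v, x) = 0 → (c v).1 x = 0 := by
    intro v hv x h
    rw [h0 v hv (sub_eq_zero.mp h)]
    rfl
  have han : ∀ v ∈ W, ∀ x, AnalyticAt ℂ (divLinear
      (fun p : (Fin n → ℂ) × (Fin n → ℂ) => (c p.1).1 p.2) (diffForm i j) (Pi.single i 1, 0))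
      (v, x) := by
    intro v hv x
    refine analyticAt_divLinear he (hc v hv x) ?_
    filter_upwards [(hW.preimage continuous_fst).mem_nhds hv] with p hp
    exact hzero p.1 hp p.2
  have hval : ∀ v ∈ W, ∀ x, (divDiff i j c v).1 x = divLinear
      (fun p : (Fin n → ℂ) × (Fin n → ℂ) => (c p.1).1 p.2) (diffForm i j) (Pi.single i 1, 0)
      (v, x) := by
    intro v hv x
    have h : ∀ x, AnalyticAt ℂ (fun x => divLinear
      (fun p : (Fin n → ℂ) × (Fin n → ℂ) => (c p.1).1 p.2) (diffForm i j) (Pi.single i 1, 0)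
      (v, x)) x := fun x => (han v hv x).comp (f := fun x => (v, x))
        (analyticAt_const.prod analyticAt_id)
    have h2 : divDiff i j c v = ⟨_, h⟩ := dif_pos h
    rw [h2]
  refine ⟨fun v hv x => (han v hv x).congr ?_, fun v hv => Subtype.ext (funext fun x => ?_), hval⟩
  · filter_upwards [(hW.preimage continuous_fst).mem_nhds hv] with p hp
    exact (hval p.1 hp p.2).symm
  · change _ = (v i - v j) * (divDiff i j c v).1 x
    rw [hval v hv x]
    have := mul_divLinear (ℓ := diffForm i j)
      (f := fun p : (Fin n → ℂ) × (Fin n → ℂ) => (c p.1).1 p.2) (Pi.single i 1, 0) (y := (v, x))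
      (hzero v hv x)
    exact this.symm

/-- An analytic family vanishing on the hyperplane `v_i = v_j` is divisible by `v_i - v_j`. -/
theorem exists_fam_eq_smul (hW : IsOpen W) {i j : Fin n} (hij : i ≠ j)
    {F : (Fin n → ℂ) → Crossed n} (hF : F ∈ fam W) (h0 : ∀ v ∈ W, v i = v j → F v = 0) :
    ∃ G ∈ fam W, ∀ v ∈ W, F v = (v i - v j) • G v := by
  obtain ⟨m, c, P, hP, hc, hFc⟩ := exists_eq_sum_linearIndependent hF
  have hc0 : ∀ k, ∀ v ∈ W, v i = v j → c k v = 0 := by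
    intro k v hv hvij
    have h1 := h0 v hv hvij
    rw [hFc v hv] at h1
    exact Subtype.ext (funext fun x =>
      algebraMap_entire_eq_zero.mp (Fintype.linearIndependent_iff.mp hP _ h1 k) x)
  have hd := fun k => divDiff_spec hW hij (hc k) (hc0 k)
  refine ⟨_, mem_fam_of_eq_sum (F := fun v =>
    ∑ k, algebraMap (Entire n) (Mer n) (divDiff i j (c k) v) • P k)
    (fun k => (hd k).1) (fun v _ => rfl), fun v hv => ?_⟩
  rw [hFc v hv, Finset.smul_sum]
  refine Finset.sum_congr rfl fun k _ => ?_
  rw [(hd k).2.1 v hv, map_mul, mul_smul, ← IsScalarTower.algebraMap_apply,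
    algebraMap_smul_crossed]

end Families

/-! ### Values of meromorphic functions -/

section Represents

variable {n : ℕ}

theorem algebraMap_entire_ne_zero {b : Entire n} (hb : b ≠ 0) :
    algebraMap (Entire n) (Mer n) b ≠ 0 :=
  (map_ne_zero_iff _ (IsFractionRing.injective (Entire n) (Mer n))).mpr hb

/-- The values of `F` on the zero set of a nonzero entire function `d` do not matter. -/
theorem Represents.congr {f : Mer n} {F G : (Fin n → ℂ) → ℂ} (hf : Represents f F) {d : Entire n}
    (hd : d ≠ 0) (h : ∀ x, d.1 x ≠ 0 → F x = G x) : Represents f G := by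
  obtain ⟨a, b, hb, rfl, h1⟩ := hf
  have hd' := algebraMap_entire_ne_zero hd
  refine ⟨a * d, b * d, mul_ne_zero hb hd, ?_, fun x hx => ?_⟩
  · rw [map_mul, map_mul, mul_div_mul_right _ _ hd']
  · obtain ⟨hbx, hdx⟩ := mul_ne_zero_iff.mp (show b.1 x * d.1 x ≠ 0 from hx)
    rw [← h x hdx, h1 x hbx]
    exact (mul_div_mul_right _ _ hdx).symm

theorem Represents.add {f g : Mer n} {F G : (Fin n → ℂ) → ℂ} (hf : Represents f F)
    (hg : Represents g G) : Represents (f + g) fun x => F x + G x := by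
  obtain ⟨a, b, hb, rfl, h1⟩ := hf
  obtain ⟨a', b', hb', rfl, h2⟩ := hg
  refine ⟨a * b' + b * a', b * b', mul_ne_zero hb hb', ?_, fun x hx => ?_⟩
  · rw [div_add_div _ _ (algebraMap_entire_ne_zero hb) (algebraMap_entire_ne_zero hb')]
    simp only [map_add, map_mul]
  · obtain ⟨hbx, hdx⟩ := mul_ne_zero_iff.mp (show b.1 x * b'.1 x ≠ 0 from hx)
    change F x + G x = (a.1 x * b'.1 x + b.1 x * a'.1 x) / (b.1 x * b'.1 x)
    rw [h1 x hbx, h2 x hdx, div_add_div _ _ hbx hdx]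

theorem Represents.mul {f g : Mer n} {F G : (Fin n → ℂ) → ℂ} (hf : Represents f F)
    (hg : Represents g G) : Represents (f * g) fun x => F x * G x := by
  obtain ⟨a, b, hb, rfl, h1⟩ := hf
  obtain ⟨a', b', hb', rfl, h2⟩ := hg
  refine ⟨a * a', b * b', mul_ne_zero hb hb', ?_, fun x hx => ?_⟩
  · rw [div_mul_div_comm]
    simp only [map_mul]
  · obtain ⟨hbx, hdx⟩ := mul_ne_zero_iff.mp (show b.1 x * b'.1 x ≠ 0 from hx)
    change F x * G x = (a.1 x * a'.1 x) / (b.1 x * b'.1 x)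
    rw [h1 x hbx, h2 x hdx, div_mul_div_comm]

theorem represents_div (a : Entire n) {b : Entire n} (hb : b ≠ 0) :
    Represents (algebraMap (Entire n) (Mer n) a / algebraMap (Entire n) (Mer n) b)
      fun x => a.1 x / b.1 x :=
  ⟨a, b, hb, rfl, fun _ _ => rfl⟩

theorem represents_const (c : ℂ) : Represents (algebraMap ℂ (Mer n) c) fun _ => c :=
  ⟨algebraMap ℂ _ c, 1, one_ne_zero, by
    rw [map_one, div_one, ← IsScalarTower.algebraMap_apply], fun x _ => (div_one c).symm⟩

theorem Represents.neg {f : Mer n} {F : (Fin n → ℂ) → ℂ} (hf : Represents f F) :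
    Represents (-f) fun x => -F x := by
  simpa using (represents_const (-1)).mul hf

theorem permEntire_ne_zero (w : Equiv.Perm (Fin n)) {b : Entire n} (hb : b ≠ 0) :
    permEntire w b ≠ 0 := (map_ne_zero_iff _ (permEntire_injective w)).mpr hb

theorem Represents.perm {f : Mer n} {F : (Fin n → ℂ) → ℂ} (hf : Represents f F)
    (w : Equiv.Perm (Fin n)) : Represents (permMer w f) fun x => F fun i => x (w i) := by
  obtain ⟨a, b, hb, rfl, h1⟩ := hf
  refine ⟨permEntire w a, permEntire w b, permEntire_ne_zero w hb, ?_, fun x hx => h1 _ hx⟩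
  rw [map_div₀, permMer_algebraMap, permMer_algebraMap]

/-- The entire function `g(x_a - x_b)`. -/
def diffEntire {g : ℂ → ℂ} (hg : Differentiable ℂ g) (a b : Fin n) : Entire n :=
  ⟨fun x => g (x a - x b), fun x => by
    have h : AnalyticAt ℂ (fun x : Fin n → ℂ => x a - x b) x :=
      ((ContinuousLinearMap.proj (R := ℂ) (φ := fun _ : Fin n => ℂ) a -
        ContinuousLinearMap.proj (R := ℂ) (φ := fun _ : Fin n => ℂ) b)).analyticAt x
    exact (hg.analyticAt (x a - x b)).comp (f := fun x : Fin n → ℂ => x a - x b) h⟩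

theorem diffEntire_apply {g : ℂ → ℂ} (hg : Differentiable ℂ g) (a b : Fin n) (x : Fin n → ℂ) :
    (diffEntire hg a b).1 x = g (x a - x b) := rfl

theorem diffEntire_ne_zero {g : ℂ → ℂ} (hg : Differentiable ℂ g) {z : ℂ} (hz : g z ≠ 0)
    {a b : Fin n} (hab : a ≠ b) : diffEntire hg a b ≠ 0 := by
  intro h
  have := congrFun (congrArg Subtype.val h) (Pi.single a z)
  rw [diffEntire_apply, Pi.single_eq_same, Pi.single_eq_of_ne hab.symm, sub_zero] at this
  exact hz this

theorem pdEntire_diffEntire {g : ℂ → ℂ} (hg : Differentiable ℂ g)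
    (hg' : Differentiable ℂ (deriv g)) (k a b : Fin n) :
    pdEntire k (diffEntire hg a b) =
      ((Pi.single k 1 : Fin n → ℂ) a - (Pi.single k 1 : Fin n → ℂ) b) • diffEntire hg' a b := by
  apply Subtype.ext
  funext x
  change fderiv ℂ (fun x : Fin n → ℂ => g (x a - x b)) x (Pi.single k 1) =
    ((Pi.single k 1 : Fin n → ℂ) a - (Pi.single k 1 : Fin n → ℂ) b) • deriv g (x a - x b)
  have h1 : HasFDerivAt (fun x : Fin n → ℂ => x a - x b)
      (ContinuousLinearMap.proj (R := ℂ) (φ := fun _ : Fin n => ℂ) a -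
        ContinuousLinearMap.proj (R := ℂ) (φ := fun _ : Fin n => ℂ) b) x :=
    (ContinuousLinearMap.proj (R := ℂ) (φ := fun _ : Fin n => ℂ) a -
      ContinuousLinearMap.proj (R := ℂ) (φ := fun _ : Fin n => ℂ) b).hasFDerivAt
  have h2 := (hg (x a - x b)).hasDerivAt.comp_hasFDerivAt x h1
  rw [show (fun x : Fin n → ℂ => g (x a - x b)) = g ∘ fun x : Fin n → ℂ => x a - x b from rfl,
    h2.fderiv]
  simp only [FunLike.coe_smul, Pi.smul_apply, smul_eq_mul, mul_comm]
  rfl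

/-- The meromorphic function `g(x_a - x_b) / h(x_a - x_b)`. -/
def diffQuot {g h : ℂ → ℂ} (hg : Differentiable ℂ g) (hh : Differentiable ℂ h) (a b : Fin n) :
    Mer n :=
  algebraMap (Entire n) (Mer n) (diffEntire hg a b) /
    algebraMap (Entire n) (Mer n) (diffEntire hh a b)

theorem represents_diffQuot {g h : ℂ → ℂ} (hg : Differentiable ℂ g) (hh : Differentiable ℂ h)
    {z : ℂ} (hz : h z ≠ 0) {a b : Fin n} (hab : a ≠ b) :
    Represents (diffQuot hg hh a b) fun x => g (x a - x b) / h (x a - x b) :=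
  represents_div _ (diffEntire_ne_zero hh hz hab)

theorem pd_diffQuot {g h : ℂ → ℂ} (hg : Differentiable ℂ g) (hh : Differentiable ℂ h)
    (hg' : Differentiable ℂ (deriv g)) (hh' : Differentiable ℂ (deriv h)) (k a b : Fin n) :
    pd k (diffQuot hg hh a b) =
      ((Pi.single k 1 : Fin n → ℂ) a - (Pi.single k 1 : Fin n → ℂ) b) •
      ((algebraMap (Entire n) (Mer n) (diffEntire hg' a b) *
          algebraMap (Entire n) (Mer n) (diffEntire hh a b) -
        algebraMap (Entire n) (Mer n) (diffEntire hg a b) *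
          algebraMap (Entire n) (Mer n) (diffEntire hh' a b)) /
        algebraMap (Entire n) (Mer n) (diffEntire hh a b) ^ 2) := by
  have hs : ∀ (c : ℂ) (f : Entire n), algebraMap (Entire n) (Mer n) (c • f) =
      c • algebraMap (Entire n) (Mer n) f := fun c f => by
    rw [Algebra.smul_def, Algebra.smul_def, map_mul, ← IsScalarTower.algebraMap_apply]
  rw [diffQuot, Derivation.leibniz_div, pd_algebraMap, pd_algebraMap, pdEntire_diffEntire hg hg',
    pdEntire_diffEntire hh hh', hs, hs]
  simp only [smul_eq_mul, Algebra.smul_def]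
  ring

/-- The meromorphic function `1 / (x_a - x_b)`. -/
def recip (a b : Fin n) : Mer n := ofFun fun x => 1 / (x a - x b)

theorem recip_eq_diffQuot {a b : Fin n} (hab : a ≠ b) :
    recip a b = diffQuot (differentiable_const 1) differentiable_id a b :=
  ofFun_eq (represents_diffQuot (differentiable_const 1) differentiable_id (z := 1) (by simp) hab)

theorem ofFun_zero : ofFun (fun _ : Fin n → ℂ => 0) = 0 := by
  simpa using ofFun_eq (represents_const (n := n) 0)

theorem recip_self (a : Fin n) : recip a a = 0 := by
  simp [recip, ofFun_zero]

/-- The coordinate difference `x_a - x_b`. -/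
def coordDiff (a b : Fin n) : Entire n := diffEntire differentiable_id a b

theorem coordDiff_ne_zero {a b : Fin n} (hab : a ≠ b) : coordDiff a b ≠ 0 :=
  diffEntire_ne_zero differentiable_id (z := 1) (by simp) hab

theorem recip_eq_inv (a b : Fin n) :
    recip a b = (algebraMap (Entire n) (Mer n) (coordDiff a b))⁻¹ := by
  by_cases hab : a = b
  · subst hab
    have : coordDiff a a = 0 := Subtype.ext (funext fun x => sub_self (x a))
    rw [recip_self, this, map_zero, inv_zero]
  · have h1 : diffEntire (differentiable_const (1 : ℂ)) a b = (1 : Entire n) := rfl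
    rw [recip_eq_diffQuot hab, diffQuot, h1, map_one, one_div]
    rfl

theorem coordDiff_neg (a b : Fin n) : coordDiff b a = -coordDiff a b :=
  Subtype.ext (funext fun x => (neg_sub (x a) (x b)).symm)

theorem coordDiff_add (a b c : Fin n) : coordDiff a b + coordDiff b c = coordDiff a c :=
  Subtype.ext (funext fun x => sub_add_sub_cancel (x a) (x b) (x c))

theorem recip_swap (a b : Fin n) : recip b a = -recip a b := by
  rw [recip_eq_inv, recip_eq_inv, coordDiff_neg, map_neg, inv_neg]

theorem permMer_recip (w : Equiv.Perm (Fin n)) (a b : Fin n) :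
    permMer w (recip a b) = recip (w a) (w b) := by
  rw [recip_eq_inv, recip_eq_inv, map_inv₀, permMer_algebraMap]
  rfl

/-- The rational three-term relation, responsible for the commutativity of the rational Dunkl
operators. -/
theorem recip_three_term {i j k : Fin n} (hij : i ≠ j) (hik : i ≠ k) (hjk : j ≠ k) :
    recip i j * recip i k = recip i k * recip k j + recip j k * recip i j := by
  have h1 := algebraMap_entire_ne_zero (coordDiff_ne_zero hij)
  have h2 := algebraMap_entire_ne_zero (coordDiff_ne_zero hik)
  have h3 := algebraMap_entire_ne_zero (coordDiff_ne_zero hjk)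
  have h4 := congrArg (algebraMap (Entire n) (Mer n)) (coordDiff_add i j k)
  rw [map_add] at h4
  rw [recip_swap j k]
  simp only [recip_eq_inv]
  field_simp
  linear_combination h4

end Represents

/-! ### Commuting families of Dunkl type -/

section Commuting

/-- The classical Yang–Baxter relation for `R` and the compatibility with `D` make the operators
`D_i - κ ∑_k R_{ik}` commute. -/
theorem commute_of_yangBaxter {A : Type*} [Ring A] [Algebra ℂ A] {n : ℕ} (κ : ℂ) (D : Fin n → A)
    (R : Fin n → Fin n → A) (hself : ∀ i, R i i = 0) (hanti : ∀ i j, R j i = -R i j)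
    (hdisj : ∀ i j k l, i ≠ k → i ≠ l → j ≠ k → j ≠ l → R i j * R k l = R k l * R i j)
    (hYB : ∀ i j k, i ≠ j → i ≠ k → j ≠ k →
      (R i j * R j k - R j k * R i j) - (R i k * R i j - R i j * R i k) +
        (R i k * R j k - R j k * R i k) = 0)
    (hDD : ∀ i j, D i * D j = D j * D i)
    (hDR : ∀ k i j, k ≠ i → k ≠ j → D k * R i j = R i j * D k)
    (hDsum : ∀ i j, i ≠ j → (D i + D j) * R i j = R i j * (D i + D j)) (i j : Fin n) :
    Commute (D i - κ • ∑ k, R i k) (D j - κ • ∑ k, R j k) := by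
  by_cases hij : i = j
  · subst hij
    exact Commute.refl _
  have h1 : ∀ i j : Fin n, i ≠ j →
      D i * ∑ l, R j l - (∑ l, R j l) * D i = D i * R j i - R j i * D i := by
    intro i j hij
    rw [Finset.mul_sum, Finset.sum_mul, ← Finset.sum_sub_distrib]
    refine Finset.sum_eq_single i (fun l _ hl => ?_) (by simp)
    by_cases hlj : l = j
    · rw [hlj, hself, mul_zero, zero_mul, sub_zero]
    · rw [hDR i j l hij hl.symm, sub_self]
  have h2 : (∑ k, R i k) * ∑ l, R j l - (∑ l, R j l) * ∑ k, R i k = 0 := by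
    -- the commutator of `R_{ik}` and `R_{jl}` vanishes unless `l = i`, `k = j` or `k = l`; these
    -- three cases give the terms of the Yang–Baxter relation
    set f : Fin n → Fin n → A := fun k l => R i k * R j l - R j l * R i k with hf
    set g1 : Fin n → A := fun k => if k = i ∨ k = j then 0 else f k i
    set g2 : Fin n → A := fun k => if k = i ∨ k = j then 0 else f j k
    set g3 : Fin n → A := fun k => if k = i ∨ k = j then 0 else f k k
    have hfg : ∀ k l, f k l =
        (if l = i then g1 k else 0) + (if k = j then g2 l else 0) + 
        (if k = l then g3 k else 0) := by
      intro k l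
      by_cases hki : k = i
      · subst hki
        simp [hf, g1, g2, g3, hself, hij]
      by_cases hlj : l = j
      · subst hlj
        by_cases hkl : k = l
        · subst hkl
          simp [hf, g2, g3, hself, hki]
        · simp [hf, hself, hkl, Ne.symm hij]
      by_cases hli : l = i
      · subst hli
        by_cases hkj : k = j
        · subst hkj
          have : R l k * R k l - R k l * R l k = 0 := by rw [hanti l k]; simp
          simp [hf, g1, g2, hki, this]
        · simp [g1, hki, hkj]
      by_cases hkj : k = j
      · subst hkj
        simp [g2, hli, hlj, Ne.symm hlj]
      by_cases hkl : k = l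
      · subst hkl
        simp [g3, hki, hkj]
      · simp only [hli, hkj, hkl, if_false, add_zero]
        exact sub_eq_zero.mpr (hdisj i k j l hij (Ne.symm hli) hkj hkl)
    have h3 : ∀ k, g1 k + g2 k + g3 k = 0 := by
      intro k
      by_cases hk : k = i ∨ k = j
      · simp [g1, g2, g3, hk]
      · have hk' := hk
        push Not at hk'
        have := hYB i j k hij hk'.1.symm hk'.2.symm
        simp only [g1, g2, g3, if_neg hk, hf]
        rw [hanti i j, ← this]
        noncomm_ring
    have h4 : (∑ k, R i k) * ∑ l, R j l - (∑ l, R j l) * ∑ k, R i k = ∑ k, ∑ l, f k l := by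
      rw [Finset.sum_mul_sum, Finset.sum_mul_sum, Finset.sum_comm (f := fun l k => R j l * R i k),
        ← Finset.sum_sub_distrib]
      exact Finset.sum_congr rfl fun k _ => (Finset.sum_sub_distrib _ _).symm
    rw [h4]
    simp only [hfg, Finset.sum_add_distrib, Finset.sum_ite_eq', Finset.mem_univ, if_true,
      Finset.sum_ite_eq]
    rw [Finset.sum_comm (f := fun k l => if k = j then g2 l else 0)]
    simp only [Finset.sum_ite_eq', Finset.mem_univ, if_true]
    rw [← Finset.sum_add_distrib, ← Finset.sum_add_distrib]
    exact Finset.sum_eq_zero fun k _ => h3 k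
  have h3 := h1 i j hij
  have h4 := h1 j i (Ne.symm hij)
  have h5 := hDsum i j hij
  rw [hanti i j] at h3
  have key : D i * ∑ l, R j l - (∑ l, R j l) * D i = D j * ∑ l, R i l - (∑ l, R i l) * D j := by
    rw [h3, h4, ← sub_eq_zero]
    rw [← sub_eq_zero] at h5
    rw [← neg_eq_zero, ← h5]
    noncomm_ring
  rw [Commute, SemiconjBy]
  simp only [sub_mul, mul_sub, mul_smul_comm, smul_mul_assoc]
  rw [sub_eq_zero] at h2
  rw [hDD i j, h2]
  linear_combination (norm := module) (-κ) • key

/-- The sum of the squares of the operators `D_i - κ ∑_k R_{ik}`: the terms `R_{ik} R_{il}` with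
`i`, `k`, `l` distinct cancel. -/
theorem sum_sq_of_threeTerm {A : Type*} [Ring A] [Algebra ℂ A] {n : ℕ} (κ : ℂ) (D : Fin n → A)
    (R : Fin n → Fin n → A) (hself : ∀ i, R i i = 0)
    (h3 : ∀ i j l, i ≠ j → i ≠ l → j ≠ l →
      R i j * R i l + R j l * R j i + R l i * R l j = 0) :
    ∑ i, (D i - κ • ∑ k, R i k) ^ 2 =
      ∑ i, D i ^ 2 - κ • ∑ i, ∑ k, (D i * R i k + R i k * D i) +
        κ ^ 2 • ∑ i, ∑ k, R i k * R i k := by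
  set G : Fin n → Fin n → Fin n → A := fun i j l => if j = l then 0 else R i j * R i l with hG
  have hT : ∑ i, ∑ j, ∑ l, G i j l = 0 := by
    have e1 : ∑ i, ∑ j, ∑ l, G i j l = ∑ i, ∑ j, ∑ l, G j l i := by
      rw [Finset.sum_comm (f := fun i j => ∑ l, G j l i)]
      exact Finset.sum_congr rfl fun _ _ => Finset.sum_comm
    have e2 : ∑ i, ∑ j, ∑ l, G i j l = ∑ i, ∑ j, ∑ l, G l i j := by
      rw [Finset.sum_congr rfl fun i _ => Finset.sum_comm (f := fun j l => G l i j)]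
      exact Finset.sum_comm
    have e3 : ∀ i j l, G i j l + G j l i + G l i j = 0 := by
      intro i j l
      by_cases hij : i = j
      · subst hij
        simp [hG, hself]
      by_cases hil : i = l
      · subst hil
        simp [hG, hself]
      by_cases hjl : j = l
      · subst hjl
        simp [hG, hself]
      simp only [hG, if_neg hjl, if_neg (Ne.symm hil), if_neg hij]
      exact h3 i j l hij hil hjl
    have e4 : (3 : ℂ) • ∑ i, ∑ j, ∑ l, G i j l = 0 := by
      calc (3 : ℂ) • ∑ i, ∑ j, ∑ l, G i j l
          = ∑ i, ∑ j, ∑ l, G i j l + ∑ i, ∑ j, ∑ l, G i j l + ∑ i, ∑ j, ∑ l, G i j l := by module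
        _ = ∑ i, ∑ j, ∑ l, G i j l + ∑ i, ∑ j, ∑ l, G j l i + ∑ i, ∑ j, ∑ l, G l i j := by
            rw [← e1, ← e2]
        _ = ∑ i, ∑ j, ∑ l, (G i j l + G j l i + G l i j) := by
            simp only [Finset.sum_add_distrib]
        _ = 0 := by simp only [e3, Finset.sum_const_zero]
    exact (smul_eq_zero.mp e4).resolve_left (by norm_num)
  have hsq : ∑ i, (∑ k, R i k) * ∑ l, R i l = ∑ i, ∑ k, R i k * R i k := by
    rw [← add_zero (∑ i, ∑ k, R i k * R i k), ← hT, ← Finset.sum_add_distrib]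
    refine Finset.sum_congr rfl fun i _ => ?_
    rw [Finset.sum_mul_sum, ← Finset.sum_add_distrib]
    refine Finset.sum_congr rfl fun j _ => ?_
    rw [← Finset.add_sum_erase _ _ (Finset.mem_univ j), ← Finset.add_sum_erase Finset.univ (G i j)
      (Finset.mem_univ j)]
    simp only [hG, if_true, zero_add]
    congr 1
    exact Finset.sum_congr rfl fun l hl => (if_neg (Finset.ne_of_mem_erase hl).symm).symm
  have hexp : ∀ i, (D i - κ • ∑ k, R i k) ^ 2 = D i ^ 2 - κ • ∑ k, (D i * R i k + R i k * D i) +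
      κ ^ 2 • ((∑ k, R i k) * ∑ l, R i l) := by
    intro i
    rw [Finset.sum_add_distrib, ← Finset.mul_sum, ← Finset.sum_mul, sq, sub_mul, mul_sub, mul_sub,
      mul_smul_comm, smul_mul_assoc, smul_mul_assoc, mul_smul_comm, sq (D i)]
    module
  rw [Finset.sum_congr rfl fun i _ => hexp i, Finset.sum_add_distrib, Finset.sum_sub_distrib,
    ← Finset.smul_sum, ← Finset.smul_sum, hsq]

variable {n : ℕ} {k : Type} [Ring k] [MulSemiringAction (Equiv.Perm (Fin n)) k]

open SkewMonoidAlgebra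

/-- The terms of a product of two operators of Dunkl type supported on a 3-cycle cancel. -/
theorem dunkl_threeTerm (f : Fin n → Fin n → Fin n → Fin n → k)
    (hf : ∀ (w : Equiv.Perm (Fin n)) i j a b, w • f i j a b = f i j (w a) (w b))
    (hanti : ∀ i j a b, f j i b a = -f i j a b)
    (h3 : ∀ i j l, i ≠ j → i ≠ l → j ≠ l →
      f i j i j * f j l i l = f i l i l * f i j l j + f j l j l * f i l i j)
    {i j l : Fin n} (hij : i ≠ j) (hil : i ≠ l) (hjl : j ≠ l) :
    single (Equiv.swap i j) (f i j i j) * single (Equiv.swap i l) (f i l i l) +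
      single (Equiv.swap j l) (f j l j l) * single (Equiv.swap j i) (f j i j i) +
      single (Equiv.swap l i) (f l i l i) * single (Equiv.swap l j) (f l j l j) = 0 := by
  have p1 : Equiv.swap j l * Equiv.swap j i = Equiv.swap i j * Equiv.swap i l := by
    rw [Equiv.swap_mul_eq_mul_swap, Equiv.swap_inv, Equiv.swap_apply_left,
      Equiv.swap_apply_of_ne_of_ne hjl.symm hil.symm, Equiv.swap_comm j i]
  have p2 : Equiv.swap l i * Equiv.swap l j = Equiv.swap i j * Equiv.swap i l := by
    rw [Equiv.mul_swap_eq_swap_mul, Equiv.swap_apply_left,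
      Equiv.swap_apply_of_ne_of_ne hjl hij.symm, Equiv.swap_comm l i]
  rw [single_mul_single, single_mul_single, single_mul_single, hf, hf, hf, p1, p2,
    Equiv.swap_apply_left, Equiv.swap_apply_left, Equiv.swap_apply_left,
    Equiv.swap_apply_of_ne_of_ne hil.symm hjl.symm, Equiv.swap_apply_of_ne_of_ne hij hil,
    Equiv.swap_apply_of_ne_of_ne hjl hij.symm, ← single_add, ← single_add, hanti l j l j,
    neg_mul, h3 l j i hjl.symm hil.symm hij.symm, hanti j i j i, hanti i l j l]
  simp

variable [Algebra ℂ k] [SMulCommClass (Equiv.Perm (Fin n)) ℂ k]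

/-- The operator `d_i - κ ∑_{j ≠ i} f_{ij} s_{ij}`. The coefficient `f_{ij} = f i j i j` is the
value of a function `f i j a b` whose last two indices are those acted on by the symmetric group. -/
def dunklOp (κ : ℂ) (d : Fin n → k) (f : Fin n → Fin n → Fin n → Fin n → k) (i : Fin n) :
    SkewMonoidAlgebra k (Equiv.Perm (Fin n)) :=
  single 1 (d i) - κ • ∑ j ∈ Finset.univ.erase i, single (Equiv.swap i j) (f i j i j)

/-- The three-term relation for the coefficients is the Yang–Baxter relation for the
`f_{ij} s_{ij}`. -/
theorem commute_dunklOp (κ : ℂ) (d : Fin n → k) (f : Fin n → Fin n → Fin n → Fin n → k)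
    (hd : ∀ (w : Equiv.Perm (Fin n)) i, w • d i = d (w i))
    (hf : ∀ (w : Equiv.Perm (Fin n)) i j a b, w • f i j a b = f i j (w a) (w b))
    (hself : ∀ i a, f i i a a = 0) (hanti : ∀ i j a b, f j i b a = -f i j a b)
    (hcomm : ∀ i j a b i' j' a' b', f i j a b * f i' j' a' b' = f i' j' a' b' * f i j a b)
    (h3 : ∀ i j l, i ≠ j → i ≠ l → j ≠ l →
      f i j i j * f j l i l = f i l i l * f i j l j + f j l j l * f i l i j)
    (hdd : ∀ i j, d i * d j = d j * d i)
    (hdf : ∀ l i j, l ≠ i → l ≠ j → d l * f i j i j = f i j i j * d l)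
    (hdsum : ∀ i j, i ≠ j → (d i + d j) * f i j i j = f i j i j * (d i + d j))
    (i j : Fin n) : Commute (dunklOp κ d f i) (dunklOp κ d f j) := by
  set R : Fin n → Fin n → SkewMonoidAlgebra k (Equiv.Perm (Fin n)) := fun i j =>
    single (Equiv.swap i j) (f i j i j) with hR
  have hRself : ∀ i, R i i = 0 := fun i => by simp only [hR, hself, single_zero]
  have hop : ∀ i, dunklOp κ d f i = single 1 (d i) - κ • ∑ j, R i j := by
    intro i
    rw [dunklOp, Finset.sum_erase _ (hRself i)]
  rw [hop, hop]
  have mulR : ∀ i j i' j', R i j * R i' j' = single (Equiv.swap i j * Equiv.swap i' j')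
      (f i j i j * f i' j' (Equiv.swap i j i') (Equiv.swap i j j')) := by
    intro i j i' j'
    simp only [hR, single_mul_single, hf]
  refine commute_of_yangBaxter κ (fun i => single 1 (d i)) R hRself ?_ ?_ ?_ ?_ ?_ ?_ i j
  · intro i j
    simp only [hR]
    rw [hanti i j, single_neg, Equiv.swap_comm]
  · intro i j i' j' h1 h2 h3 h4
    rw [mulR, mulR, Equiv.swap_apply_of_ne_of_ne h1.symm h3.symm,
      Equiv.swap_apply_of_ne_of_ne h2.symm h4.symm, Equiv.swap_apply_of_ne_of_ne h1 h2,
      Equiv.swap_apply_of_ne_of_ne h3 h4, hcomm i j i j]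
    congr 1
    have : Equiv.Perm.Disjoint (Equiv.swap i j) (Equiv.swap i' j') := by
      intro x
      by_cases hx : x = i ∨ x = j
      · right
        rcases hx with rfl | rfl
        · exact Equiv.swap_apply_of_ne_of_ne h1 h2
        · exact Equiv.swap_apply_of_ne_of_ne h3 h4
      · left
        push Not at hx
        exact Equiv.swap_apply_of_ne_of_ne hx.1 hx.2
    exact this.commute
  · intro i j l hij hil hjl
    have h4 := dunkl_threeTerm f hf hanti h3 hij hil hjl
    have h5 := dunkl_threeTerm f hf hanti h3 hjl.symm hil.symm hij.symm
    have hRanti : ∀ i j, single (Equiv.swap j i) (f j i j i) = -R i j := fun i j => by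
      simp only [hR]
      rw [hanti i j, single_neg, Equiv.swap_comm]
    rw [hRanti i j, hRanti i l, hRanti j l] at h4 h5
    change R i j * R i l + R j l * -R i j + -R i l * -R j l = 0 at h4
    change -R j l * -R i l + -R i j * R j l + R i l * R i j = 0 at h5
    rw [← sub_zero (0 : SkewMonoidAlgebra k (Equiv.Perm (Fin n)))]
    nth_rewrite 1 [← h4]
    rw [← h5]
    noncomm_ring
  · intro i j
    rw [single_mul_single, single_mul_single, one_smul, one_smul, hdd]
  · intro l i j hi hj
    simp only [hR]
    rw [single_mul_single, single_mul_single, one_smul, hd,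
      Equiv.swap_apply_of_ne_of_ne hi hj, hdf l i j hi hj, one_mul, mul_one]
  · intro i j hij
    simp only [hR]
    rw [← single_add, single_mul_single, single_mul_single, one_smul, smul_add, hd, hd,
      Equiv.swap_apply_left, Equiv.swap_apply_right, hdsum i j hij, one_mul, mul_one,
      add_comm (d j)]

/-- Equivariance of Dunkl operators. -/
theorem single_mul_dunklOp (κ : ℂ) (d : Fin n → k) (f g : Fin n → Fin n → Fin n → Fin n → k)
    (hd : ∀ (w : Equiv.Perm (Fin n)) i, w • d i = d (w i))
    (w : Equiv.Perm (Fin n)) (hf : ∀ i j, w • f i j i j = g (w i) (w j) (w i) (w j)) (i : Fin n) :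
    single w 1 * dunklOp κ d f i = dunklOp κ d g (w i) * single w 1 := by
  rw [dunklOp, dunklOp, mul_sub, sub_mul, single_mul_single, single_mul_single, hd, one_mul,
    smul_one, mul_one, one_mul, mul_one]
  congr 1
  rw [mul_smul_comm, smul_mul_assoc, Finset.mul_sum, Finset.sum_mul]
  congr 1
  refine Finset.sum_bij (fun j _ => w j) (fun j hj => ?_) (fun _ _ _ _ h => w.injective h)
    (fun j hj => ⟨w⁻¹ j, ?_, by simp⟩) (fun j hj => ?_)
  · simpa using hj
  · simp only [Finset.mem_erase, Finset.mem_univ, and_true, ne_eq] at hj ⊢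
    rintro rfl
    simp at hj
  · rw [single_mul_single, single_mul_single, smul_one, mul_one, one_mul, hf]
    congr 1
    rw [Equiv.mul_swap_eq_swap_mul]

end Commuting

/-! ### Polynomials in commuting operators -/

section Evaluation

/-- Substituting commuting elements for the variables of polynomials is a ring homomorphism. -/
theorem exists_ringHom_of_commute {n : ℕ} {R B : Type} [CommRing R] [Ring B] [Algebra ℂ B]
    (φ : R →+* ℂ) (Y : Fin n → B) (hY : ∀ i j, Commute (Y i) (Y j)) :
    ∃ E : MvPolynomial (Fin n) R →+* B,
      ∀ q, E q = ∑ α ∈ q.support, φ (q.coeff α) • monomialAt Y α := by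
  have : IsMulCommutative (Algebra.adjoin ℂ (Set.range Y)) :=
    Algebra.isMulCommutative_adjoin ℂ (by rintro _ ⟨i, rfl⟩ _ ⟨j, rfl⟩; exact hY i j)
  let _ : CommRing (Algebra.adjoin ℂ (Set.range Y)) :=
    { mul_comm := fun a b => this.is_comm.comm a b }
  let Z : Fin n → Algebra.adjoin ℂ (Set.range Y) := fun i => ⟨Y i, Algebra.subset_adjoin ⟨i, rfl⟩⟩
  refine ⟨(Algebra.adjoin ℂ (Set.range Y)).val.toRingHom.comp
    (MvPolynomial.eval₂Hom ((algebraMap ℂ (Algebra.adjoin ℂ (Set.range Y))).comp φ) Z),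
    fun q => ?_⟩
  rw [RingHom.comp_apply, MvPolynomial.coe_eval₂Hom, MvPolynomial.eval₂_eq', map_sum]
  refine Finset.sum_congr rfl fun α _ => ?_
  have h : (∏ i, Z i ^ α i) = (List.ofFn fun i => Z i ^ α i).prod := (List.prod_ofFn).symm
  rw [h, map_mul, monomialAt, Algebra.smul_def]
  congr 1
  rw [map_list_prod, List.map_ofFn]
  rfl

/-- The value of a constant polynomial, in the form of the right-hand side of
`exists_ringHom_of_commute`. -/
theorem polyEval_C {n : ℕ} {R B : Type} [CommRing R] [Ring B] [Algebra ℂ B] (φ : R →+* ℂ)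
    (Y : Fin n → B) (r : R) :
    ∑ α ∈ (MvPolynomial.C r : MvPolynomial (Fin n) R).support,
      φ ((MvPolynomial.C r : MvPolynomial (Fin n) R).coeff α) • monomialAt Y α =
        algebraMap ℂ B (φ r) := by
  classical
  rw [Finset.sum_subset (s₂ := {0}), Finset.sum_singleton, MvPolynomial.coeff_C, if_pos rfl]
  · simp [monomialAt, Algebra.smul_def]
  · intro α hα
    rw [MvPolynomial.mem_support_iff, MvPolynomial.coeff_C] at hα
    simp only [Finset.mem_singleton]
    by_contra h
    exact hα (if_neg (Ne.symm h))
  · intro α _ h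
    rw [MvPolynomial.notMem_support_iff.mp h, map_zero, zero_smul]

theorem prod_ofFn_eq_single {n : ℕ} {B : Type} [Monoid B] (f : Fin n → B) (i : Fin n)
    (h : ∀ j, j ≠ i → f j = 1) : (List.ofFn f).prod = f i := by
  induction n with
  | zero => exact i.elim0
  | succ n ih =>
    rw [List.ofFn_succ, List.prod_cons]
    refine Fin.cases (fun h => ?_) (fun i h => ?_) i h
    · have : (List.ofFn fun i : Fin n => f i.succ) = List.ofFn fun _ : Fin n => (1 : B) := by
        congr 1
        ext1 j
        exact h _ (Fin.succ_ne_zero j)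
      rw [this]
      simp
    · rw [h 0 (Fin.succ_ne_zero i).symm, one_mul]
      exact ih (fun i => f i.succ) i fun j hj => h _ fun e => hj (Fin.succ_injective _ e)

theorem monomialAt_single {n : ℕ} {B : Type} [Ring B] (Y : Fin n → B) (i : Fin n) :
    monomialAt Y (Finsupp.single i 1) = Y i := by
  rw [monomialAt, prod_ofFn_eq_single _ i]
  · simp
  · intro j hj
    simp [hj.symm]

theorem polyEval_X {n : ℕ} {R B : Type} [CommRing R] [Ring B] [Algebra ℂ B] (φ : R →+* ℂ)
    (Y : Fin n → B) (i : Fin n) :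
    ∑ α ∈ (MvPolynomial.X i : MvPolynomial (Fin n) R).support,
      φ ((MvPolynomial.X i : MvPolynomial (Fin n) R).coeff α) • monomialAt Y α = Y i := by
  classical
  rw [Finset.sum_subset (s₂ := {Finsupp.single i 1}), Finset.sum_singleton, MvPolynomial.coeff_X,
    if_pos rfl, map_one, one_smul, monomialAt_single]
  · exact MvPolynomial.support_monomial_subset
  · intro α _ h
    rw [MvPolynomial.notMem_support_iff.mp h, map_zero, zero_smul]

variable {n : ℕ}

/-- The ring of meromorphic functions regular at `v`. -/
def regularAt (v : Fin n → ℂ) : Subring (Mer n) where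
  carrier := {f | ∃ a b : Entire n, b.1 v ≠ 0 ∧
    f = algebraMap (Entire n) (Mer n) a / algebraMap (Entire n) (Mer n) b}
  mul_mem' := by
    rintro _ _ ⟨a, b, hb, rfl⟩ ⟨c, d, hd, rfl⟩
    refine ⟨a * c, b * d, mul_ne_zero hb hd, ?_⟩
    rw [div_mul_div_comm, map_mul, map_mul]
  one_mem' := ⟨1, 1, one_ne_zero, by simp⟩
  add_mem' := by
    rintro _ _ ⟨a, b, hb, rfl⟩ ⟨c, d, hd, rfl⟩
    refine ⟨a * d + b * c, b * d, mul_ne_zero hb hd, ?_⟩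
    have nz : ∀ c : Entire n, c.1 v ≠ 0 → c ≠ 0 := fun c hc h => hc (by rw [h]; rfl)
    rw [div_add_div _ _ (algebraMap_entire_ne_zero (nz b hb))
      (algebraMap_entire_ne_zero (nz d hd))]
    simp only [map_add, map_mul]
  zero_mem' := ⟨0, 1, one_ne_zero, by simp⟩
  neg_mem' := by
    rintro _ ⟨a, b, hb, rfl⟩
    exact ⟨-a, b, hb, by rw [map_neg, neg_div]⟩

/-- Evaluation at `v`. -/
def evalAt (v : Fin n → ℂ) : regularAt v →+* ℂ where
  toFun f := valueAt v f
  map_one' := by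
    have := valueAt_div v 1 1 one_ne_zero
    rw [map_one, div_one] at this
    exact this.trans (div_one _)
  map_zero' := by
    have := valueAt_div v 0 1 one_ne_zero
    rw [map_zero, zero_div] at this
    exact this.trans (zero_div _)
  map_mul' := by
    rintro ⟨_, a, b, hb, rfl⟩ ⟨_, c, d, hd, rfl⟩
    change valueAt v (_ * _) = valueAt v _ * valueAt v _
    rw [div_mul_div_comm, ← map_mul, ← map_mul, valueAt_div v _ _ hb, valueAt_div v _ _ hd,
      valueAt_div v _ _ (mul_ne_zero hb hd), div_mul_div_comm]
    rfl
  map_add' := by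
    rintro ⟨_, a, b, hb, rfl⟩ ⟨_, c, d, hd, rfl⟩
    change valueAt v (_ + _) = valueAt v _ + valueAt v _
    have nz : ∀ c : Entire n, c.1 v ≠ 0 → c ≠ 0 := fun c hc h => hc (by rw [h]; rfl)
    rw [div_add_div _ _ (algebraMap_entire_ne_zero (nz b hb))
      (algebraMap_entire_ne_zero (nz d hd)), ← map_mul, ← map_mul, ← map_mul, ← map_add,
      valueAt_div v _ _ hb, valueAt_div v _ _ hd, valueAt_div v _ _ (mul_ne_zero hb hd),
      div_add_div _ _ hb hd]
    rfl

theorem evalAt_apply (v : Fin n → ℂ) (f : regularAt v) : evalAt v f = valueAt v f := rfl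

theorem entire_mem_regularAt (v : Fin n → ℂ) (a : Entire n) :
    algebraMap (Entire n) (Mer n) a ∈ regularAt v := ⟨a, 1, one_ne_zero, by simp⟩

theorem valueAt_entire (v : Fin n → ℂ) (a : Entire n) :
    valueAt v (algebraMap (Entire n) (Mer n) a) = a.1 v := by
  have := valueAt_div v a 1 one_ne_zero
  rw [map_one, div_one] at this
  exact this.trans (div_one _)

theorem recip_mem_regularAt {v : Fin n → ℂ} {a b : Fin n} (h : a ≠ b → v a ≠ v b) :
    recip a b ∈ regularAt v := by
  by_cases hab : a = b
  · subst hab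
    rw [recip_self]
    exact zero_mem _
  · refine ⟨1, coordDiff a b, sub_ne_zero.mpr (h hab), ?_⟩
    rw [recip_eq_inv, map_one, one_div]

theorem valueAt_recip {v : Fin n → ℂ} {a b : Fin n} (h : v a ≠ v b) :
    valueAt v (recip a b) = 1 / (v a - v b) := by
  rw [recip_eq_inv, ← one_div, ← map_one (algebraMap (Entire n) (Mer n)),
    valueAt_div v 1 (coordDiff a b) (sub_ne_zero.mpr h)]
  rfl

/-- The classical observables whose coefficients are regular at `v`. -/
def regularObs (v : Fin n → ℂ) : Subalgebra ℂ (ClassObs n) where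
  toSubsemiring := (MvPolynomial.map (σ := Fin n) (regularAt v).subtype).range.toSubsemiring
  algebraMap_mem' r := by
    refine ⟨MvPolynomial.C ⟨algebraMap (Entire n) (Mer n) (algebraMap ℂ _ r),
      entire_mem_regularAt v _⟩, ?_⟩
    rw [MvPolynomial.map_C]
    rfl

theorem cl_mem_regularObs {v : Fin n → ℂ} {g : Mer n} (hg : g ∈ regularAt v) :
    cl g ∈ regularObs v := ⟨MvPolynomial.C ⟨g, hg⟩, MvPolynomial.map_C _ _⟩

theorem mom_mem_regularObs (v : Fin n → ℂ) (i : Fin n) : mom i ∈ regularObs v :=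
  ⟨MvPolynomial.X i, MvPolynomial.map_X _ _⟩

theorem substDunkl_map (L : PeriodPair) (ħ κ : ℂ) (v : Fin n → ℂ)
    (f : MvPolynomial (Fin n) (regularAt v)) :
    substDunkl L ħ κ (MvPolynomial.map (regularAt v).subtype f : MvPolynomial (Fin n) (Mer n)) v =
      ∑ α ∈ f.support, evalAt v (f.coeff α) • monomialAt (ellDunkl L ħ κ v) α := by
  unfold substDunkl ClassObs.toPoly
  rw [MvPolynomial.support_map_of_injective f (regularAt v).subtype_injective]
  refine Finset.sum_congr rfl fun α _ => ?_
  rw [MvPolynomial.coeff_map]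
  rfl

/-- For commuting elliptic Dunkl operators, `f ↦ f(v, y)` is an algebra homomorphism on the
observables whose coefficients are regular at `v`. -/
theorem exists_substHom (L : PeriodPair) (ħ κ : ℂ) (v : Fin n → ℂ)
    (hY : ∀ i j, Commute (ellDunkl L ħ κ v i) (ellDunkl L ħ κ v j)) :
    ∃ E : regularObs v →ₐ[ℂ] Crossed n,
      (∀ f : regularObs v, E f = substDunkl L ħ κ f v) ∧
      (∀ g ∈ regularAt v, substDunkl L ħ κ (cl g) v = algebraMap ℂ _ (valueAt v g)) ∧
      (∀ i, substDunkl L ħ κ (mom i) v = ellDunkl L ħ κ v i) := by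
  obtain ⟨E, hE⟩ := exists_ringHom_of_commute (evalAt v) (ellDunkl L ħ κ v) hY
  have hS : ∀ f : MvPolynomial (Fin n) (regularAt v), substDunkl L ħ κ
      (MvPolynomial.map (regularAt v).subtype f : MvPolynomial (Fin n) (Mer n)) v = E f :=
    fun f => (substDunkl_map L ħ κ v f).trans (hE f).symm
  have hmul : ∀ f g : ClassObs n, f ∈ regularObs v → g ∈ regularObs v →
      substDunkl L ħ κ (f * g) v = substDunkl L ħ κ f v * substDunkl L ħ κ g v := by
    rintro _ _ ⟨f, rfl⟩ ⟨g, rfl⟩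
    have := hS (f * g)
    rw [map_mul, map_mul, ← hS, ← hS] at this
    exact this
  have hadd : ∀ f g : ClassObs n, f ∈ regularObs v → g ∈ regularObs v →
      substDunkl L ħ κ (f + g) v = substDunkl L ħ κ f v + substDunkl L ħ κ g v := by
    rintro _ _ ⟨f, rfl⟩ ⟨g, rfl⟩
    have := hS (f + g)
    rw [map_add, map_add, ← hS, ← hS] at this
    exact this
  have hcl : ∀ g (hg : g ∈ regularAt v),
      substDunkl L ħ κ (cl g) v = algebraMap ℂ _ (valueAt v g) := by
    intro g hg
    have := hS (MvPolynomial.C ⟨g, hg⟩)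
    rw [MvPolynomial.map_C, hE, polyEval_C, evalAt_apply] at this
    exact this
  have hmom : ∀ i, substDunkl L ħ κ (mom i) v = ellDunkl L ħ κ v i := by
    intro i
    have := hS (MvPolynomial.X i)
    rw [MvPolynomial.map_X, hE, polyEval_X] at this
    exact this
  have halg : ∀ r : ℂ, substDunkl L ħ κ (algebraMap ℂ (ClassObs n) r) v = algebraMap ℂ _ r := by
    intro r
    have := hcl _ (entire_mem_regularAt v (algebraMap ℂ _ r))
    rw [valueAt_entire] at this
    exact this
  refine ⟨{
    toFun := fun f => substDunkl L ħ κ f v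
    map_one' := ?_
    map_mul' := fun f g => hmul f g f.2 g.2
    map_zero' := ?_
    map_add' := fun f g => hadd f g f.2 g.2
    commutes' := halg }, fun _ => rfl, hcl, hmom⟩
  · have := halg 1
    rwa [map_one, map_one] at this
  · have := halg 0
    rwa [map_zero, map_zero] at this

end Evaluation

/-! ### Rational Calogero–Moser Hamiltonians -/

section Rational

open SkewMonoidAlgebra (single single_mul_single single_add single_zero single_neg)

variable {n : ℕ}

theorem smul_cl (w : Equiv.Perm (Fin n)) (g : Mer n) : w • (cl g : ClassObs n) = cl (permMer w g) :=
  permClassical_cl w g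

theorem smul_mom (w : Equiv.Perm (Fin n)) (i : Fin n) : w • mom i = mom (w i) :=
  permClassical_mom w i

theorem smul_cl_recip (w : Equiv.Perm (Fin n)) (a b : Fin n) :
    w • (cl (recip a b) : ClassObs n) = cl (recip (w a) (w b)) := by
  rw [smul_cl, permMer_recip]

theorem ratDunkl_eq_dunklOp (κ : ℂ) (i : Fin n) :
    ratDunkl κ i = dunklOp κ mom (fun _ _ a b => cl (recip a b)) i := rfl

theorem cl_recip_three_term {i j l : Fin n} (hij : i ≠ j) (hil : i ≠ l) (hjl : j ≠ l) :
    (cl (recip i j) * cl (recip i l) : ClassObs n) =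
      cl (recip i l) * cl (recip l j) + cl (recip j l) * cl (recip i j) := by
  simp only [← map_mul, ← map_add, recip_three_term hij hil hjl]

theorem cl_recip_swap (a b : Fin n) : (cl (recip b a) : ClassObs n) = -cl (recip a b) := by
  rw [recip_swap, map_neg]

theorem commute_ratDunkl (κ : ℂ) (i j : Fin n) : Commute (ratDunkl κ i) (ratDunkl κ j) := by
  simp only [ratDunkl_eq_dunklOp]
  exact commute_dunklOp κ _ _ smul_mom (fun w _ _ a b => smul_cl_recip w a b)
    (fun _ a => by rw [recip_self, map_zero]) (fun _ _ a b => cl_recip_swap a b)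
    (fun _ _ _ _ _ _ _ _ => mul_comm _ _) (fun _ _ _ => cl_recip_three_term)
    (fun _ _ => mul_comm _ _) (fun _ _ _ _ _ => mul_comm _ _) (fun _ _ _ => mul_comm _ _) i j

/-- `Res` as a linear map. -/
def resLin : ClassicalCrossed n →ₗ[ℂ] ClassObs n where
  toFun := resClassical
  map_add' a b := SkewMonoidAlgebra.sum_add_index' (fun _ => rfl) (fun _ _ _ => rfl)
  map_smul' c a := by
    change SkewMonoidAlgebra.sum (c • a) _ = c • SkewMonoidAlgebra.sum a _
    rw [SkewMonoidAlgebra.sum_smul_index' (fun _ => rfl)]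
    exact Finset.smul_sum.symm

theorem resLin_single (w : Equiv.Perm (Fin n)) (a : ClassObs n) : resLin (single w a) = a :=
  SkewMonoidAlgebra.sum_single_index (h := fun _ c => c) rfl

theorem resLin_single_mul (w : Equiv.Perm (Fin n)) (a : ClassObs n) (b : ClassicalCrossed n) :
    resLin (single w a * b) = a * w • resLin b := by
  induction b using SkewMonoidAlgebra.induction with
  | h0 => simp
  | ha u b x _ _ h =>
    rw [mul_add, map_add, map_add, h, single_mul_single, resLin_single, resLin_single, smul_add,
      mul_add]

theorem resLin_mul_single (w : Equiv.Perm (Fin n)) (b : ClassicalCrossed n) :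
    resLin (b * single w 1) = resLin b := by
  induction b using SkewMonoidAlgebra.induction with
  | h0 => simp
  | ha u b x _ _ h =>
    rw [add_mul, map_add, map_add, h, single_mul_single, resLin_single, resLin_single, smul_one,
      mul_one]

/-- On elements with an invariant residue on the right, `Res` is multiplicative. -/
theorem resLin_mul {b : ClassicalCrossed n} (hb : ∀ w : Equiv.Perm (Fin n), w • resLin b = resLin b)
    (a : ClassicalCrossed n) : resLin (a * b) = resLin a * resLin b := by
  induction a using SkewMonoidAlgebra.induction with
  | h0 => simp
  | ha u c x _ _ h =>
    rw [add_mul, map_add, map_add, h, resLin_single_mul, resLin_single, hb, add_mul]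

/-- The action of the Dunkl operator `y_i` on `A_0`. -/
def dunklAct (κ : ℂ) (i : Fin n) (f : ClassObs n) : ClassObs n :=
  mom i * f - κ • ∑ j ∈ Finset.univ.erase i, cl (recip i j) * Equiv.swap i j • f

theorem resLin_ratDunkl_mul (κ : ℂ) (i : Fin n) (b : ClassicalCrossed n) :
    resLin (ratDunkl κ i * b) = dunklAct κ i (resLin b) := by
  rw [ratDunkl, sub_mul, map_sub, resLin_single_mul, one_smul, smul_mul_assoc, map_smul,
    Finset.sum_mul, map_sum, dunklAct]
  congr 2
  exact Finset.sum_congr rfl fun j _ => resLin_single_mul _ _ _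

/-- The homomorphism `q ↦ q(y)` for the rational Dunkl operators `y`. -/
theorem exists_ratHom (n : ℕ) (κ : ℂ) : ∃ E : MvPolynomial (Fin n) ℂ →+* ClassicalCrossed n,
    (∀ q, ratHam κ q = resLin (E q)) ∧ (∀ i, E (MvPolynomial.X i) = ratDunkl κ i) ∧
      ∀ c, E (MvPolynomial.C c) = algebraMap ℂ _ c := by
  obtain ⟨E, hE⟩ := exists_ringHom_of_commute (RingHom.id ℂ) (ratDunkl (n := n) κ)
    (commute_ratDunkl κ)
  refine ⟨E, fun q => ?_, fun i => ?_, fun c => ?_⟩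
  · rw [hE]
    rfl
  · rw [hE, polyEval_X]
  · rw [hE, polyEval_C]
    rfl

/-- A subspace of `A_0` that contains `1` and is stable under the Dunkl operators contains the
Hamiltonians. -/
theorem ratHam_mem (κ : ℂ) {N : Set (ClassObs n)} (h1 : 1 ∈ N)
    (hadd : ∀ f ∈ N, ∀ g ∈ N, f + g ∈ N) (hsmul : ∀ (c : ℂ), ∀ f ∈ N, c • f ∈ N)
    (hY : ∀ i, ∀ f ∈ N, dunklAct κ i f ∈ N) (q : MvPolynomial (Fin n) ℂ) : ratHam κ q ∈ N := by
  obtain ⟨E, hE, hX, hC⟩ := exists_ratHom n κ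
  rw [hE]
  induction q using MvPolynomial.induction_on with
  | C c =>
    rw [hC, Algebra.algebraMap_eq_smul_one, map_smul]
    refine hsmul c _ ?_
    rwa [show (1 : ClassicalCrossed n) = single 1 1 from rfl, resLin_single]
  | add p q hp hq =>
    rw [map_add, map_add]
    exact hadd _ hp _ hq
  | mul_X p i hp =>
    rw [mul_comm, map_mul, hX, resLin_ratDunkl_mul]
    exact hY i _ hp

theorem single_mul_ratDunkl (κ : ℂ) (w : Equiv.Perm (Fin n)) (i : Fin n) :
    single w 1 * ratDunkl κ i = ratDunkl κ (w i) * single w 1 :=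
  single_mul_dunklOp κ mom (fun _ _ a b => cl (recip a b))
    (fun _ _ a b => cl (recip a b)) smul_mom w
    (fun i j => smul_cl_recip w i j) i

/-- The Hamiltonians are `S_n`-invariant, since the Dunkl operators are permuted by conjugation. -/
theorem smul_ratHam (κ : ℂ) {q : MvPolynomial (Fin n) ℂ} (hq : q.IsSymmetric)
    (w : Equiv.Perm (Fin n)) : w • ratHam κ q = ratHam κ q := by
  obtain ⟨E, hE, hX, hC⟩ := exists_ratHom n κ
  have key : ∀ p : MvPolynomial (Fin n) ℂ,
      single w 1 * E p = E (MvPolynomial.rename w p) * single w 1 := by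
    intro p
    induction p using MvPolynomial.induction_on with
    | C c =>
      rw [MvPolynomial.rename_C, hC]
      exact (Algebra.commutes c _).symm
    | add p q hp hq => rw [map_add, map_add, map_add, mul_add, add_mul, hp, hq]
    | mul_X p i hp =>
      rw [map_mul, map_mul, map_mul, ← mul_assoc, hp, mul_assoc, hX, single_mul_ratDunkl,
        MvPolynomial.rename_X, hX, mul_assoc]
  have h := congrArg resLin (key q)
  rw [resLin_single_mul, one_mul, resLin_mul_single, hq w] at h
  rw [hE]
  exact h

theorem ratHam_mul (κ : ℂ) (p : MvPolynomial (Fin n) ℂ) {q : MvPolynomial (Fin n) ℂ}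
    (hq : q.IsSymmetric) : ratHam κ (p * q) = ratHam κ p * ratHam κ q := by
  have h := smul_ratHam κ hq
  obtain ⟨E, hE, hX, hC⟩ := exists_ratHom n κ
  simp only [hE] at h ⊢
  rw [map_mul, resLin_mul h]

theorem ratHam_add (κ : ℂ) (p q : MvPolynomial (Fin n) ℂ) :
    ratHam κ (p + q) = ratHam κ p + ratHam κ q := by
  obtain ⟨E, hE, hX, hC⟩ := exists_ratHom n κ
  rw [hE, hE, hE, map_add, map_add]

theorem ratHam_C (κ : ℂ) (c : ℂ) :
    ratHam κ (MvPolynomial.C c : MvPolynomial (Fin n) ℂ) = algebraMap ℂ _ c := by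
  obtain ⟨E, hE, hX, hC⟩ := exists_ratHom n κ
  rw [hE, hC, Algebra.algebraMap_eq_smul_one, map_smul, show (1 : ClassicalCrossed n) = single 1 1
    from rfl, resLin_single, Algebra.algebraMap_eq_smul_one]

theorem sum_sum_eq_zero_of_antisymm {A : Type*} [AddCommGroup A] [Module ℂ A] 
    (g : Fin n → Fin n → A)
    (h : ∀ i j, g j i = -g i j) : ∑ i, ∑ j, g i j = 0 := by
  have h1 : ∑ i, ∑ j, g i j = -∑ i, ∑ j, g i j := by
    conv_lhs => rw [Finset.sum_comm]
    simp only [← Finset.sum_neg_distrib]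
    exact Finset.sum_congr rfl fun i _ => Finset.sum_congr rfl fun j _ => h i j
  have h2 : (2 : ℂ) • ∑ i, ∑ j, g i j = 0 := by
    rw [two_smul]
    nth_rewrite 2 [h1]
    exact add_neg_cancel _
  exact (smul_eq_zero.mp h2).resolve_left two_ne_zero

theorem ratHam_sum_X (κ : ℂ) : ratHam κ (∑ i : Fin n, MvPolynomial.X i) = ∑ i, mom i := by
  obtain ⟨E, hE, hX, hC⟩ := exists_ratHom n κ
  rw [hE, map_sum]
  simp only [hX, ratDunkl, Finset.sum_sub_distrib, map_sub, map_sum, resLin_single,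
    ← Finset.smul_sum,
    map_smul]
  have h : ∀ i : Fin n, ∑ j ∈ Finset.univ.erase i, (cl (recip i j) : ClassObs n) =
      ∑ j, cl (recip i j) := fun i => Finset.sum_erase _ (by rw [recip_self, map_zero])
  change _ - κ • ∑ i, ∑ j ∈ Finset.univ.erase i, (cl (recip i j) : ClassObs n) = _
  simp only [h]
  rw [sum_sum_eq_zero_of_antisymm _ fun i j => cl_recip_swap i j, smul_zero, sub_zero]

theorem ratHam_sum_X_sq (κ : ℂ) : ratHam κ (∑ i : Fin n, MvPolynomial.X i ^ 2) =
    ∑ i, mom i ^ 2 - κ ^ 2 • ∑ i, ∑ j, cl (recip i j) ^ 2 := by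
  obtain ⟨E, hE, hX, hC⟩ := exists_ratHom n κ
  rw [hE, map_sum]
  simp only [map_pow, hX]
  have hself : ∀ i : Fin n, (single (Equiv.swap i i) (cl (recip i i)) : ClassicalCrossed n) = 0 :=
    fun i => by rw [recip_self, map_zero, single_zero]
  have hop : ∀ i : Fin n, ratDunkl κ i = single 1 (mom i) -
      κ • ∑ j, single (Equiv.swap i j) (cl (recip i j)) := by
    intro i
    have := Finset.sum_erase (f := fun j => (single (Equiv.swap i j) (cl (recip i j)) :
      ClassicalCrossed n)) Finset.univ (hself i)
    rw [← this]
    rfl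
  simp only [hop]
  rw [sum_sq_of_threeTerm κ (fun i : Fin n => single 1 (mom i))
    (fun i j => single (Equiv.swap i j) (cl (recip i j))) hself
    (fun i j l => dunkl_threeTerm (fun _ _ a b => cl (recip a b))
      (fun w _ _ a b => smul_cl_recip w a b) (fun _ _ a b => cl_recip_swap a b)
      (fun _ _ _ => cl_recip_three_term))]
  simp only [sq (single _ _), single_mul_single, map_add, map_sub, map_smul, map_sum,
    resLin_single, smul_cl_recip, smul_mom, one_smul, Equiv.swap_apply_left, Equiv.swap_apply_right]
  rw [sum_sum_eq_zero_of_antisymm (fun i j => mom i * cl (recip i j) + cl (recip i j) * mom j)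
    (fun i j => by rw [cl_recip_swap i j]; ring), smul_zero, sub_zero, sub_eq_add_neg, ← smul_neg]
  simp only [← Finset.sum_neg_distrib]
  refine congrArg₂ _ (Finset.sum_congr rfl fun i _ => (sq _).symm) (congrArg _ ?_)
  refine Finset.sum_congr rfl fun i _ => Finset.sum_congr rfl fun j _ => ?_
  rw [cl_recip_swap i j]
  ring

end Rational

/-! ### The Hamiltonians near a reflection hyperplane -/

section PairAlg

variable {n : ℕ}

/-- The coordinate difference `x_i - x_j` as a classical observable. -/
def clDiff (i j : Fin n) : ClassObs n := cl (algebraMap (Entire n) (Mer n) (coordDiff i j))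

theorem clDiff_mul_recip {i j : Fin n} (hij : i ≠ j) : clDiff i j * cl (recip i j) = 1 := by
  rw [clDiff, ← map_mul, recip_eq_inv,
    mul_inv_cancel₀ (algebraMap_entire_ne_zero (coordDiff_ne_zero hij)), map_one]

theorem smul_clDiff (w : Equiv.Perm (Fin n)) (i j : Fin n) :
    w • clDiff i j = clDiff (w i) (w j) := by
  rw [clDiff, smul_cl, permMer_algebraMap]
  rfl

theorem clDiff_swap (i j : Fin n) : clDiff j i = -clDiff i j := by
  rw [clDiff, coordDiff_neg, map_neg, map_neg, clDiff]

theorem clDiff_self (i : Fin n) : clDiff i i = 0 := by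
  rw [clDiff, show coordDiff i i = 0 from Subtype.ext (funext fun x => sub_self (x i)), map_zero,
    map_zero]

theorem clDiff_add (a b c : Fin n) : clDiff a b + clDiff b c = clDiff a c := by
  rw [clDiff, clDiff, clDiff, ← map_add, ← map_add, coordDiff_add]

/-- Generators of the algebra of classical observables on which the substitution of elliptic Dunkl
operators has no pole along `λ_i = λ_j`. Only the last one is not obvious: the double pole of
`(y_i - y_j)²` is cancelled by that of `4 κ² / (λ_i - λ_j)²`, the rational Hamiltonian of rank one.
-/
inductive PairGen (κ : ℂ) (i j : Fin n) : ClassObs n → Prop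
  | diff : PairGen κ i j (clDiff i j)
  | recip (a b : Fin n) : s(a, b) ≠ s(i, j) → PairGen κ i j (cl (recip a b))
  | mom (k : Fin n) : k ≠ i → k ≠ j → PairGen κ i j (mom k)
  | momAdd : PairGen κ i j (SpinCM.mom i + SpinCM.mom j)
  | diffMul : PairGen κ i j (clDiff i j * (SpinCM.mom i - SpinCM.mom j))
  | quad : PairGen κ i j ((SpinCM.mom i - SpinCM.mom j) ^ 2 -
      (4 * κ ^ 2) • cl (SpinCM.recip i j) ^ 2)

/-- The algebra generated by `PairGen κ i j`. -/
def pairAlg (κ : ℂ) (i j : Fin n) : Subalgebra ℂ (ClassObs n) :=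
  Algebra.adjoin ℂ {f | PairGen κ i j f}

theorem PairGen.mem {κ : ℂ} {i j : Fin n} {f : ClassObs n} (h : PairGen κ i j f) :
    f ∈ pairAlg κ i j := Algebra.subset_adjoin h

theorem sym2_map_ne {w : Equiv.Perm (Fin n)} {a b i j : Fin n} (h : s(a, b) ≠ s(i, j)) :
    s(w a, w b) ≠ s(w i, w j) := fun h' => h (Sym2.map.injective w.injective h')

theorem PairGen.perm {κ : ℂ} {i j : Fin n} {f : ClassObs n} (h : PairGen κ i j f)
    (w : Equiv.Perm (Fin n)) : PairGen κ (w i) (w j) (w • f) := by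
  cases h with
  | diff => rw [smul_clDiff]; exact .diff
  | recip a b h => rw [smul_cl_recip]; exact .recip _ _ (sym2_map_ne h)
  | mom k hi hj => rw [smul_mom]; exact .mom _ (w.injective.ne hi) (w.injective.ne hj)
  | momAdd => rw [smul_add, smul_mom, smul_mom]; exact .momAdd
  | diffMul => rw [smul_mul', smul_sub, smul_clDiff, smul_mom, smul_mom]; exact .diffMul
  | quad =>
    rw [smul_sub, smul_comm, smul_pow', smul_pow', smul_sub, smul_mom, smul_mom, smul_cl_recip]
    exact .quad

theorem smul_algebraMap_classObs (w : Equiv.Perm (Fin n)) (c : ℂ) :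
    w • algebraMap ℂ (ClassObs n) c = algebraMap ℂ (ClassObs n) c := by
  rw [Algebra.algebraMap_eq_smul_one, smul_comm, smul_one]

theorem smul_mem_pairAlg {κ : ℂ} {i j : Fin n} {f : ClassObs n} (h : f ∈ pairAlg κ i j)
    (w : Equiv.Perm (Fin n)) : w • f ∈ pairAlg κ (w i) (w j) := by
  induction h using Algebra.adjoin_induction with
  | mem f h => exact (PairGen.perm h w).mem
  | algebraMap r =>
    rw [smul_algebraMap_classObs]
    exact Subalgebra.algebraMap_mem _ r
  | add f g _ _ hf hg => rw [smul_add]; exact add_mem hf hg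
  | mul f g _ _ hf hg => rw [smul_mul']; exact mul_mem hf hg

theorem pairAlg_swap_le (κ : ℂ) (i j : Fin n) : pairAlg κ j i ≤ pairAlg κ i j := by
  refine Algebra.adjoin_le fun f hf => ?_
  cases hf with
  | diff => rw [clDiff_swap]; exact neg_mem PairGen.diff.mem
  | recip a b h => exact (PairGen.recip a b (by rwa [Sym2.eq_swap (a := i)])).mem
  | mom k hi hj => exact (PairGen.mom k hj hi).mem
  | momAdd => rw [add_comm]; exact PairGen.momAdd.mem
  | diffMul =>
    rw [clDiff_swap, neg_mul, ← mul_neg, neg_sub]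
    exact PairGen.diffMul.mem
  | quad =>
    rw [cl_recip_swap, neg_sq, sub_sq_comm]
    exact PairGen.quad.mem

theorem swap_smul_mem_pairAlg {κ : ℂ} {i j : Fin n} {f : ClassObs n} (h : f ∈ pairAlg κ i j) :
    Equiv.swap i j • f ∈ pairAlg κ i j := by
  have := smul_mem_pairAlg h (Equiv.swap i j)
  rw [Equiv.swap_apply_left, Equiv.swap_apply_right] at this
  exact pairAlg_swap_le κ i j this

/-- `x_{s(a)} - x_a` is a multiple of `x_i - x_j`, where `s` is the transposition of `i`, `j`. -/
theorem exists_clDiff_swap (i j a : Fin n) :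
    ∃ m : ℂ, clDiff (Equiv.swap i j a) a = algebraMap ℂ _ m * clDiff i j := by
  by_cases hi : a = i
  · subst hi
    exact ⟨-1, by rw [Equiv.swap_apply_left, clDiff_swap]; simp⟩
  by_cases hj : a = j
  · subst hj
    exact ⟨1, by rw [Equiv.swap_apply_right]; simp⟩
  · exact ⟨0, by rw [Equiv.swap_apply_of_ne_of_ne hi hj, clDiff_self]; simp⟩

/-- The divided difference of an element of `pairAlg κ i j` under the transposition of `i`, `j`. -/
theorem exists_sub_swap_smul {κ : ℂ} {i j : Fin n} {f : ClassObs n}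
    (h : f ∈ pairAlg κ i j) : ∃ g ∈ pairAlg κ i j, f - Equiv.swap i j • f = clDiff i j * g := by
  induction h using Algebra.adjoin_induction with
  | mem f h =>
    cases h with
    | diff =>
      refine ⟨algebraMap ℂ _ 2, Subalgebra.algebraMap_mem _ _, ?_⟩
      rw [smul_clDiff, Equiv.swap_apply_left, Equiv.swap_apply_right, clDiff_swap, map_ofNat]
      ring
    | recip a b h =>
      by_cases hab : a = b
      · subst hab
        exact ⟨0, zero_mem _, by rw [recip_self, map_zero, smul_zero, mul_zero, sub_zero]⟩
      obtain ⟨m, hm⟩ := exists_clDiff_swap i j a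
      obtain ⟨m', hm'⟩ := exists_clDiff_swap i j b
      have h' : s(Equiv.swap i j a, Equiv.swap i j b) ≠ s(i, j) := by
        have := sym2_map_ne (w := Equiv.swap i j) h
        rwa [Equiv.swap_apply_left, Equiv.swap_apply_right, Sym2.eq_swap (a := j)] at this
      refine ⟨algebraMap ℂ _ (m - m') * (cl (recip a b) *
        cl (recip (Equiv.swap i j a) (Equiv.swap i j b))), mul_mem (Subalgebra.algebraMap_mem _ _)
        (mul_mem (PairGen.recip _ _ h).mem (PairGen.recip _ _ h').mem), ?_⟩
      rw [smul_cl_recip]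
      have e1 := clDiff_mul_recip hab
      have e2 := clDiff_mul_recip ((Equiv.swap i j).injective.ne hab)
      have e3 := clDiff_add (Equiv.swap i j a) a b
      have e4 := clDiff_add (Equiv.swap i j a) (Equiv.swap i j b) b
      rw [hm] at e3
      rw [hm', ← e3] at e4
      rw [map_sub]
      set r := (cl (recip a b) : ClassObs n)
      set r' := (cl (recip (Equiv.swap i j a) (Equiv.swap i j b)) : ClassObs n)
      linear_combination (-r) * e2 + r' * e1 + r * r' * e4
    | mom k hi hj =>
      exact ⟨0, zero_mem _, by
        rw [smul_mom, Equiv.swap_apply_of_ne_of_ne hi hj, mul_zero, sub_self]⟩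
    | momAdd =>
      exact ⟨0, zero_mem _, by
        rw [smul_add, smul_mom, smul_mom, Equiv.swap_apply_left, Equiv.swap_apply_right]; ring⟩
    | diffMul =>
      exact ⟨0, zero_mem _, by
        rw [smul_mul', smul_sub, smul_mom, smul_mom, smul_clDiff, Equiv.swap_apply_left,
          Equiv.swap_apply_right, clDiff_swap]; ring⟩
    | quad =>
      exact ⟨0, zero_mem _, by
        rw [smul_sub, smul_comm, smul_pow', smul_pow', smul_sub, smul_mom, smul_mom, smul_cl_recip,
          Equiv.swap_apply_left, Equiv.swap_apply_right, cl_recip_swap, neg_sq]; ring⟩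
  | algebraMap r =>
    exact ⟨0, zero_mem _, by rw [smul_algebraMap_classObs, sub_self, mul_zero]⟩
  | add f g _ _ hf hg =>
    obtain ⟨f', hf', ef⟩ := hf
    obtain ⟨g', hg', eg⟩ := hg
    refine ⟨f' + g', add_mem hf' hg', ?_⟩
    rw [smul_add]
    linear_combination ef + eg
  | mul f g hf0 hg0 hf hg =>
    obtain ⟨f', hf', ef⟩ := hf
    obtain ⟨g', hg', eg⟩ := hg
    refine ⟨f' * g + Equiv.swap i j • f * g',
      add_mem (mul_mem hf' hg0) (mul_mem (swap_smul_mem_pairAlg hf0) hg'), ?_⟩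
    rw [smul_mul']
    linear_combination g * ef + (Equiv.swap i j • f) * eg

/-- `p_i - p_j - 2 κ / (x_i - x_j)`. -/
def pairTheta (κ : ℂ) (i j : Fin n) : ClassObs n :=
  mom i - mom j - (2 * κ) • cl (recip i j)

theorem smul_pairTheta (κ : ℂ) (w : Equiv.Perm (Fin n)) (i j : Fin n) :
    w • pairTheta κ i j = pairTheta κ (w i) (w j) := by
  rw [pairTheta, smul_sub, smul_sub, smul_comm, smul_mom, smul_mom, smul_cl_recip, pairTheta]

theorem pairTheta_swap (κ : ℂ) (i j : Fin n) : pairTheta κ j i = -pairTheta κ i j := by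
  rw [pairTheta, pairTheta, cl_recip_swap, smul_neg]
  ring

/-- The module over `pairAlg κ i j` generated by `1` and `pairTheta κ i j`. -/
def pairMod (κ : ℂ) (i j : Fin n) : Submodule (pairAlg κ i j) (ClassObs n) :=
  Submodule.span _ {1, pairTheta κ i j}

theorem mem_pairMod {κ : ℂ} {i j : Fin n} {f : ClassObs n} : f ∈ pairMod κ i j ↔
    ∃ b ∈ pairAlg κ i j, ∃ c ∈ pairAlg κ i j, f = b + pairTheta κ i j * c := by
  rw [pairMod, Submodule.mem_span_pair]
  constructor
  · rintro ⟨b, c, rfl⟩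
    refine ⟨b, b.2, c, c.2, ?_⟩
    rw [Subalgebra.smul_def, Subalgebra.smul_def, smul_eq_mul, smul_eq_mul, mul_one, mul_comm]
  · rintro ⟨b, hb, c, hc, rfl⟩
    refine ⟨⟨b, hb⟩, ⟨c, hc⟩, ?_⟩
    rw [Subalgebra.smul_def, Subalgebra.smul_def, smul_eq_mul, smul_eq_mul, mul_one, mul_comm]

theorem mul_mem_pairMod {κ : ℂ} {i j : Fin n} {b f : ClassObs n} (hb : b ∈ pairAlg κ i j)
    (hf : f ∈ pairMod κ i j) : b * f ∈ pairMod κ i j :=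
  (pairMod κ i j).smul_mem ⟨b, hb⟩ hf

theorem smul_mem_pairMod {κ : ℂ} {i j : Fin n} {f : ClassObs n} (h : f ∈ pairMod κ i j)
    (w : Equiv.Perm (Fin n)) : w • f ∈ pairMod κ (w i) (w j) := by
  obtain ⟨b, hb, c, hc, rfl⟩ := mem_pairMod.mp h
  refine mem_pairMod.mpr ⟨_, smul_mem_pairAlg hb w, _, smul_mem_pairAlg hc w, ?_⟩
  rw [smul_add, smul_mul', smul_pairTheta]

/-- The part of the Dunkl operators involving `p_i - p_j` and the reflection in `x_i = x_j`
preserves `pairMod κ i j`. -/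
theorem pair_dunkl_mem {κ : ℂ} {i j : Fin n} (hij : i ≠ j) {f : ClassObs n}
    (h : f ∈ pairMod κ i j) :
    (mom i - mom j) * f - (2 * κ) • (cl (recip i j) * Equiv.swap i j • f) ∈ pairMod κ i j := by
  obtain ⟨b, hb, c, hc, rfl⟩ := mem_pairMod.mp h
  obtain ⟨b', hb', eb⟩ := exists_sub_swap_smul hb
  obtain ⟨c', hc', ec⟩ := exists_sub_swap_smul hc
  have hq : (mom i - mom j) ^ 2 - (4 * κ ^ 2) • cl (recip i j) ^ 2 ∈ pairAlg κ i j :=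
    PairGen.quad.mem
  refine mem_pairMod.mpr ⟨(2 * κ) • b' + ((mom i - mom j) ^ 2 -
      (4 * κ ^ 2) • cl (recip i j) ^ 2) * c,
    add_mem (Subalgebra.smul_mem _ hb' _) (mul_mem hq hc), b - (2 * κ) • c',
    sub_mem hb (Subalgebra.smul_mem _ hc' _), ?_⟩
  have e1 := clDiff_mul_recip hij
  rw [smul_add, smul_mul', smul_pairTheta, Equiv.swap_apply_left, Equiv.swap_apply_right,
    pairTheta_swap κ i j, pairTheta]
  simp only [Algebra.smul_def, map_mul, map_pow, map_ofNat]
  set s := Equiv.swap i j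
  set r := (cl (recip i j) : ClassObs n)
  set k := algebraMap ℂ (ClassObs n) κ
  linear_combination (2 * k * r) * eb + 2 * k * b' * e1 -
    (2 * k * r * (mom i - mom j - 2 * k * r)) * ec - 2 * k * (mom i - mom j - 2 * k * r) * c' * e1

/-- Elements of `pairMod κ i j` symmetric in `i`, `j` lie in `pairAlg κ i j`. -/
theorem mem_pairAlg_of_swap_smul {κ : ℂ} {i j : Fin n} (hij : i ≠ j) {f : ClassObs n}
    (h : f ∈ pairMod κ i j) (hs : Equiv.swap i j • f = f) : f ∈ pairAlg κ i j := by
  obtain ⟨b, hb, c, hc, rfl⟩ := mem_pairMod.mp h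
  obtain ⟨c', hc', ec⟩ := exists_sub_swap_smul hc
  have e1 := clDiff_mul_recip hij
  rw [smul_add, smul_mul', smul_pairTheta, Equiv.swap_apply_left, Equiv.swap_apply_right,
    pairTheta_swap] at hs
  -- `2 f = f + s f = (b + s b) + θ (c - s c)`, and `(x_i - x_j) θ` lies in `pairAlg κ i j`
  have hm : b + Equiv.swap i j • b + (clDiff i j * (mom i - mom j) - algebraMap ℂ _ (2 * κ)) * c' ∈
      pairAlg κ i j :=
    add_mem (add_mem hb (swap_smul_mem_pairAlg hb)) (mul_mem (sub_mem PairGen.diffMul.mem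
      (Subalgebra.algebraMap_mem _ _)) hc')
  have := Subalgebra.smul_mem _ hm (1 / 2 : ℂ)
  convert this using 1
  rw [Algebra.smul_def]
  have h2 : algebraMap ℂ (ClassObs n) (1 / 2) * 2 = 1 := by
    rw [← map_ofNat (algebraMap ℂ (ClassObs n)) 2, ← map_mul]
    simp
  rw [pairTheta, Algebra.smul_def] at hs ⊢
  set h := algebraMap ℂ (ClassObs n) (1 / 2)
  set k := algebraMap ℂ (ClassObs n) (2 * κ)
  set r := (cl (recip i j) : ClassObs n)
  linear_combination (-(b + (mom i - mom j - k * r) * c)) * h2 - h * hs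
    + h * (mom i - mom j - k * r) * ec - h * k * c' * e1

/-- The Dunkl operator `y_k` is the sum of the multiplication by an element of `pairAlg κ i j`, of
reflections `s_{ab}` with coefficients in `pairAlg κ i j`, and, for `k = i, j`, of half the operator
of `pair_dunkl_mem`. -/
theorem dunklAct_mem_pairMod {κ : ℂ} {i j : Fin n} (hij : i ≠ j) {f : ClassObs n}
    (hf : ∀ a b : Fin n, a ≠ b → f ∈ pairMod κ a b) (k : Fin n) :
    dunklAct κ k f ∈ pairMod κ i j := by
  have hC : ∀ (c : ℂ) (g : ClassObs n), g ∈ pairMod κ i j → c • g ∈ pairMod κ i j := by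
    intro c g hg
    rw [Algebra.smul_def]
    exact mul_mem_pairMod (Subalgebra.algebraMap_mem _ _) hg
  have hs : ∀ w : Equiv.Perm (Fin n), w • f ∈ pairMod κ i j := by
    intro w
    have := smul_mem_pairMod (hf (w.symm i) (w.symm j) (w.symm.injective.ne hij)) w
    rwa [Equiv.apply_symm_apply, Equiv.apply_symm_apply] at this
  have hrest : ∀ a b, s(a, b) ≠ s(i, j) → cl (recip a b) * Equiv.swap a b • f ∈ pairMod κ i j :=
    fun a b hab => mul_mem_pairMod (PairGen.recip a b hab).mem (hs _)
  have hP := mul_mem_pairMod (PairGen.momAdd (κ := κ) (i := i) (j := j)).mem (hf i j hij)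
  have hT := pair_dunkl_mem hij (hf i j hij)
  rw [dunklAct]
  by_cases hki : k = i
  · subst hki
    rw [← Finset.add_sum_erase _ _ (Finset.mem_erase.mpr ⟨hij.symm, Finset.mem_univ j⟩), smul_add,
      ← sub_sub]
    refine sub_mem ?_ (hC _ _ (sum_mem fun l hl => hrest _ _ ?_))
    · convert hC (1 / 2) _ (add_mem hP hT) using 1
      rw [add_mul, sub_mul]
      module
    · rw [Finset.mem_erase, Finset.mem_erase] at hl
      simp [hl.1, hij]
  by_cases hkj : k = j
  · subst hkj
    rw [← Finset.add_sum_erase _ _ (Finset.mem_erase.mpr ⟨hij, Finset.mem_univ i⟩), smul_add,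
      ← sub_sub]
    refine sub_mem ?_ (hC _ _ (sum_mem fun l hl => hrest _ _ ?_))
    · convert hC (1 / 2) _ (sub_mem hP hT) using 1
      rw [cl_recip_swap, Equiv.swap_comm, add_mul, sub_mul, neg_mul]
      module
    · rw [Finset.mem_erase, Finset.mem_erase] at hl
      simp [hl.1, hij.symm]
  · refine sub_mem (mul_mem_pairMod (PairGen.mom k hki hkj).mem (hf i j hij))
      (hC _ _ (sum_mem fun l _ => hrest _ _ ?_))
    simp [hki, hkj]

/-- The rational Hamiltonians lie in `pairAlg κ i j` for each hyperplane `x_i = x_j`: applying Dunkl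
operators to `1` stays within `pairMod κ i j`, whose symmetric elements lie in `pairAlg κ i j`. -/
theorem ratHam_mem_pairAlg (κ : ℂ) {i j : Fin n} (hij : i ≠ j) {q : MvPolynomial (Fin n) ℂ}
    (hq : q.IsSymmetric) : ratHam κ q ∈ pairAlg κ i j := by
  refine mem_pairAlg_of_swap_smul hij ?_ (smul_ratHam κ hq _)
  refine ratHam_mem κ (N := {f | ∀ a b : Fin n, a ≠ b → f ∈ pairMod κ a b}) (fun a b _ => ?_)
    (fun f hf g hg a b hab => add_mem (hf a b hab) (hg a b hab)) (fun c f hf a b hab => ?_)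
    (fun i f hf a b hab => dunklAct_mem_pairMod hab hf i) q i j hij
  · exact Submodule.subset_span (by simp)
  · rw [Algebra.smul_def]
    exact mul_mem_pairMod (Subalgebra.algebraMap_mem _ _) (hf a b hab)

/-- The algebra generated by the `1 / (x_a - x_b)` and the momenta. -/
def recipAlg (n : ℕ) : Subalgebra ℂ (ClassObs n) :=
  Algebra.adjoin ℂ ({f | ∃ a b : Fin n, f = cl (recip a b)} ∪ {f | ∃ i, f = mom i})

theorem smul_mem_recipAlg {f : ClassObs n} (h : f ∈ recipAlg n) (w : Equiv.Perm (Fin n)) :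
    w • f ∈ recipAlg n := by
  induction h using Algebra.adjoin_induction with
  | mem f h =>
    rcases h with ⟨a, b, rfl⟩ | ⟨i, rfl⟩
    · exact Algebra.subset_adjoin (Or.inl ⟨_, _, smul_cl_recip _ _ _⟩)
    · exact Algebra.subset_adjoin (Or.inr ⟨_, smul_mom _ _⟩)
  | algebraMap r =>
    rw [smul_algebraMap_classObs]
    exact Subalgebra.algebraMap_mem _ r
  | add f g _ _ hf hg => rw [smul_add]; exact add_mem hf hg
  | mul f g _ _ hf hg => rw [smul_mul']; exact mul_mem hf hg

theorem ratHam_mem_recipAlg (κ : ℂ) (q : MvPolynomial (Fin n) ℂ) : ratHam κ q ∈ recipAlg n := by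
  refine ratHam_mem κ (N := {f | f ∈ recipAlg n}) (recipAlg n).one_mem
    (fun f hf g hg => (recipAlg n).add_mem hf hg) (fun c f hf => (recipAlg n).smul_mem hf c)
    (fun i f hf => ?_) q
  change dunklAct κ i f ∈ recipAlg n
  exact (recipAlg n).sub_mem ((recipAlg n).mul_mem (Algebra.subset_adjoin (Or.inr ⟨_, rfl⟩)) hf)
    ((recipAlg n).smul_mem ((recipAlg n).sum_mem fun j _ => (recipAlg n).mul_mem
      (Algebra.subset_adjoin (Or.inl ⟨_, _, rfl⟩)) (smul_mem_recipAlg hf _)) _)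

end PairAlg

/-! ### Elliptic Dunkl operators -/

section Elliptic

open SkewMonoidAlgebra (single single_mul_single single_add single_zero single_neg smul_single)

variable {n : ℕ} (L : PeriodPair)

theorem exists_notMem_lattice : ∃ z, z ∉ L.lattice := (dense_compl_lattice L).nonempty

/-- The meromorphic function `φ(μ, x_a - x_b)`. -/
def ellPhi (μ : ℂ) (a b : Fin n) : Mer n := ofFun fun x => phi L μ (x a - x b)

/-- The entire function `σ(x_a - x_b - μ)`. -/
def sigmaShift (μ : ℂ) (a b : Fin n) : Entire n :=
  diffEntire ((differentiable_weierstrassSigma L).comp (differentiable_id.sub_const μ)) a b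

/-- The entire function `σ(x_a - x_b)`. -/
def sigmaDiff (a b : Fin n) : Entire n := diffEntire (differentiable_weierstrassSigma L) a b

theorem sigmaShift_zero (a b : Fin n) : sigmaShift L 0 a b = sigmaDiff L a b :=
  Subtype.ext (funext fun _ => congrArg (weierstrassSigma L) (sub_zero _))

theorem sigmaDiff_ne_zero {a b : Fin n} (hab : a ≠ b) : sigmaDiff L a b ≠ 0 := by
  obtain ⟨z, hz⟩ := exists_notMem_lattice L
  exact diffEntire_ne_zero _ (weierstrassSigma_ne_zero L hz) hab

theorem represents_phi_sub (μ : ℂ) {a b : Fin n} (hab : a ≠ b) :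
    Represents ((weierstrassSigma L (-μ))⁻¹ • (algebraMap (Entire n) (Mer n) (sigmaShift L μ a b) /
      algebraMap (Entire n) (Mer n) (sigmaDiff L a b))) fun x => phi L μ (x a - x b) := by
  rw [Algebra.smul_def]
  convert (represents_const (weierstrassSigma L (-μ))⁻¹).mul
    (represents_div (sigmaShift L μ a b) (sigmaDiff_ne_zero L hab)) using 1
  ext1 x
  change phi L μ (x a - x b) = (weierstrassSigma L (-μ))⁻¹ *
    (weierstrassSigma L (x a - x b - μ) / weierstrassSigma L (x a - x b))
  rw [inv_mul_eq_div, div_div, phi]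

theorem ellPhi_eq (μ : ℂ) {a b : Fin n} (hab : a ≠ b) :
    ellPhi L μ a b = (weierstrassSigma L (-μ))⁻¹ •
      (algebraMap (Entire n) (Mer n) (sigmaShift L μ a b) /
        algebraMap (Entire n) (Mer n) (sigmaDiff L a b)) :=
  ofFun_eq (represents_phi_sub L μ hab)

theorem ellPhi_diag (μ : ℂ) (a : Fin n) : ellPhi L μ a a = 0 := by
  rw [ellPhi]
  simp only [sub_self, phi, weierstrassSigma_zero, zero_mul, div_zero]
  exact ofFun_zero

theorem represents_ellPhi (μ : ℂ) (a b : Fin n) :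
    Represents (ellPhi L μ a b) fun x => phi L μ (x a - x b) := by
  by_cases hab : a = b
  · subst hab
    rw [ellPhi_diag]
    simpa [phi, weierstrassSigma_zero] using represents_const (n := n) 0
  · rw [ellPhi_eq L μ hab]
    exact represents_phi_sub L μ hab

theorem permMer_ellPhi (w : Equiv.Perm (Fin n)) (μ : ℂ) (a b : Fin n) :
    permMer w (ellPhi L μ a b) = ellPhi L μ (w a) (w b) :=
  ((represents_ellPhi L μ a b).perm w).unique (represents_ellPhi L μ (w a) (w b))

theorem ellPhi_neg (μ : ℂ) (a b : Fin n) : ellPhi L (-μ) b a = -ellPhi L μ a b := by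
  refine (represents_ellPhi L (-μ) b a).unique ?_
  convert (represents_ellPhi L μ a b).neg using 1
  ext1 x
  rw [← phi_neg_neg, neg_sub]

/-- Off the zero set of `σ(x_a - x_b)`, the difference `x_a - x_b` is not a period. -/
theorem notMem_of_sigmaDiff_ne_zero {a b : Fin n} {x : Fin n → ℂ} (h : (sigmaDiff L a b).1 x ≠ 0) :
    x a - x b ∉ L.lattice := fun hx => h ((weierstrassSigma_eq_zero_iff L _).mpr hx)

theorem ellPhi_three_term {α β γ : ℂ} (hαβγ : α + β + γ = 0) (hα : α ∉ L.lattice)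
    (hβ : β ∉ L.lattice) (hγ : γ ∉ L.lattice) {i j l : Fin n} (hij : i ≠ j) (hil : i ≠ l)
    (hjl : j ≠ l) :
    (ellPhi L α i j * ellPhi L (-γ) l i + ellPhi L β l i * ellPhi L (-α) j l +
      ellPhi L γ j l * ellPhi L (-β) i j : Mer n) = 0 := by
  have h := ((((represents_ellPhi L α i j).mul (represents_ellPhi L (-γ) l i)).add
    ((represents_ellPhi L β l i).mul (represents_ellPhi L (-α) j l))).add
    ((represents_ellPhi L γ j l).mul (represents_ellPhi L (-β) i j)))
  have h0 := represents_const (n := n) 0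
  rw [map_zero] at h0
  refine (h.congr (mul_ne_zero (mul_ne_zero (sigmaDiff_ne_zero L hij)
    (sigmaDiff_ne_zero L hil.symm)) (sigmaDiff_ne_zero L hjl)) fun x hx => ?_).unique h0
  obtain ⟨hx, h3⟩ := mul_ne_zero_iff.mp (show ((sigmaDiff L i j).1 x * (sigmaDiff L l i).1 x) *
    (sigmaDiff L j l).1 x ≠ 0 from hx)
  obtain ⟨h1, h2⟩ := mul_ne_zero_iff.mp hx
  exact phi_three_term L (by ring) hαβγ (notMem_of_sigmaDiff_ne_zero L h1)
    (notMem_of_sigmaDiff_ne_zero L h2) (notMem_of_sigmaDiff_ne_zero L h3) hα hβ hγ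

/-- The meromorphic function `℘(x_a - x_b)`. -/
def ellP (a b : Fin n) : Mer n := ofFun fun x => L.weierstrassP (x a - x b)

/-- The entire function `(σ² ℘)(x_a - x_b)`. -/
def sigmaSqPDiff (a b : Fin n) : Entire n := diffEntire (differentiable_sigmaSqP L) a b

theorem represents_weierstrassP_sub {a b : Fin n} (hab : a ≠ b) :
    Represents (algebraMap (Entire n) (Mer n) (sigmaSqPDiff L a b) /
      algebraMap (Entire n) (Mer n) (sigmaDiff L a b) ^ 2)
      fun x => L.weierstrassP (x a - x b) := by
  have hs := sigmaDiff_ne_zero L hab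
  rw [← map_pow]
  refine (represents_div (sigmaSqPDiff L a b) (pow_ne_zero 2 hs)).congr hs fun x hx => ?_
  have h := deriv_weierstrassSigma_sq_sub L (notMem_of_sigmaDiff_ne_zero L hx)
  change sigmaSqP L (x a - x b) / weierstrassSigma L (x a - x b) ^ 2 = _
  rw [div_eq_iff (pow_ne_zero 2 (show weierstrassSigma L (x a - x b) ≠ 0 from hx)), sigmaSqP, h,
    mul_comm]

theorem ellP_eq {a b : Fin n} (hab : a ≠ b) :
    ellP L a b = algebraMap (Entire n) (Mer n) (sigmaSqPDiff L a b) /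
      algebraMap (Entire n) (Mer n) (sigmaDiff L a b) ^ 2 :=
  ofFun_eq (represents_weierstrassP_sub L hab)

theorem ellPhi_mul_swap {μ : ℂ} (hμ : μ ∉ L.lattice) {i j : Fin n} (hij : i ≠ j) :
    ellPhi L μ i j * ellPhi L μ j i = algebraMap ℂ (Mer n) (L.weierstrassP μ) - ellP L i j := by
  have hP : Represents (ellP L i j) fun x => L.weierstrassP (x i - x j) := by
    rw [ellP_eq L hij]
    exact represents_weierstrassP_sub L hij
  have h := (represents_ellPhi L μ i j).mul (represents_ellPhi L μ j i)
  have h2 := (represents_const (n := n) (L.weierstrassP μ)).add hP.neg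
  rw [← sub_eq_add_neg] at h2
  refine (h.congr (sigmaDiff_ne_zero L hij) fun x hx => ?_).unique h2
  rw [← sub_eq_add_neg, ← phi_mul_phi_neg L hμ (notMem_of_sigmaDiff_ne_zero L hx), neg_sub]

/-- The numerator `σ'(z - μ) σ(z) - σ(z - μ) σ'(z)` of the derivative of `σ(z - μ) / σ(z)`, at
`z = x_a - x_b`. -/
def sigmaWronskian (μ : ℂ) (a b : Fin n) : Entire n :=
  diffEntire ((differentiable_deriv_weierstrassSigma L).comp (differentiable_id.sub_const μ)) a b *
    sigmaDiff L a b -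
  sigmaShift L μ a b * diffEntire (differentiable_deriv_weierstrassSigma L) a b

theorem pd_ellPhi (μ : ℂ) {a b : Fin n} (hab : a ≠ b) (k : Fin n) :
    pd k (ellPhi L μ a b) =
      ((Pi.single k 1 : Fin n → ℂ) a - (Pi.single k 1 : Fin n → ℂ) b) •
        (weierstrassSigma L (-μ))⁻¹ • (algebraMap (Entire n) (Mer n) (sigmaWronskian L μ a b) /
          algebraMap (Entire n) (Mer n) (sigmaDiff L a b) ^ 2) := by
  have hd : deriv (weierstrassSigma L ∘ fun z => id z - μ) =
      deriv (weierstrassSigma L) ∘ fun z => id z - μ := by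
    ext1 z
    exact deriv_comp_sub_const (f := weierstrassSigma L) μ z
  have hg' : Differentiable ℂ (deriv (weierstrassSigma L ∘ fun z => id z - μ)) := by
    rw [hd]
    exact (differentiable_deriv_weierstrassSigma L).comp (differentiable_id.sub_const μ)
  have h := pd_diffQuot ((differentiable_weierstrassSigma L).comp (differentiable_id.sub_const μ))
    (differentiable_weierstrassSigma L) hg' (differentiable_deriv_weierstrassSigma L) k a b
  have e : diffEntire hg' a b = diffEntire ((differentiable_deriv_weierstrassSigma L).comp
      (differentiable_id.sub_const μ)) a b :=
    Subtype.ext (funext fun x => congrFun hd (x a - x b))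
  rw [ellPhi_eq L μ hab, Derivation.map_smul, smul_comm]
  rw [e] at h
  refine congrArg _ (h.trans ?_)
  rw [sigmaWronskian, map_sub, map_mul, map_mul]
  rfl

theorem ellDunkl_eq_dunklOp (ħ κ : ℂ) (v : Fin n → ℂ) (i : Fin n) :
    ellDunkl L ħ κ v i = dunklOp κ (fun i => ħ • dOp i)
      (fun i j a b => mulOp (ellPhi L (v i - v j) a b)) i := rfl

theorem smul_smul_dOp (ħ : ℂ) (w : Equiv.Perm (Fin n)) (i : Fin n) :
    w • (ħ • dOp i : DiffOp n) = ħ • dOp (w i) := by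
  rw [smul_comm, smul_dOp]

theorem mulOp_ellPhi_neg (μ ν : ℂ) (h : ν = -μ) (a b : Fin n) :
    mulOp (ellPhi L ν b a) = -mulOp (ellPhi L μ a b) := by
  rw [h, ellPhi_neg]
  exact map_neg mulOpHom _

/-- The three-term relation for the coefficients of the elliptic Dunkl operators. -/
theorem mulOp_ellPhi_three_term {v : Fin n → ℂ} (hv : v ∈ generic n L) {i j l : Fin n}
    (hij : i ≠ j) (hil : i ≠ l) (hjl : j ≠ l) :
    mulOp (ellPhi L (v i - v j) i j) * mulOp (ellPhi L (v j - v l) i l) =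
      mulOp (ellPhi L (v i - v l) i l) * mulOp (ellPhi L (v i - v j) l j) +
        mulOp (ellPhi L (v j - v l) j l) * mulOp (ellPhi L (v i - v l) i j) := by
  have h := ellPhi_three_term L (show (v i - v j) + (v l - v i) + (v j - v l) = 0 by ring)
    (hv i j hij) (hv l i hil.symm) (hv j l hjl) hij hil hjl
  rw [ellPhi_neg L _ i l, ← neg_sub (v i) (v l), neg_neg, ellPhi_neg L _ i l, ellPhi_neg L _ l j]
    at h
  have h2 := congrArg mulOpHom h
  simp only [map_add, map_mul, map_neg, map_zero, mulOpHom_apply] at h2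
  rw [← sub_eq_zero, ← neg_eq_zero, ← h2]
  noncomm_ring

theorem commute_mulOp (f g : Mer n) : mulOp f * mulOp g = mulOp g * mulOp f := by
  simp only [← mulOpHom_apply, ← map_mul, mul_comm]

theorem pdEntire_comm (i j : Fin n) (f : Entire n) :
    pdEntire i (pdEntire j f) = pdEntire j (pdEntire i f) := by
  apply Subtype.ext
  funext x
  have h : ∀ e e' : Fin n → ℂ, fderiv ℂ (fun y => fderiv ℂ f.1 y e) x e' =
      fderiv ℂ (fderiv ℂ f.1) x e' e := by
    intro e e'
    have h1 := (AnalyticAt.fderiv (f.2 x)).differentiableAt.hasFDerivAt.clm_apply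
      (hasFDerivAt_const e x)
    rw [h1.fderiv]
    simp
  change fderiv ℂ (fun y => fderiv ℂ f.1 y (Pi.single j 1)) x (Pi.single i 1) =
    fderiv ℂ (fun y => fderiv ℂ f.1 y (Pi.single i 1)) x (Pi.single j 1)
  rw [h, h]
  exact ((f.2 x).contDiffAt.isSymmSndFDerivAt le_top) _ _

theorem pd_comm (i j : Fin n) (f : Mer n) : pd i (pd j f) = pd j (pd i f) := by
  have h : ⁅pd i, pd j⁆ f = 0 := by
    have h0 : ∀ a : Entire n, ⁅pd i, pd j⁆ (algebraMap (Entire n) (Mer n) a) = 0 := by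
      intro a
      rw [Derivation.commutator_apply, pd_algebraMap, pd_algebraMap, pd_algebraMap, pd_algebraMap,
        pdEntire_comm, sub_self]
    obtain ⟨a, b, hb, rfl⟩ := IsFractionRing.div_surjective (A := Entire n) f
    rw [Derivation.leibniz_div, h0, h0, smul_zero, smul_zero, sub_zero, smul_zero]
  rw [Derivation.commutator_apply] at h
  exact sub_eq_zero.mp h

theorem commute_dOp (i j : Fin n) : (dOp i * dOp j : DiffOp n) = dOp j * dOp i := by
  exact Subtype.ext (LinearMap.ext fun f => pd_comm i j f)

theorem commute_ellDunkl (ħ κ : ℂ) {v : Fin n → ℂ} (hv : v ∈ generic n L) (i j : Fin n) :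
    Commute (ellDunkl L ħ κ v i) (ellDunkl L ħ κ v j) := by
  simp only [ellDunkl_eq_dunklOp]
  refine commute_dunklOp κ _ _ (smul_smul_dOp ħ)
    (fun w i j a b => by rw [smul_mulOp, permMer_ellPhi])
    (fun i a => by rw [ellPhi_diag]; exact map_zero mulOpHom)
    (fun i j a b => mulOp_ellPhi_neg L _ _ (neg_sub _ _).symm a b)
    (fun _ _ _ _ _ _ _ _ => commute_mulOp _ _)
    (fun i j l => mulOp_ellPhi_three_term L hv) (fun i j => ?_) (fun l i j hi hj => ?_)
    (fun i j hij => ?_) i j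
  · simp only [smul_mul_assoc, mul_smul_comm, commute_dOp i j]
  · by_cases hij : i = j
    · subst hij
      rw [ellPhi_diag, show mulOp (0 : Mer n) = 0 from map_zero mulOpHom, mul_zero, zero_mul]
    · rw [smul_mul_assoc, mul_smul_comm, dOp_mul_mulOp, pd_ellPhi L _ hij,
        Pi.single_eq_of_ne hi.symm, Pi.single_eq_of_ne hj.symm, sub_zero, zero_smul,
        show mulOp (0 : Mer n) = 0 from map_zero mulOpHom, add_zero]
  · rw [← smul_add, smul_mul_assoc, mul_smul_comm, add_mul, dOp_mul_mulOp, dOp_mul_mulOp,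
      pd_ellPhi L _ hij, pd_ellPhi L _ hij, Pi.single_eq_same, Pi.single_eq_same,
      Pi.single_eq_of_ne hij, Pi.single_eq_of_ne hij.symm, zero_sub, sub_zero, one_smul, neg_smul,
      one_smul, ← mulOpHom_apply, ← mulOpHom_apply, ← mulOpHom_apply, map_neg, mul_add]
    congr 1
    abel

/-- Equivariance of the elliptic Dunkl operators. -/
theorem single_mul_ellDunkl (ħ κ : ℂ) (v : Fin n → ℂ) (w : Equiv.Perm (Fin n)) (i : Fin n) :
    single w 1 * ellDunkl L ħ κ v i = ellDunkl L ħ κ (fun j => v (w.symm j)) (w i) *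
      single w 1 := by
  refine single_mul_dunklOp κ (fun i => ħ • dOp i) (fun i j a b => mulOp (ellPhi L (v i - v j) a b))
    (fun i j a b => mulOp (ellPhi L (v (w.symm i) - v (w.symm j)) a b)) (smul_smul_dOp ħ) w
    (fun i j => ?_) i
  rw [smul_mulOp, permMer_ellPhi, Equiv.symm_apply_apply, Equiv.symm_apply_apply]

end Elliptic

/-! ### Poles of the elliptic Dunkl operators in the spectral parameters -/

section Poles

open SkewMonoidAlgebra (single single_mul_single single_add single_zero single_neg smul_single)

variable {n : ℕ} (L : PeriodPair)

/-- The spectral parameters `v` for which no `v_i - v_j` is a nonzero period. -/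
def regSet (n : ℕ) (L : PeriodPair) : Set (Fin n → ℂ) :=
  {v | ∀ i j, v i - v j ∈ ((L.lattice \ {0} : Set ℂ)ᶜ)}

/-- The points of `regSet n L` outside the hyperplanes `v_k = v_l` other than `v_i = v_j`. -/
def pairSet (L : PeriodPair) (i j : Fin n) : Set (Fin n → ℂ) :=
  {v | v ∈ regSet n L ∧ ∀ k l, k ≠ l → s(k, l) ≠ s(i, j) → v k ≠ v l}

theorem zero_mem_regSet : (0 : Fin n → ℂ) ∈ regSet n L := fun i j => by simp

theorem isOpen_regSet : IsOpen (regSet n L) := by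
  simp only [regSet, Set.ofPred_forall]
  exact isOpen_iInter_of_finite fun i => isOpen_iInter_of_finite fun j =>
    (isOpen_compl_nonzero_lattice L).preimage ((continuous_apply i).sub (continuous_apply j))

theorem isOpen_pairSet (i j : Fin n) : IsOpen (pairSet L i j) := by
  have : pairSet L i j = regSet n L ∩ ⋂ (k : Fin n), ⋂ (l : Fin n), ⋂ (_ : k ≠ l),
      ⋂ (_ : s(k, l) ≠ s(i, j)), {v : Fin n → ℂ | v k ≠ v l} := by
    ext v
    simp [pairSet]
  rw [this]
  refine (isOpen_regSet L).inter ?_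
  exact isOpen_iInter_of_finite fun k => isOpen_iInter_of_finite fun l =>
    isOpen_iInter_of_finite fun _ => isOpen_iInter_of_finite fun _ =>
      isOpen_ne_fun (continuous_apply k) (continuous_apply l)

variable {L}

theorem pairSet_subset_regSet (i j : Fin n) : pairSet L i j ⊆ regSet n L := fun _ h => h.1

theorem ne_of_generic {v : Fin n → ℂ} (hv : v ∈ generic n L) {i j : Fin n} (hij : i ≠ j) :
    v i ≠ v j := fun h => hv i j hij (by rw [h, sub_self]; exact zero_mem _)

theorem mem_generic_iff {v : Fin n → ℂ} :
    v ∈ generic n L ↔ v ∈ regSet n L ∧ ∀ k l, k ≠ l → v k ≠ v l := by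
  refine ⟨fun hv => ⟨fun i j h => ?_, fun k l => ne_of_generic hv⟩, fun h i j hij hm => ?_⟩
  · by_cases hij : i = j
    · exact h.2 (by simp [hij])
    · exact hv i j hij h.1
  · exact h.1 i j ⟨hm, sub_ne_zero.mpr (h.2 i j hij)⟩

theorem generic_subset_pairSet (i j : Fin n) : generic n L ⊆ pairSet L i j := fun _ hv =>
  ⟨(mem_generic_iff.mp hv).1, fun k l h _ => (mem_generic_iff.mp hv).2 k l h⟩

theorem generic_subset_regSet : generic n L ⊆ regSet n L := fun _ hv => (mem_generic_iff.mp hv).1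

/-- A small perturbation in the direction `e` separates the coordinates separated by `e`. -/
theorem eventually_separated (v e : Fin n → ℂ) (k l : Fin n) (h : v k ≠ v l ∨ e k ≠ e l) :
    ∀ᶠ t : ℂ in nhdsWithin 0 {0}ᶜ, (v + t • e) k ≠ (v + t • e) l := by
  by_cases hv : v k = v l
  · have he := h.resolve_left (not_not.mpr hv)
    filter_upwards [self_mem_nhdsWithin] with t ht h1
    simp only [Pi.add_apply, Pi.smul_apply, smul_eq_mul, hv, add_right_inj] at h1
    exact he (mul_left_cancel₀ ht h1)
  · have hc : ContinuousAt (fun t : ℂ => (v + t • e) k - (v + t • e) l) 0 := by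
      simp only [Pi.add_apply, Pi.smul_apply]
      fun_prop
    have := (hc.eventually_ne (by simpa using sub_ne_zero.mpr hv)).filter_mono
      (nhdsWithin_le_nhds (s := {0}ᶜ))
    filter_upwards [this] with t ht
    exact sub_ne_zero.mp ht

/-- Points of the line `v + t e`, `t ≠ 0`, accumulate at `v`. -/
theorem frequently_of_eventually_path {p : (Fin n → ℂ) → Prop} (v e : Fin n → ℂ)
    (h : ∀ᶠ t : ℂ in nhdsWithin 0 {0}ᶜ, p (v + t • e)) : ∃ᶠ u in nhds v, p u := by
  have ht : Filter.Tendsto (fun t : ℂ => v + t • e) (nhdsWithin 0 {0}ᶜ) (nhds v) := by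
    have : ContinuousAt (fun t : ℂ => v + t • e) 0 := by fun_prop
    have h2 := this.tendsto
    rw [zero_smul, add_zero] at h2
    exact h2.mono_left nhdsWithin_le_nhds
  exact ht.frequently h.frequently

theorem eventually_path_mem {W : Set (Fin n → ℂ)} (hW : IsOpen W) {v : Fin n → ℂ} (hv : v ∈ W)
    (e : Fin n → ℂ) : ∀ᶠ t : ℂ in nhdsWithin 0 {0}ᶜ, v + t • e ∈ W := by
  have : ContinuousAt (fun t : ℂ => v + t • e) 0 := by fun_prop
  exact (this.eventually_mem (hW.mem_nhds (by simpa using hv))).filter_mono nhdsWithin_le_nhds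

/-- The generic points accumulate at each point of an open subset of `regSet n L`. -/
theorem frequently_generic {W : Set (Fin n → ℂ)} (hW : IsOpen W) (hWr : W ⊆ regSet n L)
    {v : Fin n → ℂ} (hv : v ∈ W) : ∃ᶠ u in nhds v, u ∈ W ∧ u ∈ generic n L := by
  refine frequently_of_eventually_path v (fun k => ((k : ℕ) : ℂ)) ?_
  have h : ∀ᶠ t : ℂ in nhdsWithin 0 {0}ᶜ, ∀ k l : Fin n, k ≠ l →
      (v + t • fun k : Fin n => ((k : ℕ) : ℂ)) k ≠ (v + t • fun k : Fin n => ((k : ℕ) : ℂ)) l := by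
    rw [Filter.eventually_all]
    intro k
    rw [Filter.eventually_all]
    intro l
    by_cases hkl : k = l
    · exact Filter.Eventually.of_forall fun t h => absurd hkl h
    · filter_upwards [eventually_separated v (fun k => ((k : ℕ) : ℂ)) k l
        (Or.inr (by simpa [Fin.ext_iff] using hkl))] with t ht _ using ht
  filter_upwards [h, eventually_path_mem hW hv _] with t h1 h2
  exact ⟨h2, mem_generic_iff.mpr ⟨hWr h2, h1⟩⟩

/-- Near a point of `v_i = v_j` in `regSet n L` there are points of `v_i = v_j` on no other
reflection hyperplane. -/
theorem frequently_pairSet {i j : Fin n} {v : Fin n → ℂ} (hv : v ∈ regSet n L)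
    (hvij : v i = v j) : ∃ᶠ u in nhds v, u ∈ pairSet L i j ∧ u i = u j := by
  -- a direction with `e_i = e_j` and no other coincidences
  set e : Fin n → ℂ := fun k => if k = j then ((i : ℕ) : ℂ) else ((k : ℕ) : ℂ) with he
  refine frequently_of_eventually_path v e ?_
  have hsep : ∀ k l, k ≠ l → s(k, l) ≠ s(i, j) → e k ≠ e l := by
    intro k l hkl hs
    simp only [ne_eq, Sym2.eq_iff, not_or, not_and] at hs
    simp only [he]
    split_ifs with h1 h2 h2
    · exact absurd (h1.trans h2.symm) hkl
    · simp only [ne_eq, Nat.cast_inj, ← Fin.ext_iff]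
      exact fun h => hs.2 h1 h.symm
    · simp only [ne_eq, Nat.cast_inj, ← Fin.ext_iff]
      exact fun h => hs.1 h h2
    · simpa only [ne_eq, Nat.cast_inj, ← Fin.ext_iff] using hkl
  have heij : e i = e j := by simp [he]
  have h : ∀ᶠ t : ℂ in nhdsWithin 0 {0}ᶜ, ∀ k l : Fin n, k ≠ l → s(k, l) ≠ s(i, j) →
      (v + t • e) k ≠ (v + t • e) l := by
    rw [Filter.eventually_all]
    intro k
    rw [Filter.eventually_all]
    intro l
    by_cases hkl : k ≠ l ∧ s(k, l) ≠ s(i, j)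
    · filter_upwards [eventually_separated v e k l (Or.inr (hsep k l hkl.1 hkl.2))] with t ht _ _
        using ht
    · exact Filter.Eventually.of_forall fun t h1 h2 => absurd ⟨h1, h2⟩ hkl
  filter_upwards [h, eventually_path_mem (isOpen_regSet L) hv e] with t h1 h2
  refine ⟨⟨h2, h1⟩, ?_⟩
  simp only [Pi.add_apply, Pi.smul_apply, hvij, heij]

theorem mer_smul_single (g : Mer n) (w : Equiv.Perm (Fin n)) :
    (single w (mulOp g) : Crossed n) = g • single w 1 := by
  rw [mer_smul_def, merHom_apply, single_mul_single, one_smul, mul_one, one_mul]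

theorem single_mul_mer_smul (w : Equiv.Perm (Fin n)) (g : Mer n) (P : Crossed n) :
    single w 1 * g • P = permMer w g • (single w 1 * P) := by
  rw [mer_smul_def, mer_smul_def, ← mul_assoc, ← mul_assoc, merHom_apply, merHom_apply,
    single_mul_single, single_mul_single, smul_mulOp, one_smul, one_mul, mul_one, mul_one,
    one_mul]

instance : IsScalarTower ℂ (Mer n) (Crossed n) where
  smul_assoc c g P := by
    rw [← algebraMap_smul_crossed c, smul_smul, ← Algebra.smul_def]

variable (L)

/-- The term `φ(v_i - v_j, x_i - x_j) s_{ij}` of a Dunkl operator. -/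
def phiTerm (i j : Fin n) (v : Fin n → ℂ) : Crossed n :=
  single (Equiv.swap i j) (mulOp (ellPhi L (v i - v j) i j))

/-- The numerator of `(v_i - v_j) φ(v_i - v_j, x_i - x_j)`, with denominator `σ(x_i - x_j)`. -/
def psiCoeff (i j : Fin n) (v : Fin n → ℂ) : Entire n :=
  algebraMap ℂ (Entire n) (-(sigmaProd L (v i - v j))⁻¹) * sigmaShift L (v i - v j) i j

/-- The continuation of `(v_i - v_j) φ(v_i - v_j, x_i - x_j) s_{ij}` to `v_i = v_j`. -/
def psiTerm (i j : Fin n) (v : Fin n → ℂ) : Crossed n :=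
  algebraMap (Entire n) (Mer n) (psiCoeff L i j v) •
    (algebraMap (Entire n) (Mer n) (sigmaDiff L i j))⁻¹ • single (Equiv.swap i j) 1

theorem sigmaProd_ne_zero_of_regSet {v : Fin n → ℂ} (hv : v ∈ regSet n L) (i j : Fin n) :
    sigmaProd L (v i - v j) ≠ 0 := by
  refine sigmaProd_ne_zero L ?_
  by_contra! h
  exact hv i j h

theorem analyticAt_sub_apply (i j : Fin n) (v : Fin n → ℂ) :
    AnalyticAt ℂ (fun v : Fin n → ℂ => v i - v j) v :=
  ((ContinuousLinearMap.proj (R := ℂ) (φ := fun _ : Fin n => ℂ) i -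
        ContinuousLinearMap.proj (R := ℂ) (φ := fun _ : Fin n => ℂ) j)).analyticAt v

theorem isAnalyticFamily_shift {g : ℂ → ℂ} (hg : Differentiable ℂ g) {W : Set (Fin n → ℂ)}
    (i j a b : Fin n) : IsAnalyticFamily W fun v : Fin n → ℂ =>
      diffEntire (hg.comp (differentiable_id.sub_const (v i - v j))) a b := fun v _ x => by
  have h : AnalyticAt ℂ (fun p : (Fin n → ℂ) × (Fin n → ℂ) =>
      (p.2 a - p.2 b) - (p.1 i - p.1 j)) (v, x) :=
    ((analyticAt_sub_apply a b x).comp (f := Prod.snd) (x := (v, x)) analyticAt_snd).sub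
      ((analyticAt_sub_apply i j v).comp (f := Prod.fst) (x := (v, x)) analyticAt_fst)
  exact (hg.analyticAt _).comp (f := fun p : (Fin n → ℂ) × (Fin n → ℂ) =>
      (p.2 a - p.2 b) - (p.1 i - p.1 j)) h

theorem isAnalyticFamily_psiCoeff {W : Set (Fin n → ℂ)} (hW : W ⊆ regSet n L) (i j : Fin n) :
    IsAnalyticFamily W (psiCoeff L i j) := by
  refine IsAnalyticFamily.mul (isAnalyticFamily_scalar fun v hv => ?_)
    (isAnalyticFamily_shift (differentiable_weierstrassSigma L) i j i j)
  have h : AnalyticAt ℂ (fun v : Fin n → ℂ => sigmaProd L (v i - v j)) v :=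
    ((differentiable_sigmaProd L).analyticAt _).comp (f := fun v : Fin n → ℂ => v i - v j)
      (analyticAt_sub_apply i j v)
  exact (h.inv (sigmaProd_ne_zero_of_regSet L (hW hv) i j)).neg

theorem psiTerm_mem_fam {W : Set (Fin n → ℂ)} (hW : W ⊆ regSet n L) (i j : Fin n) :
    psiTerm L i j ∈ fam W := coeff_smul_mem_fam (isAnalyticFamily_psiCoeff L hW i j) _

theorem smul_phiTerm {v : Fin n → ℂ} {i j : Fin n} (hij : i ≠ j) (hv : v i ≠ v j) :
    (v i - v j) • phiTerm L i j v = psiTerm L i j v := by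
  rw [phiTerm, mer_smul_single, ellPhi_eq L _ hij, psiTerm, psiCoeff, ← smul_assoc, ← mul_smul,
    smul_smul, map_mul, ← IsScalarTower.algebraMap_apply, ← Algebra.smul_def, smul_mul_assoc,
    div_eq_mul_inv]
  congr 2
  rw [weierstrassSigma_eq, sigmaProd_neg, mul_inv, ← mul_assoc, inv_neg, mul_neg,
    mul_inv_cancel₀ (sub_ne_zero.mpr hv), neg_one_mul]

theorem phiTerm_eq {v : Fin n → ℂ} (hv : v ∈ generic n L) {i j : Fin n} (hij : i ≠ j) :
    phiTerm L i j v = (v i - v j)⁻¹ • psiTerm L i j v := by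
  have h := ne_of_generic hv hij
  rw [← smul_phiTerm L hij h, smul_smul, inv_mul_cancel₀ (sub_ne_zero.mpr h), one_smul]

/-- The residue of `φ(μ, z)` at `μ = 0` is `-1`. -/
theorem psiTerm_of_eq {v : Fin n → ℂ} {i j : Fin n} (hij : i ≠ j) (hv : v i = v j) :
    psiTerm L i j v = -single (Equiv.swap i j) 1 := by
  rw [psiTerm, psiCoeff, hv, sub_self, sigmaShift_zero, sigmaProd_zero, inv_one, map_mul,
    ← IsScalarTower.algebraMap_apply, smul_smul, mul_assoc,
    mul_inv_cancel₀ (algebraMap_entire_ne_zero (sigmaDiff_ne_zero L hij)), mul_one, map_neg,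
      map_one,
    neg_smul, one_smul]

theorem single_mul_psiTerm (w : Equiv.Perm (Fin n)) (i j : Fin n) (v : Fin n → ℂ) :
    single w 1 * psiTerm L i j v =
      psiTerm L (w i) (w j) (fun k => v (w.symm k)) * single w 1 := by
  rw [psiTerm, psiTerm, single_mul_mer_smul, single_mul_mer_smul, mer_smul_mul, mer_smul_mul,
    map_inv₀, permMer_algebraMap, permMer_algebraMap, single_mul_single, single_mul_single,
    Equiv.mul_swap_eq_swap_mul, smul_one, smul_one]
  have h : permEntire w (psiCoeff L i j v) = psiCoeff L (w i) (w j) fun k => v (w.symm k) := by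
    rw [psiCoeff, psiCoeff, map_mul, AlgHom.commutes, Equiv.symm_apply_apply,
      Equiv.symm_apply_apply]
    rfl
  rw [h]
  rfl

theorem ellDunkl_eq (ħ κ : ℂ) (v : Fin n → ℂ) (i : Fin n) :
    ellDunkl L ħ κ v i =
      single 1 (ħ • dOp i) - κ • ∑ j ∈ Finset.univ.erase i, phiTerm L i j v := rfl

theorem phiTerm_swap (i j : Fin n) (v : Fin n → ℂ) : phiTerm L j i v = -phiTerm L i j v := by
  rw [phiTerm, mulOp_ellPhi_neg L (v i - v j) (v j - v i) (neg_sub _ _).symm, single_neg,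
    Equiv.swap_comm, phiTerm]

theorem phiTerm_self (i : Fin n) (v : Fin n → ℂ) : phiTerm L i i v = 0 := by
  rw [phiTerm, ellPhi_diag, show mulOp (0 : Mer n) = 0 from map_zero mulOpHom, single_zero]

/-- `φ(μ, z) φ(μ, -z) = ℘(μ) - ℘(z)`. -/
theorem phiTerm_sq {v : Fin n → ℂ} (hv : v ∈ generic n L) {i j : Fin n} (hij : i ≠ j) :
    phiTerm L i j v * phiTerm L i j v =
      algebraMap ℂ (Crossed n) (L.weierstrassP (v i - v j)) - merHom (ellP L i j) := by
  rw [phiTerm, single_mul_single, Equiv.swap_mul_self, smul_mulOp, permMer_ellPhi,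
    Equiv.swap_apply_left, Equiv.swap_apply_right]
  simp only [← mulOpHom_apply]
  rw [← map_mul, ellPhi_mul_swap L (hv i j hij) hij, ← merHom_algebraMap, ← map_sub]
  rfl

/-- The part of the Dunkl operator `y_i` with the reflections `s_{il}`, `l ∈ s`. -/
def dunklPart (ħ κ : ℂ) (i : Fin n) (s : Finset (Fin n)) (v : Fin n → ℂ) : Crossed n :=
  single 1 (ħ • dOp i) - κ • ∑ l ∈ s, (v i - v l)⁻¹ • psiTerm L i l v

theorem dunklPart_mem_fam (ħ κ : ℂ) {W : Set (Fin n → ℂ)} (hW : W ⊆ regSet n L) (i : Fin n)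
    (s : Finset (Fin n)) (hs : ∀ l ∈ s, ∀ v ∈ W, v i ≠ v l) : dunklPart L ħ κ i s ∈ fam W := by
  have h1 : (fun v => κ • ∑ l ∈ s, (v i - v l)⁻¹ • psiTerm L i l v) ∈ fam W := by
    have h2 : (∑ l ∈ s, fun v : Fin n → ℂ => (v i - v l)⁻¹ • psiTerm L i l v) ∈ fam W :=
      sum_mem fun l hl => scalar_smul_mem_fam (fun v hv =>
        (analyticAt_sub_apply i l v).inv (sub_ne_zero.mpr (hs l hl v hv)))
        (psiTerm_mem_fam L hW i l)
    convert! (fam W).smul_mem h2 κ using 1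
    ext1 v
    rw [Pi.smul_apply, Finset.sum_apply]
  exact sub_mem (const_mem_fam (single 1 (ħ • dOp i))) h1

theorem sum_phiTerm_eq {v : Fin n → ℂ} (hv : v ∈ generic n L) {i : Fin n} {s : Finset (Fin n)}
    (hs : i ∉ s) : ∑ l ∈ s, phiTerm L i l v = ∑ l ∈ s, (v i - v l)⁻¹ • psiTerm L i l v :=
  Finset.sum_congr rfl fun _ hl => phiTerm_eq L hv fun h => hs (h ▸ hl)

theorem ellDunkl_eq_dunklPart (ħ κ : ℂ) {v : Fin n → ℂ} (hv : v ∈ generic n L) (i : Fin n) :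
    ellDunkl L ħ κ v i = dunklPart L ħ κ i (Finset.univ.erase i) v := by
  rw [ellDunkl_eq, sum_phiTerm_eq L hv (by simp), dunklPart]

theorem ellDunkl_eq_dunklPart_sub (ħ κ : ℂ) {v : Fin n → ℂ} (hv : v ∈ generic n L) {i j : Fin n}
    (hij : i ≠ j) : ellDunkl L ħ κ v i =
      dunklPart L ħ κ i ((Finset.univ.erase i).erase j) v - κ • phiTerm L i j v := by
  rw [ellDunkl_eq, ← Finset.add_sum_erase _ _ (Finset.mem_erase.mpr ⟨hij.symm, Finset.mem_univ j⟩),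
    sum_phiTerm_eq L hv (by simp), dunklPart, smul_add]
  abel

/-- Equivariance of the partial Dunkl operators; it also holds at non-generic points. -/
theorem single_mul_dunklPart (ħ κ : ℂ) (w : Equiv.Perm (Fin n)) (i : Fin n) (s : Finset (Fin n))
    (v : Fin n → ℂ) : single w 1 * dunklPart L ħ κ i s v =
      dunklPart L ħ κ (w i) (s.map w.toEmbedding) (fun k => v (w.symm k)) * single w 1 := by
  rw [dunklPart, dunklPart, mul_sub, sub_mul, single_mul_single, single_mul_single, smul_smul_dOp,
    mul_one, one_mul, one_mul, one_smul, mul_one, mul_smul_comm, smul_mul_assoc,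
    Finset.mul_sum, Finset.sum_mul, Finset.sum_map]
  congr 2
  refine Finset.sum_congr rfl fun l _ => ?_
  rw [mul_smul_comm, smul_mul_assoc, single_mul_psiTerm, Equiv.symm_apply_apply,
    Equiv.toEmbedding_apply, Equiv.symm_apply_apply]

end Poles

/-! ### Regularity of the substituted Hamiltonians -/

section Regularity

open SkewMonoidAlgebra (single single_mul_single single_add single_zero single_neg smul_single)

variable {n : ℕ} (L : PeriodPair) (ħ κ : ℂ)

theorem exists_substHom_generic {v : Fin n → ℂ} (hv : v ∈ generic n L) :
    ∃ E : regularObs v →ₐ[ℂ] Crossed n,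
      (∀ f : regularObs v, E f = substDunkl L ħ κ f v) ∧
      (∀ g ∈ regularAt v, substDunkl L ħ κ (cl g) v = algebraMap ℂ _ (valueAt v g)) ∧
      (∀ i, substDunkl L ħ κ (mom i) v = ellDunkl L ħ κ v i) :=
  exists_substHom L ħ κ v (commute_ellDunkl L ħ κ hv)

variable {L}

theorem cl_recip_mem_regularObs {v : Fin n → ℂ} (hv : v ∈ generic n L) (a b : Fin n) :
    cl (recip a b) ∈ regularObs v := cl_mem_regularObs (recip_mem_regularAt (ne_of_generic hv))

theorem clDiff_mem_regularObs (v : Fin n → ℂ) (a b : Fin n) : clDiff a b ∈ regularObs v :=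
  cl_mem_regularObs (entire_mem_regularAt v _)

theorem recipAlg_le_regularObs {v : Fin n → ℂ} (hv : v ∈ generic n L) :
    recipAlg n ≤ regularObs v := by
  refine Algebra.adjoin_le ?_
  rintro f (⟨a, b, rfl⟩ | ⟨i, rfl⟩)
  · exact cl_recip_mem_regularObs hv a b
  · exact mom_mem_regularObs v i

theorem pairAlg_le_regularObs {v : Fin n → ℂ} (hv : v ∈ generic n L) (i j : Fin n) :
    pairAlg κ i j ≤ regularObs v := by
  refine Algebra.adjoin_le fun f hf => ?_
  have hm := mom_mem_regularObs v
  cases hf with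
  | diff => exact clDiff_mem_regularObs v i j
  | recip a b _ => exact cl_recip_mem_regularObs hv a b
  | mom k _ _ => exact hm k
  | momAdd => exact add_mem (hm i) (hm j)
  | diffMul => exact mul_mem (clDiff_mem_regularObs v i j) (sub_mem (hm i) (hm j))
  | quad =>
    exact sub_mem (pow_mem (sub_mem (hm i) (hm j)) 2)
      ((regularObs v).smul_mem (pow_mem (cl_recip_mem_regularObs hv i j) 2) _)

section Hom

variable {v : Fin n → ℂ} {f g : ClassObs n}

theorem substDunkl_add (hv : v ∈ generic n L)
    (hf : f ∈ regularObs v) (hg : g ∈ regularObs v) :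
    substDunkl L ħ κ (f + g) v = substDunkl L ħ κ f v + substDunkl L ħ κ g v := by
  obtain ⟨E, h, -, -⟩ := exists_substHom_generic L ħ κ hv
  have := map_add E ⟨f, hf⟩ ⟨g, hg⟩
  rwa [h, h, h] at this

theorem substDunkl_sub (hv : v ∈ generic n L)
    (hf : f ∈ regularObs v) (hg : g ∈ regularObs v) :
    substDunkl L ħ κ (f - g) v = substDunkl L ħ κ f v - substDunkl L ħ κ g v := by
  obtain ⟨E, h, -, -⟩ := exists_substHom_generic L ħ κ hv
  have := map_sub E ⟨f, hf⟩ ⟨g, hg⟩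
  rwa [h, h, h] at this

theorem substDunkl_mul (hv : v ∈ generic n L)
    (hf : f ∈ regularObs v) (hg : g ∈ regularObs v) :
    substDunkl L ħ κ (f * g) v = substDunkl L ħ κ f v * substDunkl L ħ κ g v := by
  obtain ⟨E, h, -, -⟩ := exists_substHom_generic L ħ κ hv
  have := map_mul E ⟨f, hf⟩ ⟨g, hg⟩
  rwa [h, h, h] at this

theorem substDunkl_pow (hv : v ∈ generic n L) (hf : f ∈ regularObs v) (m : ℕ) :
    substDunkl L ħ κ (f ^ m) v = substDunkl L ħ κ f v ^ m := by
  obtain ⟨E, h, -, -⟩ := exists_substHom_generic L ħ κ hv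
  have := map_pow E ⟨f, hf⟩ m
  rwa [h, h] at this

theorem substDunkl_smul (hv : v ∈ generic n L) (hf : f ∈ regularObs v) (c : ℂ) :
    substDunkl L ħ κ (c • f) v = c • substDunkl L ħ κ f v := by
  obtain ⟨E, h, -, -⟩ := exists_substHom_generic L ħ κ hv
  have := map_smul E c ⟨f, hf⟩
  rwa [h, h] at this

theorem substDunkl_sum (hv : v ∈ generic n L)
    {ι : Type*} (s : Finset ι) (F : ι → ClassObs n)
    (hf : ∀ i, F i ∈ regularObs v) :
    substDunkl L ħ κ (∑ i ∈ s, F i) v = ∑ i ∈ s, substDunkl L ħ κ (F i) v := by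
  obtain ⟨E, h, -, -⟩ := exists_substHom_generic L ħ κ hv
  have := map_sum E (fun i => ⟨F i, hf i⟩) s
  simp only [h] at this
  rw [← this]
  congr 1
  exact (map_sum (regularObs v).val (fun i => (⟨F i, hf i⟩ : regularObs v)) s).symm

theorem substDunkl_algebraMap (hv : v ∈ generic n L) (c : ℂ) :
    substDunkl L ħ κ (algebraMap ℂ (ClassObs n) c) v = algebraMap ℂ _ c := by
  obtain ⟨E, h, -, -⟩ := exists_substHom_generic L ħ κ hv
  have := E.commutes c
  rwa [h] at this

theorem substDunkl_clDiff (hv : v ∈ generic n L) (a b : Fin n) :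
    substDunkl L ħ κ (clDiff a b) v = algebraMap ℂ _ (v a - v b) := by
  obtain ⟨E, -, h, -⟩ := exists_substHom_generic L ħ κ hv
  rw [clDiff, h _ (entire_mem_regularAt v _), valueAt_entire]
  rfl

theorem substDunkl_recip (hv : v ∈ generic n L) {a b : Fin n} (hab : a ≠ b) :
    substDunkl L ħ κ (cl (recip a b)) v = algebraMap ℂ _ (v a - v b)⁻¹ := by
  obtain ⟨E, -, h, -⟩ := exists_substHom_generic L ħ κ hv
  rw [h _ (recip_mem_regularAt (ne_of_generic hv)), valueAt_recip (ne_of_generic hv hab), one_div]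

theorem substDunkl_recip_self (hv : v ∈ generic n L) (a : Fin n) :
    substDunkl L ħ κ (cl (recip a a)) v = 0 := by
  have := substDunkl_algebraMap ħ κ hv 0
  rwa [map_zero, map_zero, ← map_zero cl, ← recip_self a] at this

theorem substDunkl_mom (hv : v ∈ generic n L) (i : Fin n) :
    substDunkl L ħ κ (mom i) v = ellDunkl L ħ κ v i := by
  obtain ⟨E, -, -, h⟩ := exists_substHom_generic L ħ κ hv
  exact h i

end Hom

theorem scalar_mem_fam {W : Set (Fin n → ℂ)} {f : (Fin n → ℂ) → ℂ}
    (hf : ∀ v ∈ W, AnalyticAt ℂ f v) : (fun v => algebraMap ℂ (Crossed n) (f v)) ∈ fam W := by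
  have := scalar_smul_mem_fam hf (const_mem_fam (1 : Crossed n))
  simpa only [← Algebra.algebraMap_eq_smul_one] using this

/-- `F` extends from the generic points to an analytic family on `W`. -/
def Extends (L : PeriodPair) (W : Set (Fin n → ℂ)) (F : (Fin n → ℂ) → Crossed n) : Prop :=
  ∃ G ∈ fam W, ∀ v ∈ generic n L, F v = G v

theorem weierstrassP_eq (z : ℂ) :
    L.weierstrassP z = L.weierstrassPExcept 0 z + 1 / z ^ 2 := by
  have h := L.weierstrassPExcept_def ⟨0, zero_mem _⟩ z
  simp only [sub_zero, ne_eq, OfNat.ofNat_ne_zero, not_false_eq_true, zero_pow, div_zero,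
    zero_sub] at h
  rw [h]
  ring

theorem analyticAt_weierstrassPExcept {v : Fin n → ℂ} (hv : v ∈ regSet n L) (i j : Fin n) :
    AnalyticAt ℂ (fun v : Fin n → ℂ => L.weierstrassPExcept 0 (v i - v j)) v := by
  have h : AnalyticAt ℂ (L.weierstrassPExcept 0) (v i - v j) := by
    by_cases h0 : v i - v j = 0
    · rw [h0]
      exact L.analyticAt_weierstrassPExcept 0
    · exact L.analyticOnNhd_weierstrassPExcept 0 _ (hv i j)
  exact h.comp (f := fun v : Fin n → ℂ => v i - v j) (analyticAt_sub_apply i j v)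

/-- The square of `y_i - y_j` has the pole `4 κ² / (v_i - v_j)²` along `v_i = v_j`. -/
theorem extends_quad {i j : Fin n} (hij : i ≠ j) : Extends L (pairSet L i j) fun v =>
    (ellDunkl L ħ κ v i - ellDunkl L ħ κ v j) ^ 2 -
      (4 * κ ^ 2) • algebraMap ℂ (Crossed n) ((v i - v j)⁻¹) ^ 2 := by
  have hW := pairSet_subset_regSet (L := L) i j
  set Y : (Fin n → ℂ) → Crossed n := dunklPart L ħ κ i ((Finset.univ.erase i).erase j) with hY
  set Z : (Fin n → ℂ) → Crossed n := dunklPart L ħ κ j ((Finset.univ.erase j).erase i) with hZ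
  have hYm : Y ∈ fam (pairSet L i j) := dunklPart_mem_fam L ħ κ hW i _ fun l hl v hv => by
    simp only [Finset.mem_erase] at hl
    exact hv.2 i l hl.2.1.symm (by simp [hl.1, hij])
  have hZm : Z ∈ fam (pairSet L i j) := dunklPart_mem_fam L ħ κ hW j _ fun l hl v hv => by
    simp only [Finset.mem_erase] at hl
    exact hv.2 j l hl.2.1.symm (by simp [hl.1, hij.symm])
  set T := Y - Z with hT
  have hTm : T ∈ fam (pairSet L i j) := sub_mem hYm hZm
  set Ψ : (Fin n → ℂ) → Crossed n := psiTerm L i j with hΨ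
  have hΨm : Ψ ∈ fam (pairSet L i j) := psiTerm_mem_fam L hW i j
  -- `T Ψ + Ψ T` vanishes on `v_i = v_j`, since there `Ψ = -s_{ij}`, which anticommutes with `T`
  obtain ⟨G, hG, hGe⟩ := exists_fam_eq_smul (isOpen_pairSet L i j) hij
    (add_mem (mul_mem hTm hΨm) (mul_mem hΨm hTm)) (fun v hv hvij => by
      have hvs : (fun k => v ((Equiv.swap i j).symm k)) = v := by
        ext1 k
        rw [Equiv.symm_swap]
        by_cases hi : k = i
        · rw [hi, Equiv.swap_apply_left, hvij]
        by_cases hj : k = j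
        · rw [hj, Equiv.swap_apply_right, hvij]
        · rw [Equiv.swap_apply_of_ne_of_ne hi hj]
      have hs : ∀ a b : Fin n, ((Finset.univ.erase a).erase b).map
          (Equiv.swap i j).toEmbedding =
          (Finset.univ.erase (Equiv.swap i j a)).erase (Equiv.swap i j b) := by
        intro a b
        simp [Finset.map_erase]
      have h1 := single_mul_dunklPart L ħ κ (Equiv.swap i j) i ((Finset.univ.erase i).erase j) v
      have h2 := single_mul_dunklPart L ħ κ (Equiv.swap i j) j ((Finset.univ.erase j).erase i) v
      rw [hvs, hs, Equiv.swap_apply_left, Equiv.swap_apply_right] at h1 h2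
      change (Y v - Z v) * psiTerm L i j v + psiTerm L i j v * (Y v - Z v) = 0
      rw [psiTerm_of_eq L hij hvij, neg_mul, mul_neg, mul_sub, sub_mul]
      change single (Equiv.swap i j) 1 * Y v = Z v * single (Equiv.swap i j) 1 at h1
      change single (Equiv.swap i j) 1 * Z v = Y v * single (Equiv.swap i j) 1 at h2
      rw [h1, h2]
      abel)
  have hP : (fun v : Fin n → ℂ => algebraMap ℂ (Crossed n) (L.weierstrassPExcept 0 (v i - v j))) ∈
      fam (pairSet L i j) :=
    scalar_mem_fam fun v hv => analyticAt_weierstrassPExcept (hW hv) i j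
  refine ⟨T * T - (2 * κ) • G + (4 * κ ^ 2) •
    ((fun v : Fin n → ℂ => algebraMap ℂ (Crossed n) (L.weierstrassPExcept 0 (v i - v j))) -
      fun _ => merHom (ellP L i j)),
    add_mem (sub_mem (mul_mem hTm hTm) ((fam _).smul_mem hG _))
      ((fam _).smul_mem (sub_mem hP (const_mem_fam _)) _), fun v hv => ?_⟩
  have hne := sub_ne_zero.mpr (ne_of_generic hv hij)
  have h1 := ellDunkl_eq_dunklPart_sub L ħ κ hv hij
  have h2 := ellDunkl_eq_dunklPart_sub L ħ κ hv hij.symm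
  rw [phiTerm_swap, smul_neg, sub_neg_eq_add] at h2
  have h3 : G v = T v * phiTerm L i j v + phiTerm L i j v * T v := by
    have h4 := hGe v (generic_subset_pairSet i j hv)
    change T v * Ψ v + Ψ v * T v = _ at h4
    rw [hΨ, ← smul_phiTerm L hij (ne_of_generic hv hij), mul_smul_comm, smul_mul_assoc,
      ← smul_add] at h4
    exact (smul_right_injective _ hne h4).symm
  have h5 := phiTerm_sq L hv hij
  rw [weierstrassP_eq, map_add, one_div, ← inv_pow, map_pow] at h5
  have h6 : ellDunkl L ħ κ v i - ellDunkl L ħ κ v j = T v - (2 * κ) • phiTerm L i j v := by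
    rw [h1, h2]
    change _ = (Y v - Z v) - _
    module
  change _ = T v * T v - (2 * κ) • G v + (4 * κ ^ 2) •
    (algebraMap ℂ (Crossed n) (L.weierstrassPExcept 0 (v i - v j)) - merHom (ellP L i j))
  have h7 : algebraMap ℂ (Crossed n) (L.weierstrassPExcept 0 (v i - v j)) - merHom (ellP L i j) =
      phiTerm L i j v * phiTerm L i j v - algebraMap ℂ (Crossed n) (v i - v j)⁻¹ ^ 2 := by
    rw [h5]
    abel
  beta_reduce
  rw [h7, h6, h3, sq (T v - _), sub_mul, mul_sub, mul_sub, smul_mul_assoc, smul_mul_assoc,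
    mul_smul_comm, mul_smul_comm]
  module

/-- Substituting the elliptic Dunkl operators into `pairAlg κ i j` gives no pole along `v_i = v_j`.
-/
theorem extends_pairAlg {i j : Fin n} (hij : i ≠ j) {f : ClassObs n} (hf : f ∈ pairAlg κ i j) :
    Extends L (pairSet L i j) (substDunkl L ħ κ f) := by
  have hW := pairSet_subset_regSet (L := L) i j
  have hYm : ∀ k l, k ≠ l → s(k, l) = s(i, j) →
      dunklPart L ħ κ k ((Finset.univ.erase k).erase l) ∈ fam (pairSet L i j) :=
    fun k l hkl hs => dunklPart_mem_fam L ħ κ hW k _ fun m hm v hv => by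
      simp only [Finset.mem_erase] at hm
      refine hv.2 k m hm.2.1.symm ?_
      rw [← hs]
      simp [hm.1, hkl]
  have h1 := hYm i j hij rfl
  have h2 := hYm j i hij.symm Sym2.eq_swap
  induction hf using Algebra.adjoin_induction with
  | mem f h =>
    cases h with
    | diff =>
      exact ⟨_, scalar_mem_fam fun v _ => analyticAt_sub_apply i j v,
        fun v hv => substDunkl_clDiff ħ κ hv i j⟩
    | recip a b h =>
      by_cases hab : a = b
      · subst hab
        exact ⟨0, zero_mem _, fun v hv => substDunkl_recip_self ħ κ hv a⟩
      · exact ⟨_, scalar_mem_fam fun v hv => (analyticAt_sub_apply a b v).inv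
          (sub_ne_zero.mpr (hv.2 a b hab h)), fun v hv => substDunkl_recip ħ κ hv hab⟩
    | mom k hi hj =>
      refine ⟨_, dunklPart_mem_fam L ħ κ hW k (Finset.univ.erase k) fun l hl v hv =>
        hv.2 k l (Finset.ne_of_mem_erase hl).symm (by simp [hi, hj]), fun v hv => ?_⟩
      rw [substDunkl_mom ħ κ hv, ellDunkl_eq_dunklPart L ħ κ hv]
    | momAdd =>
      refine ⟨_, add_mem h1 h2, fun v hv => ?_⟩
      rw [substDunkl_add ħ κ hv (mom_mem_regularObs v i) (mom_mem_regularObs v j),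
        substDunkl_mom ħ κ hv, substDunkl_mom ħ κ hv, ellDunkl_eq_dunklPart_sub L ħ κ hv hij,
        ellDunkl_eq_dunklPart_sub L ħ κ hv hij.symm, phiTerm_swap, smul_neg, Pi.add_apply]
      abel
    | diffMul =>
      refine ⟨_, sub_mem (scalar_smul_mem_fam (fun v _ => analyticAt_sub_apply i j v)
        (sub_mem h1 h2)) ((fam _).smul_mem (psiTerm_mem_fam L hW i j) (2 * κ)), fun v hv => ?_⟩
      rw [substDunkl_mul ħ κ hv (clDiff_mem_regularObs v i j) (sub_mem (mom_mem_regularObs v i)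
        (mom_mem_regularObs v j)), substDunkl_sub ħ κ hv (mom_mem_regularObs v i)
        (mom_mem_regularObs v j), substDunkl_mom ħ κ hv, substDunkl_mom ħ κ hv,
        substDunkl_clDiff ħ κ hv, ← Algebra.smul_def, ellDunkl_eq_dunklPart_sub L ħ κ hv hij,
        ellDunkl_eq_dunklPart_sub L ħ κ hv hij.symm, phiTerm_swap L i j, Pi.sub_apply,
          Pi.smul_apply,
        ← smul_phiTerm L hij (ne_of_generic hv hij), Pi.sub_apply]
      module
    | quad =>
      obtain ⟨G, hG, h⟩ := extends_quad (L := L) ħ κ hij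
      refine ⟨G, hG, fun v hv => ?_⟩
      have hm := mom_mem_regularObs v
      have hr := cl_recip_mem_regularObs hv i j
      rw [← h v hv, substDunkl_sub ħ κ hv (pow_mem (sub_mem (hm i) (hm j)) 2)
        ((regularObs v).smul_mem (pow_mem hr 2) _), substDunkl_pow ħ κ hv (sub_mem (hm i) (hm j)),
        substDunkl_sub ħ κ hv (hm i) (hm j), substDunkl_smul ħ κ hv (pow_mem hr 2),
        substDunkl_pow ħ κ hv hr, substDunkl_recip ħ κ hv hij, substDunkl_mom ħ κ hv,
        substDunkl_mom ħ κ hv]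
  | algebraMap r => exact ⟨_, const_mem_fam _, fun v hv => substDunkl_algebraMap ħ κ hv r⟩
  | add f g hf hg ihf ihg =>
    obtain ⟨F, hF, ef⟩ := ihf
    obtain ⟨G, hG, eg⟩ := ihg
    refine ⟨F + G, add_mem hF hG, fun v hv => ?_⟩
    rw [substDunkl_add ħ κ hv (pairAlg_le_regularObs κ hv i j hf)
      (pairAlg_le_regularObs κ hv i j hg), ef v hv, eg v hv, Pi.add_apply]
  | mul f g hf hg ihf ihg =>
    obtain ⟨F, hF, ef⟩ := ihf
    obtain ⟨G, hG, eg⟩ := ihg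
    refine ⟨F * G, mul_mem hF hG, fun v hv => ?_⟩
    rw [substDunkl_mul ħ κ hv (pairAlg_le_regularObs κ hv i j hf)
      (pairAlg_le_regularObs κ hv i j hg), ef v hv, eg v hv, Pi.mul_apply]

/-- The products of linear forms `v_a - v_b`. -/
def discMonoid (n : ℕ) : Submonoid ((Fin n → ℂ) → ℂ) :=
  Submonoid.closure {D | ∃ a b : Fin n, a ≠ b ∧ D = fun v => v a - v b}

theorem analyticAt_of_mem_discMonoid {D : (Fin n → ℂ) → ℂ} (hD : D ∈ discMonoid n)
    (v : Fin n → ℂ) : AnalyticAt ℂ D v := by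
  induction hD using Submonoid.closure_induction with
  | mem D h =>
    obtain ⟨a, b, -, rfl⟩ := h
    exact analyticAt_sub_apply a b v
  | one => exact analyticAt_const
  | mul D D' _ _ h h' => exact h.mul h'

/-- `D F` extends to `regSet n L` for some product `D` of linear forms `v_a - v_b`. -/
def Clearable (L : PeriodPair) (F : (Fin n → ℂ) → Crossed n) : Prop :=
  ∃ D ∈ discMonoid n, Extends L (regSet n L) fun v => D v • F v

theorem Extends.clearable {F : (Fin n → ℂ) → Crossed n} (h : Extends L (regSet n L) F) :
    Clearable L F := ⟨1, one_mem _, by simpa using h⟩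

theorem Extends.smul_disc {W : Set (Fin n → ℂ)} {F : (Fin n → ℂ) → Crossed n}
    (h : Extends L W F) {D : (Fin n → ℂ) → ℂ} (hD : D ∈ discMonoid n) :
    Extends L W fun v => D v • F v := by
  obtain ⟨G, hG, e⟩ := h
  exact ⟨_, scalar_smul_mem_fam (fun v _ => analyticAt_of_mem_discMonoid hD v) hG,
    fun v hv => by simp only [e v hv]⟩

theorem Extends.add {W : Set (Fin n → ℂ)} {F G : (Fin n → ℂ) → Crossed n}
    (hF : Extends L W F) (hG : Extends L W G) : Extends L W fun v => F v + G v := by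
  obtain ⟨F', hF', ef⟩ := hF
  obtain ⟨G', hG', eg⟩ := hG
  exact ⟨_, add_mem hF' hG', fun v hv => by simp only [ef v hv, eg v hv, Pi.add_apply]⟩

theorem Extends.mul {W : Set (Fin n → ℂ)} {F G : (Fin n → ℂ) → Crossed n}
    (hF : Extends L W F) (hG : Extends L W G) : Extends L W fun v => F v * G v := by
  obtain ⟨F', hF', ef⟩ := hF
  obtain ⟨G', hG', eg⟩ := hG
  exact ⟨_, mul_mem hF' hG', fun v hv => by simp only [ef v hv, eg v hv, Pi.mul_apply]⟩

theorem Extends.congr {W : Set (Fin n → ℂ)} {F G : (Fin n → ℂ) → Crossed n}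
    (hF : Extends L W F) (h : ∀ v ∈ generic n L, F v = G v) : Extends L W G := by
  obtain ⟨F', hF', ef⟩ := hF
  exact ⟨F', hF', fun v hv => by rw [← h v hv, ef v hv]⟩

theorem Clearable.congr {F G : (Fin n → ℂ) → Crossed n}
    (hF : Clearable L F) (h : ∀ v ∈ generic n L, F v = G v) : Clearable L G := by
  obtain ⟨D, hD, hF⟩ := hF
  exact ⟨D, hD, hF.congr fun v hv => by rw [h v hv]⟩

theorem Clearable.add {F G : (Fin n → ℂ) → Crossed n}
    (hF : Clearable L F) (hG : Clearable L G) : Clearable L fun v => F v + G v := by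
  obtain ⟨D, hD, hF⟩ := hF
  obtain ⟨D', hD', hG⟩ := hG
  refine ⟨D * D', mul_mem hD hD', ((hF.smul_disc hD').add (hG.smul_disc hD)).congr fun v _ => ?_⟩
  rw [Pi.mul_apply, smul_add, smul_smul, smul_smul, mul_comm (D' v)]

theorem Clearable.mul {F G : (Fin n → ℂ) → Crossed n}
    (hF : Clearable L F) (hG : Clearable L G) : Clearable L fun v => F v * G v := by
  obtain ⟨D, hD, hF⟩ := hF
  obtain ⟨D', hD', hG⟩ := hG
  refine ⟨D * D', mul_mem hD hD', (hF.mul hG).congr fun v _ => ?_⟩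
  rw [Pi.mul_apply, smul_mul_smul_comm]

theorem clearable_const (P : Crossed n) : Clearable L fun _ => P :=
  Extends.clearable ⟨_, const_mem_fam P, fun _ _ => rfl⟩

theorem Clearable.sum {ι : Type*} (s : Finset ι) {F : ι → (Fin n → ℂ) → Crossed n}
    (hF : ∀ i ∈ s, Clearable L (F i)) : Clearable L fun v => ∑ i ∈ s, F i v := by
  classical
  induction s using Finset.induction_on with
  | empty => simpa using clearable_const 0
  | insert a s ha ih =>
    simp only [Finset.sum_insert ha]
    exact (hF a (by simp)).add (ih fun i hi => hF i (by simp [hi]))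

theorem clearable_phiTerm {i j : Fin n} (hij : i ≠ j) : Clearable L (phiTerm L i j) :=
  ⟨_, Submonoid.subset_closure ⟨i, j, hij, rfl⟩, _, psiTerm_mem_fam L subset_rfl i j,
    fun _ hv => smul_phiTerm L hij (ne_of_generic hv hij)⟩

/-- The substituted observables have poles at most along the hyperplanes `v_a = v_b`, of finite
order. -/
theorem clearable_recipAlg {f : ClassObs n} (hf : f ∈ recipAlg n) :
    Clearable L (substDunkl L ħ κ f) := by
  induction hf using Algebra.adjoin_induction with
  | mem f h =>
    rcases h with ⟨a, b, rfl⟩ | ⟨i, rfl⟩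
    · by_cases hab : a = b
      · subst hab
        exact (clearable_const 0).congr fun v hv => (substDunkl_recip_self ħ κ hv a).symm
      · refine ⟨_, Submonoid.subset_closure ⟨a, b, hab, rfl⟩, _, const_mem_fam 1, fun v hv => ?_⟩
        beta_reduce
        rw [substDunkl_recip ħ κ hv hab, Algebra.smul_def, ← map_mul,
          mul_inv_cancel₀ (sub_ne_zero.mpr (ne_of_generic hv hab)), map_one]
    · refine Clearable.congr ((clearable_const (single 1 (ħ • dOp i))).add
        ((clearable_const (algebraMap ℂ _ (-κ))).mul (Clearable.sum (Finset.univ.erase i)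
          (F := fun j => phiTerm L i j)
          fun j hj => clearable_phiTerm (Finset.ne_of_mem_erase hj).symm))) fun v hv => ?_
      rw [substDunkl_mom ħ κ hv, ellDunkl_eq, ← Algebra.smul_def, neg_smul, sub_eq_add_neg]
  | algebraMap r => exact (clearable_const _).congr fun v hv =>
    (substDunkl_algebraMap ħ κ hv r).symm
  | add f g hf hg ihf ihg =>
    exact (ihf.add ihg).congr fun v hv => (substDunkl_add ħ κ hv (recipAlg_le_regularObs hv hf)
      (recipAlg_le_regularObs hv hg)).symm
  | mul f g hf hg ihf ihg =>
    exact (ihf.mul ihg).congr fun v hv => (substDunkl_mul ħ κ hv (recipAlg_le_regularObs hv hf)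
      (recipAlg_le_regularObs hv hg)).symm

/-- A family with clearable poles, and without pole along any single hyperplane `v_a = v_b`, has no
poles. -/
theorem extends_of_extends_pairSet {D : (Fin n → ℂ) → ℂ} (hD : D ∈ discMonoid n) :
    ∀ {F : (Fin n → ℂ) → Crossed n}, (∀ a b, a ≠ b → Extends L (pairSet L a b) F) →
      (Extends L (regSet n L) fun v => D v • F v) → Extends L (regSet n L) F := by
  induction hD using Submonoid.closure_induction with
  | mem D h =>
    obtain ⟨i, j, hij, rfl⟩ := h
    rintro F hF ⟨K, hK, e⟩
    obtain ⟨G, hG, eG⟩ := hF i j hij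
    -- so `K` vanishes on the part of `v_i = v_j` in `pairSet L i j`, and by continuity on all of it
    have h1 : ∀ v ∈ pairSet L i j, K v = (v i - v j) • G v := by
      intro v hv
      have h2 : (K - fun v => (v i - v j) • G v) ∈ fam (pairSet L i j) :=
        sub_mem (fam_mono (pairSet_subset_regSet i j) hK)
          (scalar_smul_mem_fam (fun v _ => analyticAt_sub_apply i j v) hG)
      refine sub_eq_zero.mp (fam_eq_zero_of_frequently h2 hv ?_)
      refine (frequently_generic (isOpen_pairSet L i j) (pairSet_subset_regSet i j) hv).mono ?_
      rintro u ⟨hu, hug⟩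
      refine ⟨hu, ?_⟩
      rw [Pi.sub_apply, ← e u hug, ← eG u hug, sub_self]
    obtain ⟨H, hH, eH⟩ := exists_fam_eq_smul (isOpen_regSet L) hij hK fun v hv hvij =>
      fam_eq_zero_of_frequently hK hv ((frequently_pairSet hv hvij).mono fun u hu =>
        ⟨hu.1.1, by rw [h1 u hu.1, hu.2, sub_self, zero_smul]⟩)
    refine ⟨H, hH, fun v hv => ?_⟩
    have h3 := (e v hv).trans (eH v (generic_subset_regSet hv))
    exact smul_right_injective _ (sub_ne_zero.mpr (ne_of_generic hv hij)) h3
  | one =>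
    intro F _ h
    simpa using h
  | mul D D' hD hD' ih ih' =>
    intro F hF h
    refine ih' hF (ih (fun a b hab => (hF a b hab).smul_disc hD') (h.congr fun v _ => ?_))
    rw [Pi.mul_apply, smul_smul]

/-- The substituted rational Hamiltonians are regular at all points where no `v_i - v_j` is a
nonzero period, in particular near `0`. -/
theorem extends_ratHam {q : MvPolynomial (Fin n) ℂ} (hq : q.IsSymmetric) :
    Extends L (regSet n L) (substDunkl L ħ κ (ratHam κ q)) := by
  obtain ⟨D, hD, h⟩ := clearable_recipAlg (L := L) ħ κ (ratHam_mem_recipAlg κ q)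
  exact extends_of_extends_pairSet hD
    (fun a b hab => extends_pairAlg ħ κ hab (ratHam_mem_pairAlg κ hab hq)) h

end Regularity

/-! ### Limits at zero -/

section Limits

open SkewMonoidAlgebra (single single_mul_single single_add single_zero)

variable {n : ℕ} {L : PeriodPair}

theorem hasRegularLimit_iff {F : (Fin n → ℂ) → Crossed n} {G : Crossed n} :
    HasRegularLimit L F G ↔ ∃ W : Set (Fin n → ℂ), IsOpen W ∧ 0 ∈ W ∧ ∃ N ∈ fam W,
      (∀ v ∈ W, v ∈ generic n L → F v = N v) ∧ G = N 0 := by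
  constructor
  · rintro ⟨W, m, c, P, hW, h0, hc, hF, hG⟩
    exact ⟨W, hW, h0, fun v => ∑ k, algebraMap (Entire n) (Mer n) (c k v) • P k,
      mem_fam_of_eq_sum hc fun _ _ => rfl, hF, hG⟩
  · rintro ⟨W, hW, h0, N, hN, hF, hG⟩
    obtain ⟨m, c, P, hc, h⟩ := exists_eq_sum_of_mem_fam hN
    exact ⟨W, m, c, P, hW, h0, hc, fun v hv hvg => (hF v hv hvg).trans (h v hv),
      hG.trans (h 0 h0)⟩

/-- Two analytic families that agree at generic points have the same value at zero. -/
theorem fam_zero_unique {W W' : Set (Fin n → ℂ)} (hW : IsOpen W) (hW' : IsOpen W') (h0 : 0 ∈ W)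
    (h0' : 0 ∈ W') {N N' : (Fin n → ℂ) → Crossed n} (hN : N ∈ fam W) (hN' : N' ∈ fam W')
    (h : ∀ v ∈ W, v ∈ W' → v ∈ generic n L → N v = N' v) : N 0 = N' 0 := by
  have hO : IsOpen (W ∩ W' ∩ regSet n L) := (hW.inter hW').inter (isOpen_regSet L)
  have hd : N - N' ∈ fam (W ∩ W' ∩ regSet n L) :=
    sub_mem (fam_mono (fun v hv => hv.1.1) hN) (fam_mono (fun v hv => hv.1.2) hN')
  have hm : (0 : Fin n → ℂ) ∈ W ∩ W' ∩ regSet n L := ⟨⟨h0, h0'⟩, zero_mem_regSet L⟩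
  refine sub_eq_zero.mp (fam_eq_zero_of_frequently hd hm ?_)
  refine (frequently_generic hO Set.inter_subset_right hm).mono ?_
  rintro u ⟨hu, hug⟩
  exact ⟨hu, sub_eq_zero.mpr (h u hu.1.1 hu.1.2 hug)⟩

theorem HasRegularLimit.unique {F : (Fin n → ℂ) → Crossed n} {G G' : Crossed n}
    (h : HasRegularLimit L F G) (h' : HasRegularLimit L F G') : G = G' := by
  obtain ⟨W, hW, h0, N, hN, hF, rfl⟩ := hasRegularLimit_iff.mp h
  obtain ⟨W', hW', h0', N', hN', hF', rfl⟩ := hasRegularLimit_iff.mp h'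
  exact fam_zero_unique hW hW' h0 h0' hN hN' fun v hv hv' hvg =>
    (hF v hv hvg).symm.trans (hF' v hv' hvg)

theorem limZero_eq {F : (Fin n → ℂ) → Crossed n} {G : Crossed n} (h : HasRegularLimit L F G) :
    limZero L F = G := by
  have hex : ∃ G, HasRegularLimit L F G := ⟨G, h⟩
  rw [limZero, dif_pos hex]
  exact hex.choose_spec.unique h

theorem hasRegularLimit_of_fam {F N : (Fin n → ℂ) → Crossed n} (hN : N ∈ fam (regSet n L))
    (h : ∀ v ∈ generic n L, F v = N v) : HasRegularLimit L F (N 0) :=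
  hasRegularLimit_iff.mpr ⟨_, isOpen_regSet L, zero_mem_regSet L, N, hN, fun v _ => h v, rfl⟩

theorem fam_comp_perm {N : (Fin n → ℂ) → Crossed n} (hN : N ∈ fam (regSet n L))
    (w : Equiv.Perm (Fin n)) : (fun v => N fun k => v (w k)) ∈ fam (regSet n L) := by
  obtain ⟨m, c, P, hc, h⟩ := exists_eq_sum_of_mem_fam hN
  have hw : ∀ v ∈ regSet n L, (fun k => v (w k)) ∈ regSet n L := fun _ hv i j => hv (w i) (w j)
  refine mem_fam_of_eq_sum (c := fun k v => c k fun i => v (w i)) (P := P) (fun k v hv x => ?_)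
    fun v hv => h _ (hw v hv)
  let T : ((Fin n → ℂ) × (Fin n → ℂ)) →L[ℂ] ((Fin n → ℂ) × (Fin n → ℂ)) :=
    ((LinearMap.toContinuousLinearMap (LinearMap.funLeft ℂ ℂ w)).comp
      (ContinuousLinearMap.fst ℂ _ _)).prod (ContinuousLinearMap.snd ℂ _ _)
  exact (hc k _ (hw v hv) x).comp (f := T) (T.analyticAt (v, x))

theorem comp_perm_mem_generic {v : Fin n → ℂ} (hv : v ∈ generic n L) (w : Equiv.Perm (Fin n)) :
    (fun k => v (w k)) ∈ generic n L := fun _ _ hij => hv _ _ (w.injective.ne hij)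

/-- Equivariance of the substitution of elliptic Dunkl operators. -/
theorem single_mul_substDunkl (ħ κ : ℂ) {v : Fin n → ℂ} (hv : v ∈ generic n L)
    (w : Equiv.Perm (Fin n)) {f : ClassObs n} (hf : f ∈ recipAlg n) :
    single w 1 * substDunkl L ħ κ f v =
      substDunkl L ħ κ (w • f) (fun k => v (w.symm k)) * single w 1 := by
  have hv' := comp_perm_mem_generic hv w.symm
  induction hf using Algebra.adjoin_induction with
  | mem f h =>
    rcases h with ⟨a, b, rfl⟩ | ⟨i, rfl⟩
    · rw [smul_cl_recip]
      by_cases hab : a = b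
      · subst hab
        rw [substDunkl_recip_self ħ κ hv, substDunkl_recip_self ħ κ hv', mul_zero, zero_mul]
      · rw [substDunkl_recip ħ κ hv hab, substDunkl_recip ħ κ hv' (w.injective.ne hab),
          Equiv.symm_apply_apply, Equiv.symm_apply_apply]
        exact (Algebra.commutes _ _).symm
    · rw [smul_mom, substDunkl_mom ħ κ hv, substDunkl_mom ħ κ hv', single_mul_ellDunkl]
  | algebraMap r =>
    rw [smul_algebraMap_classObs, substDunkl_algebraMap ħ κ hv, substDunkl_algebraMap ħ κ hv']
    exact (Algebra.commutes _ _).symm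
  | add f g hf hg ihf ihg =>
    rw [smul_add, substDunkl_add ħ κ hv (recipAlg_le_regularObs hv hf)
      (recipAlg_le_regularObs hv hg), substDunkl_add ħ κ hv'
      (recipAlg_le_regularObs hv' (smul_mem_recipAlg hf w))
      (recipAlg_le_regularObs hv' (smul_mem_recipAlg hg w)), mul_add, add_mul, ihf, ihg]
  | mul f g hf hg ihf ihg =>
    rw [smul_mul', substDunkl_mul ħ κ hv (recipAlg_le_regularObs hv hf)
      (recipAlg_le_regularObs hv hg), substDunkl_mul ħ κ hv'
      (recipAlg_le_regularObs hv' (smul_mem_recipAlg hf w))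
      (recipAlg_le_regularObs hv' (smul_mem_recipAlg hg w)), ← mul_assoc, ihf, mul_assoc, ihg,
      mul_assoc]

variable (L) in
/-- `lim_{λ → 0} L^{rat}_{q,c}(λ, y)`. -/
def limHam (ħ κ : ℂ) (q : MvPolynomial (Fin n) ℂ) : Crossed n :=
  limZero L (substDunkl L ħ κ (ratHam κ q))

theorem exists_fam_limHam (ħ κ : ℂ) {q : MvPolynomial (Fin n) ℂ} (hq : q.IsSymmetric) :
    ∃ N ∈ fam (regSet n L), (∀ v ∈ generic n L, substDunkl L ħ κ (ratHam κ q) v = N v) ∧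
      limHam L ħ κ q = N 0 := by
  obtain ⟨N, hN, h⟩ := extends_ratHam (L := L) ħ κ hq
  exact ⟨N, hN, h, limZero_eq (hasRegularLimit_of_fam hN h)⟩

theorem limHam_eq {ħ κ : ℂ} {q : MvPolynomial (Fin n) ℂ} {N : (Fin n → ℂ) → Crossed n}
    (hN : N ∈ fam (regSet n L))
    (h : ∀ v ∈ generic n L, substDunkl L ħ κ (ratHam κ q) v = N v) : limHam L ħ κ q = N 0 :=
  limZero_eq (hasRegularLimit_of_fam hN h)

theorem limHam_mul (ħ κ : ℂ) {p q : MvPolynomial (Fin n) ℂ} (hp : p.IsSymmetric)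
    (hq : q.IsSymmetric) : limHam L ħ κ (p * q) = limHam L ħ κ p * limHam L ħ κ q := by
  obtain ⟨N, hN, h, e⟩ := exists_fam_limHam (L := L) ħ κ hp
  obtain ⟨N', hN', h', e'⟩ := exists_fam_limHam (L := L) ħ κ hq
  rw [e, e']
  refine limHam_eq (mul_mem hN hN') fun v hv => ?_
  rw [ratHam_mul κ p hq, substDunkl_mul ħ κ hv (recipAlg_le_regularObs hv (ratHam_mem_recipAlg κ p))
    (recipAlg_le_regularObs hv (ratHam_mem_recipAlg κ q)), h v hv, h' v hv, Pi.mul_apply]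

theorem limHam_add (ħ κ : ℂ) {p q : MvPolynomial (Fin n) ℂ} (hp : p.IsSymmetric)
    (hq : q.IsSymmetric) : limHam L ħ κ (p + q) = limHam L ħ κ p + limHam L ħ κ q := by
  obtain ⟨N, hN, h, e⟩ := exists_fam_limHam (L := L) ħ κ hp
  obtain ⟨N', hN', h', e'⟩ := exists_fam_limHam (L := L) ħ κ hq
  rw [e, e']
  refine limHam_eq (add_mem hN hN') fun v hv => ?_
  rw [ratHam_add κ p q, substDunkl_add ħ κ hv (recipAlg_le_regularObs hv (ratHam_mem_recipAlg κ p))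
    (recipAlg_le_regularObs hv (ratHam_mem_recipAlg κ q)), h v hv, h' v hv, Pi.add_apply]

theorem limHam_C (ħ κ c : ℂ) : limHam L ħ κ (MvPolynomial.C c : MvPolynomial (Fin n) ℂ) =
    algebraMap ℂ (Crossed n) c := by
  refine limHam_eq (const_mem_fam (algebraMap ℂ (Crossed n) c)) fun v hv => ?_
  rw [ratHam_C, substDunkl_algebraMap ħ κ hv]

/-- The limits commute with the symmetric group. -/
theorem single_mul_limHam (ħ κ : ℂ) {q : MvPolynomial (Fin n) ℂ} (hq : q.IsSymmetric)
    (w : Equiv.Perm (Fin n)) :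
    single w 1 * limHam L ħ κ q = limHam L ħ κ q * single w 1 := by
  obtain ⟨N, hN, h, e⟩ := exists_fam_limHam (L := L) ħ κ hq
  rw [e]
  refine fam_zero_unique (L := L) (isOpen_regSet L) (isOpen_regSet L) (zero_mem_regSet L)
    (zero_mem_regSet L) (N := fun v => single w 1 * N v)
    (N' := fun v => N (fun k => v (w.symm k)) * single w 1)
    (mul_mem (const_mem_fam _) hN) (mul_mem (fam_comp_perm hN w.symm) (const_mem_fam _))
    fun v _ _ hv => ?_
  rw [← h v hv, ← h _ (comp_perm_mem_generic hv w.symm),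
    single_mul_substDunkl ħ κ hv w (ratHam_mem_recipAlg κ q), smul_ratHam κ hq]

end Limits

/-! ### The algebra of spin Hamiltonians -/

section Spin

open SkewMonoidAlgebra (single single_mul_single)

variable {n : ℕ}

/-- `Res^` as a linear map. -/
def resHatLin : Crossed n →ₗ[ℂ] SpinAlg n where
  toFun := resHat
  map_add' a b := SkewMonoidAlgebra.sum_add_index' (fun _ => TensorProduct.zero_tmul _ _)
    (fun _ _ _ => TensorProduct.add_tmul _ _ _)
  map_smul' c a := by
    change SkewMonoidAlgebra.sum (c • a) _ = c • SkewMonoidAlgebra.sum a _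
    rw [SkewMonoidAlgebra.smul_sum]
    exact SkewMonoidAlgebra.sum_smul_index' (k := DiffOp n) (R := ℂ) (g := a) (b := c)
      (h := fun w (c : DiffOp n) => c ⊗ₜ[ℂ] hat w⁻¹) fun _ => TensorProduct.zero_tmul _ _

theorem resHatLin_single (w : Equiv.Perm (Fin n)) (a : DiffOp n) :
    resHatLin (single w a) = a ⊗ₜ[ℂ] hat w⁻¹ :=
  SkewMonoidAlgebra.sum_single_index (h := fun w c => c ⊗ₜ[ℂ] hat w⁻¹) (TensorProduct.zero_tmul _ _)

theorem hat_mul (u w : Equiv.Perm (Fin n)) : hat (u * w) = hat u * hat w :=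
  map_mul (MonoidAlgebra.of ℂ (Equiv.Perm (Fin n))) u w

theorem hat_one : hat (1 : Equiv.Perm (Fin n)) = 1 :=
  map_one (MonoidAlgebra.of ℂ (Equiv.Perm (Fin n)))

/-- `Res^` reverses the group elements; it is multiplicative when the right factor commutes with
them. -/
theorem resHatLin_mul {b : Crossed n}
    (hb : ∀ w : Equiv.Perm (Fin n), single w 1 * b = b * single w 1) (a : Crossed n) :
    resHatLin (a * b) = resHatLin a * resHatLin b := by
  have key : ∀ (w : Equiv.Perm (Fin n)) (c : DiffOp n) (d : Crossed n),
      resHatLin (single 1 c * d * single w 1) = c ⊗ₜ[ℂ] hat w⁻¹ * resHatLin d := by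
    intro w c d
    induction d using SkewMonoidAlgebra.induction with
    | h0 => simp
    | ha u e x _ _ h =>
      rw [mul_add, add_mul, map_add, map_add, h, mul_add, single_mul_single, single_mul_single,
        resHatLin_single, resHatLin_single, one_smul, smul_one, mul_one, one_mul,
        Algebra.TensorProduct.tmul_mul_tmul, mul_inv_rev, hat_mul]
  induction a using SkewMonoidAlgebra.induction with
  | h0 => simp
  | ha u c x _ _ h =>
    have h2 : (single u c : Crossed n) = single 1 c * single u 1 := by
      rw [single_mul_single, one_mul, one_smul, mul_one]
    rw [add_mul, map_add, map_add, h, add_mul, resHatLin_single, h2, mul_assoc, hb, ← mul_assoc,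
      key]

theorem spinAct_tmul (w u : Equiv.Perm (Fin n)) (a : DiffOp n) :
    spinAct w (a ⊗ₜ[ℂ] hat u) = (w • a) ⊗ₜ[ℂ] hat (w * u * w⁻¹) := by
  rw [spinAct, Algebra.TensorProduct.map_tmul]
  congr 1
  simp [hat]

theorem spinAct_resHatLin (w : Equiv.Perm (Fin n)) (a : Crossed n) :
    spinAct w (resHatLin a) = resHatLin (single w 1 * a * single w⁻¹ 1) := by
  induction a using SkewMonoidAlgebra.induction with
  | h0 => simp
  | ha u c x _ _ h =>
    rw [mul_add, add_mul, map_add, map_add, map_add, h, single_mul_single, single_mul_single,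
      resHatLin_single, resHatLin_single, spinAct_tmul, one_mul, smul_one, mul_one, mul_inv_rev,
      mul_inv_rev, inv_inv, mul_assoc]

theorem resHatLin_mem_spinInvariants {b : Crossed n}
    (hb : ∀ w : Equiv.Perm (Fin n), single w 1 * b = b * single w 1) :
    resHatLin b ∈ spinInvariants n := by
  rw [spinInvariants, Algebra.mem_iInf]
  intro w
  rw [AlgHom.mem_equalizer, spinAct_resHatLin, hb, mul_assoc, single_mul_single, mul_inv_cancel,
    smul_one, mul_one]
  exact congrArg resHatLin (mul_one b)

variable (L : PeriodPair) (ħ κ : ℂ)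

theorem spinHam_eq (q : MvPolynomial (Fin n) ℂ) : spinHam L ħ κ q = resHatLin (limHam L ħ κ q) :=
    rfl

theorem spinHam_add {p q : MvPolynomial (Fin n) ℂ} (hp : p.IsSymmetric) (hq : q.IsSymmetric) :
    spinHam L ħ κ (p + q) = spinHam L ħ κ p + spinHam L ħ κ q := by
  rw [spinHam_eq, spinHam_eq, spinHam_eq, limHam_add ħ κ hp hq, map_add]

theorem spinHam_mul {p q : MvPolynomial (Fin n) ℂ} (hp : p.IsSymmetric) (hq : q.IsSymmetric) :
    spinHam L ħ κ (p * q) = spinHam L ħ κ p * spinHam L ħ κ q := by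
  rw [spinHam_eq, spinHam_eq, spinHam_eq, limHam_mul ħ κ hp hq,
    resHatLin_mul (single_mul_limHam ħ κ hq)]

theorem spinHam_C (c : ℂ) :
    spinHam L ħ κ (MvPolynomial.C c : MvPolynomial (Fin n) ℂ) = algebraMap ℂ (SpinAlg n) c := by
  rw [spinHam_eq, limHam_C, Algebra.algebraMap_eq_smul_one, Algebra.algebraMap_eq_smul_one,
    map_smul]
  congr 1
  refine (resHatLin_single 1 1).trans ?_
  rw [inv_one, hat_one]
  rfl

/-- The algebra of spin Hamiltonians `L^_q`. -/
def spinHamAlg (n : ℕ) (L : PeriodPair) (ħ κ : ℂ) : Subalgebra ℂ (SpinAlg n) where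
  carrier := {a | ∃ q : MvPolynomial (Fin n) ℂ, q.IsSymmetric ∧ a = spinHam L ħ κ q}
  mul_mem' := by
    rintro _ _ ⟨p, hp, rfl⟩ ⟨q, hq, rfl⟩
    exact ⟨p * q, hp.mul hq, (spinHam_mul L ħ κ hp hq).symm⟩
  add_mem' := by
    rintro _ _ ⟨p, hp, rfl⟩ ⟨q, hq, rfl⟩
    exact ⟨p + q, hp.add hq, (spinHam_add L ħ κ hp hq).symm⟩
  algebraMap_mem' c := ⟨MvPolynomial.C c, MvPolynomial.IsSymmetric.C c, (spinHam_C L ħ κ c).symm⟩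

theorem spinHamAlg_le_spinInvariants : spinHamAlg n L ħ κ ≤ spinInvariants n := by
  rintro _ ⟨q, hq, rfl⟩
  exact resHatLin_mem_spinInvariants (single_mul_limHam ħ κ hq)

theorem spinHamAlg_mul_comm {a b : SpinAlg n} (ha : a ∈ spinHamAlg n L ħ κ)
    (hb : b ∈ spinHamAlg n L ħ κ) : a * b = b * a := by
  obtain ⟨p, hp, rfl⟩ := ha
  obtain ⟨q, hq, rfl⟩ := hb
  rw [← spinHam_mul L ħ κ hp hq, ← spinHam_mul L ħ κ hq hp, mul_comm]

end Spin

/-! ### The total momentum and the spin Calogero–Moser Hamiltonian -/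

section Explicit

open SkewMonoidAlgebra (single single_mul_single single_add single_zero smul_single)

variable {n : ℕ} (L : PeriodPair) (ħ κ : ℂ)

theorem sum_erase_eq_sum {A : Type*} [AddCommMonoid A] {f : Fin n → A} {i : Fin n} (h : f i = 0) :
    ∑ j ∈ Finset.univ.erase i, f j = ∑ j, f j := Finset.sum_erase _ h

theorem ellDunkl_eq_sum (v : Fin n → ℂ) (i : Fin n) :
    ellDunkl L ħ κ v i = single 1 (ħ • dOp i) - κ • ∑ j, phiTerm L i j v := by
  rw [ellDunkl_eq, sum_erase_eq_sum (phiTerm_self L i v)]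

theorem limHam_sum_X : limHam L ħ κ (∑ i : Fin n, MvPolynomial.X i) =
    ∑ i, single 1 (ħ • dOp i) := by
  refine limHam_eq (const_mem_fam _) fun v hv => ?_
  rw [ratHam_sum_X, substDunkl_sum ħ κ hv _ _ (mom_mem_regularObs v)]
  simp only [substDunkl_mom ħ κ hv, ellDunkl_eq_sum, Finset.sum_sub_distrib, ← Finset.smul_sum]
  rw [sum_sum_eq_zero_of_antisymm _ fun i j => phiTerm_swap L i j v, smul_zero, sub_zero]

/-- The family `∂_i φ(v_i - v_j, x_i - x_j) s_{ij}`, continued to `v_i = v_j`. -/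
def dPhiTerm (i j : Fin n) (v : Fin n → ℂ) : Crossed n :=
  algebraMap (Entire n) (Mer n) (algebraMap ℂ (Entire n) (-(sigmaProd L (v i - v j))⁻¹) *
      divDiff i j (fun v => sigmaWronskian L (v i - v j) i j) v) •
    (algebraMap (Entire n) (Mer n) (sigmaDiff L i j) ^ 2)⁻¹ • single (Equiv.swap i j) 1

theorem sigmaWronskian_apply (μ : ℂ) (i j : Fin n) (x : Fin n → ℂ) : (sigmaWronskian L μ i j).1 x =
    deriv (weierstrassSigma L) (x i - x j - μ) * weierstrassSigma L (x i - x j) -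
      weierstrassSigma L (x i - x j - μ) * deriv (weierstrassSigma L) (x i - x j) := rfl

theorem isAnalyticFamily_sigmaWronskian {W : Set (Fin n → ℂ)} (i j : Fin n) :
    IsAnalyticFamily W fun v => sigmaWronskian L (v i - v j) i j := by
  have h1 := (isAnalyticFamily_shift (W := W) (differentiable_deriv_weierstrassSigma L) i j i j).mul
    (isAnalyticFamily_const (sigmaDiff L i j))
  have h2 := (isAnalyticFamily_shift (W := W) (differentiable_weierstrassSigma L) i j i j).mul
    (isAnalyticFamily_const (diffEntire (differentiable_deriv_weierstrassSigma L) i j))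
  exact fun v hv x => (h1 v hv x).sub (h2 v hv x)

theorem sigmaWronskian_zero (i j : Fin n) : sigmaWronskian L 0 i j = 0 :=
  Subtype.ext (funext fun x => by
    rw [sigmaWronskian_apply, sub_zero, mul_comm, sub_self]
    rfl)

theorem dPhiTerm_mem_fam {i j : Fin n} (hij : i ≠ j) : dPhiTerm L i j ∈ fam (regSet n L) := by
  refine coeff_smul_mem_fam (IsAnalyticFamily.mul (isAnalyticFamily_scalar fun v hv => ?_)
    (divDiff_spec (isOpen_regSet L) hij (isAnalyticFamily_sigmaWronskian L i j)
      fun v _ h => by rw [h, sub_self, sigmaWronskian_zero]).1) _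
  have h : AnalyticAt ℂ (fun v : Fin n → ℂ => sigmaProd L (v i - v j)) v :=
    ((differentiable_sigmaProd L).analyticAt _).comp (f := fun v : Fin n → ℂ => v i - v j)
      (analyticAt_sub_apply i j v)
  exact (h.inv (sigmaProd_ne_zero_of_regSet L hv i j)).neg

theorem dPhiTerm_eq {v : Fin n → ℂ} (hv : v ∈ generic n L) {i j : Fin n} (hij : i ≠ j) :
    dPhiTerm L i j v =
      single (Equiv.swap i j) (mulOp (pd i (ellPhi L (v i - v j) i j))) := by
  have h1 := (divDiff_spec (isOpen_regSet L) hij (isAnalyticFamily_sigmaWronskian L i j)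
      fun v _ h => by rw [h, sub_self, sigmaWronskian_zero]).2.1 v (generic_subset_regSet hv)
  have hne := sub_ne_zero.mpr (ne_of_generic hv hij)
  rw [mer_smul_single, pd_ellPhi L _ hij, Pi.single_eq_same, Pi.single_eq_of_ne hij.symm, sub_zero,
    one_smul, h1, dPhiTerm, smul_smul, div_eq_mul_inv, map_mul, map_mul,
    ← IsScalarTower.algebraMap_apply, ← IsScalarTower.algebraMap_apply, ← smul_mul_assoc,
    ← Algebra.smul_def, ← Algebra.smul_def, smul_smul]
  congr 4
  rw [weierstrassSigma_eq, sigmaProd_neg, mul_inv, inv_neg]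
  field_simp

/-- The limit of `∂_z φ(μ, z)` at `μ = 0` is `-℘(z)`. -/
theorem dPhiTerm_zero {i j : Fin n} (hij : i ≠ j) :
    dPhiTerm L i j 0 = -(ellP L i j • single (Equiv.swap i j) 1) := by
  have h1 := (divDiff_spec (isOpen_regSet L) hij (isAnalyticFamily_sigmaWronskian L i j)
      fun v _ h => by rw [h, sub_self, sigmaWronskian_zero]).2.2 0 (zero_mem_regSet L)
  have h2 : divDiff i j (fun v => sigmaWronskian L (v i - v j) i j) 0 = sigmaSqPDiff L i j := by
    refine Subtype.ext (funext fun x => ?_)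
    rw [h1 x, divLinear, if_pos (by simp [diffForm_apply])]
    set f : (Fin n → ℂ) × (Fin n → ℂ) → ℂ :=
      fun p => (sigmaWronskian L (p.1 i - p.1 j) i j).1 p.2 with hf
    have hfd : HasFDerivAt f (fderiv ℂ f (0, x)) ((0 : ℂ) • Pi.single i 1, x) := by
      rw [zero_smul]
      exact (isAnalyticFamily_sigmaWronskian L (W := regSet n L) i j 0 (zero_mem_regSet L)
        x).differentiableAt.hasFDerivAt
    have hl : HasDerivAt (fun t : ℂ => ((t • Pi.single i 1, x) : (Fin n → ℂ) × (Fin n → ℂ)))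
        (Pi.single i 1, 0) 0 := by
      have := ((hasDerivAt_id (0 : ℂ)).smul_const (Pi.single i 1 : Fin n → ℂ)).prodMk
        (hasDerivAt_const (0 : ℂ) x)
      simpa using this
    have h3 := hfd.comp_hasDerivAt (0 : ℂ) hl
    set z := x i - x j
    have h4 : (f ∘ fun t : ℂ => ((t • Pi.single i 1, x) : (Fin n → ℂ) × (Fin n → ℂ))) = fun t =>
        deriv (weierstrassSigma L) (z - t) * weierstrassSigma L z -
          weierstrassSigma L (z - t) * deriv (weierstrassSigma L) z := by
      ext1 t
      rw [Function.comp_apply, hf]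
      simp only [sigmaWronskian_apply, Pi.smul_apply, Pi.single_eq_same,
        Pi.single_eq_of_ne hij.symm, smul_eq_mul, mul_one, mul_zero, sub_zero]
      rfl
    have hz : HasDerivAt (fun t : ℂ => z - t) (-1) 0 := by
      simpa using (hasDerivAt_id (0 : ℂ)).const_sub z
    have d1 := (differentiable_weierstrassSigma L (z - 0)).hasDerivAt.comp (0 : ℂ) hz
    have d2 := (differentiable_deriv_weierstrassSigma L (z - 0)).hasDerivAt.comp (0 : ℂ) hz
    have h5 := (d2.mul_const (weierstrassSigma L z)).sub
      (d1.mul_const (deriv (weierstrassSigma L) z))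
    rw [h4] at h3
    rw [h3.unique h5, sub_zero]
    change _ = sigmaSqP L z
    rw [sigmaSqP]
    ring
  rw [dPhiTerm, h2, Pi.zero_apply, Pi.zero_apply, sub_zero, sigmaProd_zero, inv_one, map_neg,
    map_one,
    neg_one_mul, map_neg, neg_smul, smul_smul, ellP_eq L hij, div_eq_mul_inv]

theorem ellP_swap (i j : Fin n) : ellP L j i = ellP L i j :=
  congrArg ofFun (funext fun x => by rw [← neg_sub, L.weierstrassP_neg])

/-- The sum of the squares of the elliptic Dunkl operators. -/
theorem sum_ellDunkl_sq {v : Fin n → ℂ} (hv : v ∈ generic n L) :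
    ∑ i, ellDunkl L ħ κ v i ^ 2 = ∑ i, single 1 (ħ ^ 2 • dOp i ^ 2) -
      (κ * ħ) • ∑ i, ∑ j ∈ Finset.univ.erase i, dPhiTerm L i j v +
      κ ^ 2 • ∑ i, ∑ j ∈ Finset.univ.erase i,
        (algebraMap ℂ (Crossed n) (L.weierstrassP (v i - v j)) - merHom (ellP L i j)) := by
  simp only [ellDunkl_eq_sum]
  rw [sum_sq_of_threeTerm κ (fun i : Fin n => single 1 (ħ • dOp i)) (fun i j => phiTerm L i j v)
    (fun i => phiTerm_self L i v)
    (fun i j l => dunkl_threeTerm (fun i j a b => mulOp (ellPhi L (v i - v j) a b))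
      (fun w i j a b => by rw [smul_mulOp, permMer_ellPhi])
      (fun i j a b => mulOp_ellPhi_neg L _ _ (neg_sub _ _).symm a b)
      (fun i j l => mulOp_ellPhi_three_term L hv))]
  have e1 : ∀ i : Fin n, (single 1 (ħ • dOp i) : Crossed n) ^ 2 = single 1 (ħ ^ 2 • dOp i ^ 2) := by
    intro i
    rw [sq, single_mul_single, one_smul, one_mul, smul_mul_smul_comm, sq, sq]
  have e2 : ∀ i j : Fin n, i ≠ j →
      (single 1 (ħ • dOp i) : Crossed n) * phiTerm L i j v +
          phiTerm L i j v * single 1 (ħ • dOp i) =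
        ħ • dPhiTerm L i j v + ħ • (single (Equiv.swap i j)
          (mulOp (ellPhi L (v i - v j) i j) * (dOp i + dOp j)) : Crossed n) := by
    intro i j hij
    rw [dPhiTerm_eq L hv hij, phiTerm, single_mul_single, single_mul_single, one_smul, one_mul,
      mul_one, smul_smul_dOp, Equiv.swap_apply_left, smul_mul_assoc, mul_smul_comm, dOp_mul_mulOp,
      smul_single, smul_single, ← single_add, ← single_add, ← smul_add, ← smul_add, mul_add]
    congr 2
    abel
  have e3 : ∑ i, ∑ j, ((single 1 (ħ • dOp i) : Crossed n) * phiTerm L i j v +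
      phiTerm L i j v * single 1 (ħ • dOp i)) =
      ħ • ∑ i, ∑ j ∈ Finset.univ.erase i, dPhiTerm L i j v := by
    have h0 : ∑ i, ∑ j, (single (Equiv.swap i j)
        (mulOp (ellPhi L (v i - v j) i j) * (dOp i + dOp j)) : Crossed n) = 0 := by
      refine sum_sum_eq_zero_of_antisymm _ fun i j => ?_
      rw [mulOp_ellPhi_neg L (v i - v j) (v j - v i) (neg_sub _ _).symm, neg_mul, Equiv.swap_comm,
        add_comm (dOp j), SkewMonoidAlgebra.single_neg]
    rw [← add_zero (ħ • _), ← smul_zero ħ, ← h0, ← smul_add, ← Finset.sum_add_distrib,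
      Finset.smul_sum]
    refine Finset.sum_congr rfl fun i _ => ?_
    rw [← sum_erase_eq_sum (i := i) (by rw [phiTerm_self, mul_zero, zero_mul, add_zero]),
      ← sum_erase_eq_sum (f := fun j => (single (Equiv.swap i j)
        (mulOp (ellPhi L (v i - v j) i j) * (dOp i + dOp j)) : Crossed n)) (i := i)
      (by rw [ellPhi_diag, show mulOp (0 : Mer n) = 0 from map_zero mulOpHom, zero_mul,
        single_zero]),
      ← Finset.sum_add_distrib, Finset.smul_sum]
    refine Finset.sum_congr rfl fun j hj => ?_
    rw [e2 i j (Finset.ne_of_mem_erase hj).symm, smul_add]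
  have e4 : ∀ i : Fin n, ∑ j, phiTerm L i j v * phiTerm L i j v = ∑ j ∈ Finset.univ.erase i,
      (algebraMap ℂ (Crossed n) (L.weierstrassP (v i - v j)) - merHom (ellP L i j)) := by
    intro i
    rw [← sum_erase_eq_sum (i := i) (by rw [phiTerm_self, mul_zero])]
    exact Finset.sum_congr rfl fun j hj => phiTerm_sq L hv (Finset.ne_of_mem_erase hj).symm
  rw [e3, smul_smul]
  simp only [e1, e4]

theorem isSymmetric_sum_X_pow (m : ℕ) :
    (∑ i : Fin n, (MvPolynomial.X i : MvPolynomial (Fin n) ℂ) ^ m).IsSymmetric := by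
  intro w
  simp only [map_sum, map_pow, MvPolynomial.rename_X]
  exact Equiv.sum_comp w fun i => (MvPolynomial.X i : MvPolynomial (Fin n) ℂ) ^ m

/-- The poles `κ² / (v_i - v_j)²` of the sum of squares are those subtracted in the rational
Hamiltonian, and the regular part `℘(μ) - 1 / μ²` vanishes at `μ = 0`. -/
theorem limHam_sum_X_sq : limHam L ħ κ (∑ i : Fin n, MvPolynomial.X i ^ 2) =
    ∑ i, single 1 (ħ ^ 2 • dOp i ^ 2) -
      (κ * ħ) • ∑ i, ∑ j ∈ Finset.univ.erase i, dPhiTerm L i j 0 -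
      κ ^ 2 • ∑ i, ∑ j ∈ Finset.univ.erase i, merHom (ellP L i j) := by
  -- `weierstrassPExcept 0` is `℘(z) - 1 / z²`
  set N : (Fin n → ℂ) → Crossed n := fun v => ∑ i, single 1 (ħ ^ 2 • dOp i ^ 2) -
      (κ * ħ) • ∑ i, ∑ j ∈ Finset.univ.erase i, dPhiTerm L i j v +
      κ ^ 2 • ∑ i, ∑ j ∈ Finset.univ.erase i,
        (algebraMap ℂ (Crossed n) (L.weierstrassPExcept 0 (v i - v j)) - merHom (ellP L i j))
    with hN
  have hNm : N ∈ fam (regSet n L) := by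
    have h1 : ∀ i j : Fin n, i ≠ j → dPhiTerm L i j ∈ fam (regSet n L) :=
      fun i j => dPhiTerm_mem_fam L
    have h2 : ∀ i j : Fin n, (fun v : Fin n → ℂ =>
        algebraMap ℂ (Crossed n) (L.weierstrassPExcept 0 (v i - v j)) - merHom (ellP L i j)) ∈
        fam (regSet n L) := fun i j => sub_mem
      (scalar_mem_fam fun v hv => analyticAt_weierstrassPExcept hv i j) (const_mem_fam _)
    have h3 := add_mem (sub_mem (const_mem_fam (W := regSet n L)
      (∑ i : Fin n, (single 1 (ħ ^ 2 • dOp i ^ 2) : Crossed n)))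
      ((fam (regSet n L)).smul_mem (sum_mem (t := Finset.univ) fun i _ =>
        sum_mem (t := Finset.univ.erase i) fun j hj =>
          h1 i j (Finset.ne_of_mem_erase hj).symm) (κ * ħ)))
      ((fam (regSet n L)).smul_mem (sum_mem (t := Finset.univ) fun i _ =>
        sum_mem (t := Finset.univ.erase i) fun j _ => h2 i j) (κ ^ 2))
    convert! h3 using 1
    ext1 v
    simp only [hN, Finset.sum_apply, Pi.add_apply, Pi.sub_apply, Pi.smul_apply]
  have hlim : limHam L ħ κ (∑ i : Fin n, MvPolynomial.X i ^ 2) = N 0 := by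
    refine limHam_eq hNm fun v hv => ?_
    have hm := mom_mem_regularObs v
    have hr := fun i j => pow_mem (cl_recip_mem_regularObs hv i j) 2
    have hs : ∀ i, ∑ j, cl (recip i j) ^ 2 ∈ regularObs v := fun i => sum_mem fun j _ => hr i j
    rw [ratHam_sum_X_sq, substDunkl_sub ħ κ hv (sum_mem fun i _ => pow_mem (hm i) 2)
      ((regularObs v).smul_mem (sum_mem fun i _ => hs i) _),
      substDunkl_smul ħ κ hv (sum_mem fun i _ => hs i),
      substDunkl_sum ħ κ hv _ _ (fun i => pow_mem (hm i) 2), substDunkl_sum ħ κ hv _ _ hs]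
    simp only [substDunkl_sum ħ κ hv _ _ (hr _),
      substDunkl_pow ħ κ hv (hm _), substDunkl_mom ħ κ hv]
    rw [sum_ellDunkl_sq L ħ κ hv, hN, add_sub_assoc, ← smul_sub, ← Finset.sum_sub_distrib]
    refine congrArg _ (congrArg _ (Finset.sum_congr rfl fun i _ => ?_))
    rw [← sum_erase_eq_sum (i := i) (by
      rw [substDunkl_pow ħ κ hv (cl_recip_mem_regularObs hv i i), substDunkl_recip_self ħ κ hv,
        zero_pow two_ne_zero]),
      ← Finset.sum_sub_distrib]
    refine Finset.sum_congr rfl fun j hj => ?_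
    rw [substDunkl_pow ħ κ hv (cl_recip_mem_regularObs hv i j),
      substDunkl_recip ħ κ hv (Finset.ne_of_mem_erase hj).symm, weierstrassP_eq, map_add, one_div,
      ← inv_pow, map_pow]
    abel
  rw [hlim, hN]
  simp only [Pi.zero_apply, sub_zero, PeriodPair.weierstrassPExcept_zero, map_zero, zero_sub,
    Finset.sum_neg_distrib, smul_neg]
  abel

theorem spinHam_sum_X : spinHam L ħ κ (∑ i : Fin n, MvPolynomial.X i) = totalMomentum n ħ := by
  rw [spinHam_eq, limHam_sum_X, map_sum, totalMomentum]
  simp only [resHatLin_single, inv_one, hat_one]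

theorem spinHam_sum_X_sq :
    spinHam L ħ κ (∑ i : Fin n, MvPolynomial.X i ^ 2) = spinCMHam n L ħ κ := by
  rw [spinHam_eq, limHam_sum_X_sq, spinCMHam]
  set T : Fin n → Fin n → SpinAlg n := fun i j =>
    mulOp (ellP L i j) ⊗ₜ[ℂ] (κ • (κ • 1 - ħ • hat (Equiv.swap i j))) with hT
  have h1 : ∀ i j : Fin n, i ≠ j → (κ * ħ) • resHatLin (dPhiTerm L i j 0) +
      κ ^ 2 • resHatLin (merHom (ellP L i j)) = T i j := by
    intro i j hij
    rw [dPhiTerm_zero L hij, ← mer_smul_single, merHom_apply, map_neg, resHatLin_single,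
      resHatLin_single, inv_one, hat_one, Equiv.swap_inv, hT]
    simp only [TensorProduct.tmul_sub, TensorProduct.tmul_smul, smul_sub]
    module
  have hsym : ∀ i j : Fin n, i ≠ j → T j i = T i j := by
    intro i j hij
    simp only [hT]
    rw [ellP_swap L i j, Equiv.swap_comm]
  have h2 : ∑ i, ∑ j ∈ Finset.univ.erase i, T i j =
      (2 : ℂ) • ∑ i, ∑ j ∈ Finset.univ.filter (fun j => i < j), T i j := by
    have h3 : ∀ i : Fin n, ∑ j ∈ Finset.univ.erase i, T i j =
        ∑ j ∈ Finset.univ.filter (fun j => i < j), T i j +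
          ∑ j ∈ Finset.univ.filter (fun j => j < i), T i j := by
      intro i
      rw [← Finset.sum_union]
      · refine Finset.sum_congr ?_ fun _ _ => rfl
        ext j
        simp only [Finset.mem_erase, Finset.mem_univ, and_true, Finset.mem_union,
          Finset.mem_filter, true_and]
        rw [ne_comm, lt_or_lt_iff_ne]
      · rw [Finset.disjoint_left]
        intro j hj hj'
        simp only [Finset.mem_filter, Finset.mem_univ, true_and] at hj hj'
        exact lt_asymm hj hj'
    have h4 : ∑ i, ∑ j ∈ Finset.univ.filter (fun j => j < i), T i j =
        ∑ i, ∑ j ∈ Finset.univ.filter (fun j => i < j), T i j := by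
      simp only [Finset.sum_filter]
      rw [Finset.sum_comm]
      refine Finset.sum_congr rfl fun i _ => Finset.sum_congr rfl fun j _ => ?_
      split_ifs with h
      · exact hsym i j h.ne
      · rfl
    rw [Finset.sum_congr rfl fun i _ => h3 i, Finset.sum_add_distrib, h4, two_smul]
  change _ = _ - (2 : ℂ) • ∑ i, ∑ j ∈ Finset.univ.filter (fun j => i < j), T i j
  rw [← h2, map_sub, map_sub, map_smul, map_smul, map_sum, map_sum, map_sum, sub_sub]
  simp only [map_sum, resHatLin_single, inv_one, hat_one]
  congr 1
  rw [Finset.smul_sum, Finset.smul_sum, ← Finset.sum_add_distrib]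
  refine Finset.sum_congr rfl fun i _ => ?_
  rw [Finset.smul_sum, Finset.smul_sum, ← Finset.sum_add_distrib]
  exact Finset.sum_congr rfl fun j hj => h1 i j (Finset.ne_of_mem_erase hj).symm

theorem existsUnique_hasRegularLimit {q : MvPolynomial (Fin n) ℂ} (hq : q.IsSymmetric) :
    ∃! G : Crossed n, HasRegularLimit L (substDunkl L ħ κ (ratHam κ q)) G := by
  obtain ⟨N, hN, h⟩ := extends_ratHam (L := L) ħ κ hq
  exact ⟨N 0, hasRegularLimit_of_fam hN h, fun G hG => hG.unique (hasRegularLimit_of_fam hN h)⟩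

end Explicit

end SpinCM

end

theorem mainTheorem5 (n : ℕ) (τ : UpperHalfPlane) (ħ κ : ℂ) (hħ : ħ ≠ 0) :
    (∀ q : MvPolynomial (Fin n) ℂ, q.IsSymmetric →
      ∃! G : SpinCM.Crossed n, SpinCM.HasRegularLimit (SpinCM.periods τ)
        (SpinCM.substDunkl (SpinCM.periods τ) ħ κ (SpinCM.ratHam κ q)) G) ∧
    (∃ S : Subalgebra ℂ (SpinCM.SpinAlg n),
      (S : Set (SpinCM.SpinAlg n)) =
        {a | ∃ q : MvPolynomial (Fin n) ℂ, q.IsSymmetric ∧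
          a = SpinCM.spinHam (SpinCM.periods τ) ħ κ q} ∧
      S ≤ SpinCM.spinInvariants n ∧
      (∀ a ∈ S, ∀ b ∈ S, a * b = b * a) ∧
      SpinCM.totalMomentum n ħ ∈ S ∧
      SpinCM.spinCMHam n (SpinCM.periods τ) ħ κ ∈ S) ∧
    SpinCM.spinHam (SpinCM.periods τ) ħ κ (∑ i : Fin n, MvPolynomial.X i) =
      SpinCM.totalMomentum n ħ ∧
    SpinCM.spinHam (SpinCM.periods τ) ħ κ (∑ i : Fin n, MvPolynomial.X i ^ 2) =
      SpinCM.spinCMHam n (SpinCM.periods τ) ħ κ := by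
  have h1 := SpinCM.spinHam_sum_X (n := n) (SpinCM.periods τ) ħ κ
  have h2 := SpinCM.spinHam_sum_X_sq (n := n) (SpinCM.periods τ) ħ κ
  refine ⟨fun q hq => SpinCM.existsUnique_hasRegularLimit (SpinCM.periods τ) ħ κ hq,
    ⟨SpinCM.spinHamAlg n (SpinCM.periods τ) ħ κ, rfl,
      SpinCM.spinHamAlg_le_spinInvariants (SpinCM.periods τ) ħ κ,
      fun a ha b hb => SpinCM.spinHamAlg_mul_comm (SpinCM.periods τ) ħ κ ha hb,
      ⟨_, ?_, h1.symm⟩, ⟨_, SpinCM.isSymmetric_sum_X_pow 2, h2.symm⟩⟩, h1, h2⟩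
  simpa using SpinCM.isSymmetric_sum_X_pow (n := n) 1
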